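/- **Setting.** Let $M\ge 1$ procedures observe data $(x_{ji},y_{ji})$, $i=1,2,\dots$, $j=1,\dots,M$, from the linear model $y_{ji}=x_{ji}^\top\beta_0+\epsilon_{ji}$, with nonrandom covariates $x_{ji}\in\mathbb R^p$, an unknown $\beta_0\in\mathbb R^p$, $\beta_0\neq 0$, and random errors $\epsilon_{ji}$ that are mutually independent, identically distributed within each procedure, with mean $0$ and variance $\sigma^2>0$. Assume that for each $j$, $\lim_{n\to\infty}\frac1n\sum_{i=1}^n x_{ji}x_{ji}^\top=\Sigma$, where $\Sigma$ is positive definite and does not depend on $j$. Let $p_0$ be the number of nonzero components of $\beta_0$, and $I_0=\operatorname{diag}\{1(\beta_{01}\ne0),\dots,1(\beta_{0p}\ne0)\}$. Let $0<\alpha<1$, $n_0>p$, $\varepsilon>0$, $\gamma>0$, $0<\delta<1/2$, and let $\lambda(n)$ be a nonrandom sequence with $n^{1/2}\lambda(n)\to0$ and $n^{1/2+\gamma\delta}\lambda(n)\to\infty$. Let $\chi_m(\alpha)$ denote the $1-\alpha$ quantile of the chi-square distribution with $m$ degrees of freedom. Let $X_{jk}$ be the $p\times k$ matrix with columns $x_{j1},\dots,x_{jk}$.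 **One procedure.** At stage $k$, let $\hat\beta_{jk}$ be the least squares estimate from the first $k$ observations of procedure $j$, let $\hat\sigma^2_{jk}=\frac1{k-p}\sum_{i=1}^k(y_{ji}-x_{ji}^\top\hat\beta_{jk})^2$, let $I_{jk}$ be the diagonal matrix with entries $I_{jk}^l=1\big(\sqrt k\,\lambda(k)|\hat\beta_{jk}^l|^{-\gamma}<\varepsilon\big)$ (equal to $0$ if $\hat\beta^l_{jk}=0$), $\hat p_{0j}(k)=\sum_l I_{jk}^l$, $\beta^*_{jk}=I_{jk}\hat\beta_{jk}$, $\tilde a_{jk}^2=\chi_{\hat p_{0j}(k)}(\alpha)/M$ and $\tilde\mu_{jk}=\lambda_{\max}[k\,I_{jk}(X_{jk}X_{jk}^\top)^{-1}I_{jk}]$. For $d>0$ put $$\tilde N_j=\inf\Big\{k\ge n_0:\ \hat\sigma_{jk}^2+\tfrac1k\le\frac{d^2k}{\tilde a_{jk}^2\tilde\mu_{jk}}\Big\},$$ where the inequality counts as not fulfilled at stages where its right-hand side is undefined (that is, where $X_{jk}X_{jk}^\top$ is singular or $\hat p_{0j}(k)=0$). **Combination.** Let $\tilde N=\sum_j\tilde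 N_j$, $\rho_j=\tilde N_j/\tilde N$, $I^*=\prod_{j}I_{j\tilde N_j}$, $\hat p_0=\operatorname{tr}I^*$, $\tilde\beta=I^*\sum_j\rho_j\beta^*_{j\tilde N_j}$, $G=\sum_jX_{j\tilde N_j}X_{j\tilde N_j}^\top$ and $\nu=\lambda_{\max}(\tilde N\,I^*G^{-1}I^*)$. Permute the coordinates so that those with $I^*_{ll}=1$ come first, partition $G$ accordingly into blocks $\Sigma_{11},\Sigma_{12},\Sigma_{12}^\top,\Sigma_{22}$, and put $\tilde\Sigma_{11}=\Sigma_{11}-\Sigma_{12}\Sigma_{22}^{-1}\Sigma_{12}^\top$. For $z\in\mathbb R^p$ let $S(z)=(z-\tilde\beta)^\top\operatorname{diag}(\tilde\Sigma_{11},0)(z-\tilde\beta)$ in the permuted coordinates. The combined confidence set is $$R_{\tilde N}=\Big\{z\in\mathbb R^p:\ \frac{S(z)}{\tilde N}\le\frac{d^2}{\nu}\ \text{ and } z_l=0\text{ whenever } I^*_{ll}=0\Big\}.$$ **Theorem.** Let $a^2=\chi_{p_0}(\alpha)$ and $\tilde\mu=\lambda_{\max}(I_0\Sigma^{-1}I_0)$.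 Almost surely $\tilde N<\infty$ for all $d>0$, and as $d\to0^+$: 1. $P(\beta_0\in R_{\tilde N})\to1-\alpha$; 2. $\dfrac{d^2\tilde N}{a^2\sigma^2\tilde\mu}\to1$ almost surely; 3. $E(\tilde N)<\infty$ for all sufficiently small $d$, and $\dfrac{d^2E(\tilde N)}{a^2\sigma^2\tilde\mu}\to1$. Moreover, $\hat p_0\to p_0$ almost surely and $E(\hat p_0)\to p_0$; for each $j$ the same holds for the number $\hat p_{0j}(\tilde N_j)$ of variables selected by procedure $j$ when it stops. -/

import Mathlib

open Filter Topology MeasureTheory ProbabilityTheory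

namespace DistSeq

/-- The chi-square distribution with `m` degrees of freedom: the law of the sum of squares of `m`
independent standard normal variables (the point mass at `0` when `m = 0`). -/
noncomputable def chiSq (m : ℕ) : Measure ℝ :=
  (Measure.pi fun _ : Fin m => gaussianReal 0 1).map fun z => ∑ i, z i ^ 2

/-- The `1 - α` quantile of the chi-square distribution with `m` degrees of freedom. -/
noncomputable def chiSqQuantile (m : ℕ) (α : ℝ) : ℝ :=
  sInf {q : ℝ | 1 - α ≤ (chiSq m).real (Set.Iic q)}

/-- The largest eigenvalue of a (symmetric) real matrix. -/
noncomputable def lambdaMax {p : ℕ} (A : Matrix (Fin p) (Fin p) ℝ) : ℝ :=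
  sSup (spectrum ℝ A)

/-- The `p × n` design matrix whose columns are the first `n` covariate vectors. -/
def designMatrix {p : ℕ} (x : ℕ → Fin p → ℝ) (n : ℕ) : Matrix (Fin p) (Fin n) ℝ :=
  Matrix.of fun l i => x i l

/-- The information matrix `X Xᵀ` of the first `n` observations. -/
def infoMatrix {p : ℕ} (x : ℕ → Fin p → ℝ) (n : ℕ) : Matrix (Fin p) (Fin p) ℝ :=
  designMatrix x n * (designMatrix x n).transpose

/-- The least squares estimate `(X Xᵀ)⁻¹ X y` from the first `n` observations. -/
noncomputable def lse {p : ℕ} (x : ℕ → Fin p → ℝ) (y : ℕ → ℝ) (n : ℕ) : Fin p → ℝ :=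
  (infoMatrix x n)⁻¹.mulVec ((designMatrix x n).mulVec fun i => y i)

/-- The residual estimate of the error variance from the first `n` observations. -/
noncomputable def sigmaSqHat {p : ℕ} (x : ℕ → Fin p → ℝ) (y : ℕ → ℝ) (n : ℕ) : ℝ :=
  1 / ((n : ℝ) - p) * ∑ i : Fin n, (y i - x i ⬝ᵥ lse x y n) ^ 2

/-- The tuning constants of the procedure: the initial sample size `n₀`, the level `α`, and the
cutting parameter `ε`, the exponent `γ` and the sequence `λ(n)` of the adaptive shrinkage. -/
structure Tuning where
  n₀ : ℕ
  α : ℝ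
  ε : ℝ
  γ : ℝ
  lam : ℕ → ℝ

section OneProcedure

variable {p : ℕ} (T : Tuning) (x : ℕ → Fin p → ℝ) (y : ℕ → ℝ)

open Classical in
/-- The indicator that `√n λ(n) |β̂ₗ|^(-γ) < ε` at stage `n`, where `β̂` is the least squares
estimate; for `β̂ₗ = 0` the left side is infinite, so the indicator is `0`. -/
noncomputable def ind (n : ℕ) (l : Fin p) : ℕ :=
  if lse x y n l ≠ 0 ∧ Real.sqrt n * (T.lam n * |lse x y n l| ^ (-T.γ)) < T.ε then 1 else 0

/-- The diagonal matrix of the indicators at stage `n`. -/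
noncomputable def indMatrix (n : ℕ) : Matrix (Fin p) (Fin p) ℝ :=
  Matrix.diagonal fun l => (ind T x y n l : ℝ)

/-- The estimated number of effective variables at stage `n`. -/
noncomputable def pHat (n : ℕ) : ℕ := ∑ l, ind T x y n l

/-- The adaptive shrinkage estimate at stage `n`. -/
noncomputable def aseEst (n : ℕ) : Fin p → ℝ := (indMatrix T x y n).mulVec (lse x y n)

/-- The largest eigenvalue of `k I (X Xᵀ)⁻¹ I` at stage `k`, with `I` the matrix of indicators. -/
noncomputable def muTilde (k : ℕ) : ℝ :=
  lambdaMax ((k : ℝ) • (indMatrix T x y k * (infoMatrix x k)⁻¹ * indMatrix T x y k))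

/-- The stopping inequality for one of `M` procedures at stage `k` and precision `d`. It is
fulfilled only if its right-hand side is defined, i.e. if `X Xᵀ` is invertible and at least one
variable is selected (then both factors of the denominator are positive). -/
def StopsAt (M : ℕ) (d : ℝ) (k : ℕ) : Prop :=
  IsUnit (infoMatrix x k) ∧ 0 < pHat T x y k ∧
    sigmaSqHat x y k + 1 / k ≤
      d ^ 2 * k / (chiSqQuantile (pHat T x y k) T.α / M * muTilde T x y k)

/-- The set of stages at which one of `M` procedures may stop. -/
def stopSet (M : ℕ) (d : ℝ) : Set ℕ := {k | T.n₀ ≤ k ∧ StopsAt T x y M d k}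

/-- The stopping time of one of `M` procedures: the least element of `stopSet` (the value on an
empty `stopSet` is irrelevant). -/
noncomputable def stopTime (M : ℕ) (d : ℝ) : ℕ := sInf (stopSet T x y M d)

end OneProcedure

section Combined

variable {p M : ℕ} (T : Tuning) (x : Fin M → ℕ → Fin p → ℝ) (y : Fin M → ℕ → ℝ) (d : ℝ)

/-- The stopping time of procedure `j`. -/
noncomputable def stopN (j : Fin M) : ℕ := stopTime T (x j) (y j) M d

/-- The total number of observations used. -/
noncomputable def totalN : ℕ := ∑ j, stopN T x y d j

/-- The element-wise product over the procedures of the indicators at the stopping times. -/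
noncomputable def combInd (l : Fin p) : ℕ := ∏ j, ind T (x j) (y j) (stopN T x y d j) l

/-- The diagonal matrix of the combined indicators. -/
noncomputable def combMatrix : Matrix (Fin p) (Fin p) ℝ :=
  Matrix.diagonal fun l => (combInd T x y d l : ℝ)

/-- The number of variables selected by all procedures. -/
noncomputable def combPHat : ℕ := ∑ l, combInd T x y d l

/-- The combined adaptive shrinkage estimate, with weights proportional to the stopping times. -/
noncomputable def combEst : Fin p → ℝ :=
  (combMatrix T x y d).mulVec
    (∑ j, ((stopN T x y d j : ℝ) / totalN T x y d) • aseEst T (x j) (y j) (stopN T x y d j))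

/-- The sum of the information matrices of all procedures at their stopping times. -/
noncomputable def combInfo : Matrix (Fin p) (Fin p) ℝ := ∑ j, infoMatrix (x j) (stopN T x y d j)

/-- The Schur complement `Σ₁₁ - Σ₁₂ Σ₂₂⁻¹ Σ₁₂ᵀ` of the total information matrix, partitioned into
the selected (first block) and the unselected (second block) variables. -/
noncomputable def schurSel :
    Matrix {l : Fin p // combInd T x y d l = 1} {l : Fin p // combInd T x y d l = 1} ℝ :=
  let G := combInfo T x y d
  let s : Fin p → Prop := fun l => combInd T x y d l = 1
  let u : Fin p → Prop := fun l => ¬ combInd T x y d l = 1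
  G.toBlock s s - G.toBlock s u * (G.toBlock u u)⁻¹ * (G.toBlock s u).transpose

/-- The quadratic form in `z - β̃`, after the coordinates are permuted so that the selected ones
come first, with the matrix `diag(Σ̃₁₁, 0)`. -/
noncomputable def quadS (z : Fin p → ℝ) : ℝ :=
  let v : {l : Fin p // combInd T x y d l = 1} ⊕ {l : Fin p // ¬ combInd T x y d l = 1} → ℝ :=
    fun i => (z - combEst T x y d) (Sum.elim Subtype.val Subtype.val i)
  v ⬝ᵥ (Matrix.fromBlocks (schurSel T x y d) 0 0 0).mulVec v

/-- The largest eigenvalue of `N I* {∑ⱼ Xⱼ Xⱼᵀ}⁻¹ I*`, with `N` the total number of observations. -/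
noncomputable def nuTilde : ℝ :=
  lambdaMax ((totalN T x y d : ℝ) •
    (combMatrix T x y d * (combInfo T x y d)⁻¹ * combMatrix T x y d))

/-- The combined confidence set. -/
def confSet : Set (Fin p → ℝ) :=
  {z | quadS T x y d z / totalN T x y d ≤ d ^ 2 / nuTilde T x y d ∧
    ∀ l, combInd T x y d l = 0 → z l = 0}

end Combined

open Classical in
/-- The number of nonzero components of the true parameter. -/
noncomputable def trueP {p : ℕ} (β₀ : Fin p → ℝ) : ℕ := ∑ l, if β₀ l ≠ 0 then 1 else 0

open Classical in
/-- The diagonal matrix of the indicators of the nonzero components of the true parameter. -/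
noncomputable def trueInd {p : ℕ} (β₀ : Fin p → ℝ) : Matrix (Fin p) (Fin p) ℝ :=
  Matrix.diagonal fun l => if β₀ l ≠ 0 then 1 else 0

end DistSeq

/-! Almost surely, for every procedure, the scores `X e` are `o(n ^ (1 - δ))` and the averages of
the squared errors tend to `σ ^ 2`. The first fact follows from Kolmogorov's maximal inequality over
dyadic blocks (`ae_tendsto_sum_div_rpow`), the second from the strong law. Along such a path
everything is deterministic. Least squares errs by `o(n ^ (-δ))`, so the two rate conditions on `λ`
separate the variables: `√n λ(n) |β̂ₗ| ^ (-γ)` tends to zero if `β₀ₗ ≠ 0`, and otherwise it is at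
least `n ^ (1/2 + γδ) λ(n)`, which diverges. The selection is therefore eventually exact
(`eventually_ind_eq`), and the stopping rule is the first passage `g k ≤ d² k` of a function `g`
tending to `c = σ² a² μ̃ / M`. By `tendsto_firstPassage` each stopping time is finite, diverges as
`d → 0`, and satisfies `d² Nⱼ → c`. Summation over `j` gives claim 2; exact selection at the
stopping times and bounded convergence give the claims on the counts.

For claim 3, a late stage `k` passes without stopping only if the residual variance is large or no
variable is selected. Either way `d² k²` is at most a constant times the squared score plus the
squared errors plus one (`exists_bound_of_notMem_stopSet`). For the truncated time `t`, Wald's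
identities make the expectation of that bound linear in `E t`, so that `d² E t² ≤ C (E t + 1)`. This
inequality bounds `E (d² t)²` uniformly in the truncation and in `d ≤ 1`, and bounded second moments
turn almost sure convergence into convergence of expectations.

For claim 1, exact selection turns coverage into an inequality for a quadratic form in the
normalized scores (`mem_confSet_iff`). Its coefficients and threshold converge almost surely.
Anscombe's argument replaces the random sample sizes by `n = ⌊c / d²⌋`, and the central limit
theorem takes over. The limiting form is a multiple of a chi-square variable with `p₀` degrees of
freedom, because the Schur complement inverts the selected block of `Σ⁻¹`. After rescaling the
threshold is the quantile `a²`, where the continuous chi-square distribution function equals `1 -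
α`. -/

set_option linter.unusedSectionVars false

namespace DistSeq

/-! ### Stopped sums: Wald's identity, Kolmogorov's inequality, a strong law with rate -/

section StoppedSums

variable {Ω : Type*} [mΩ : MeasurableSpace Ω]

/-- The σ-algebra generated by the first `k` variables of a sequence. -/
@[reducible] def pastAlg (ξ : ℕ → Ω → ℝ) (k : ℕ) : MeasurableSpace Ω :=
  ⨆ i ∈ {i | i < k}, MeasurableSpace.comap (ξ i) inferInstance

theorem pastAlg_le {ξ : ℕ → Ω → ℝ} (hξ : ∀ i, Measurable (ξ i)) (k : ℕ) : pastAlg ξ k ≤ mΩ :=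
  iSup₂_le fun i _ => (hξ i).comap_le

theorem pastAlg_mono (ξ : ℕ → Ω → ℝ) {k m : ℕ} (h : k ≤ m) : pastAlg ξ k ≤ pastAlg ξ m :=
  biSup_mono fun _ hi => lt_of_lt_of_le hi h

theorem measurable_pastAlg (ξ : ℕ → Ω → ℝ) {i k : ℕ} (h : i < k) :
    Measurable[pastAlg ξ k] (ξ i) :=
  measurable_iff_comap_le.2
    (le_biSup (fun i => MeasurableSpace.comap (ξ i) inferInstance) (show i ∈ {i | i < k} from h))

variable {P : Measure Ω} [IsProbabilityMeasure P] {ξ : ℕ → Ω → ℝ} {σ : ℝ}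

theorem indep_pastAlg (hξ : ∀ i, Measurable (ξ i)) (hind : iIndepFun ξ P) (k : ℕ) :
    Indep (pastAlg ξ k) (MeasurableSpace.comap (ξ k) inferInstance) P := by
  suffices Indep (⨆ i ∈ {i | i < k}, MeasurableSpace.comap (ξ i) inferInstance)
      (⨆ i ∈ ({k} : Set ℕ), MeasurableSpace.comap (ξ i) inferInstance) P by
    rwa [iSup_singleton] at this
  exact indep_iSup_of_disjoint (fun i => (hξ i).comap_le) hind (by simp)

theorem indepFun_of_pastAlg (hξ : ∀ i, Measurable (ξ i)) (hind : iIndepFun ξ P) {k : ℕ}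
    {f : Ω → ℝ} (hf : Measurable[pastAlg ξ k] f) : IndepFun f (ξ k) P :=
  indep_of_indep_of_le_left (indep_pastAlg hξ hind k) hf.comap_le

/-- The sum of the terms `a i * ξ i`, `i < m`, over those `i` for which the event `A i` occurs. -/
noncomputable def stoppedSum (ξ : ℕ → Ω → ℝ) (a : ℕ → ℝ) (A : ℕ → Set Ω) (m : ℕ) (ω : Ω) : ℝ :=
  ∑ i ∈ Finset.range m, (A i).indicator (fun ω => a i * ξ i ω) ω

theorem measurable_stoppedSum (a : ℕ → ℝ) {A : ℕ → Set Ω}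
    (hA : ∀ i, MeasurableSet[pastAlg ξ i] (A i)) (m : ℕ) :
    Measurable[pastAlg ξ m] (stoppedSum ξ a A m) := by
  unfold stoppedSum
  refine Finset.measurable_fun_sum _ fun i hi => ?_
  have him := Finset.mem_range.1 hi
  exact Measurable.indicator ((measurable_pastAlg ξ him).const_mul _)
    (pastAlg_mono ξ him.le _ (hA i))

theorem memLp_stoppedSum (hξ : ∀ i, Measurable (ξ i)) (hL2 : ∀ i, MemLp (ξ i) 2 P) (a : ℕ → ℝ)
    {A : ℕ → Set Ω} (hA : ∀ i, MeasurableSet[pastAlg ξ i] (A i)) (m : ℕ) :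
    MemLp (stoppedSum ξ a A m) 2 P := by
  unfold stoppedSum
  exact memLp_finsetSum _ fun i _ =>
    ((hL2 i).const_mul _).indicator (pastAlg_le hξ i _ (hA i))

theorem integral_sq_of_variance (hL2 : ∀ i, MemLp (ξ i) 2 P)
    (hmean : ∀ i, ∫ ω, ξ i ω ∂P = 0) (hvar : ∀ i, variance (ξ i) P = σ ^ 2) (i : ℕ) :
    ∫ ω, ξ i ω ^ 2 ∂P = σ ^ 2 := by
  rw [← hvar i, variance_eq_integral (hL2 i).aemeasurable]
  simp [hmean i]

/-- For square integrable variables, the events being determined by the past, an event and the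
square of the next variable are independent. -/
theorem integral_indicator_sq (hξ : ∀ i, Measurable (ξ i)) (hind : iIndepFun ξ P)
    (hL2 : ∀ i, MemLp (ξ i) 2 P) (hmean : ∀ i, ∫ ω, ξ i ω ∂P = 0)
    (hvar : ∀ i, variance (ξ i) P = σ ^ 2) {m : ℕ} {A : Set Ω}
    (hA : MeasurableSet[pastAlg ξ m] A) :
    ∫ ω, A.indicator (fun ω => ξ m ω ^ 2) ω ∂P = σ ^ 2 * P.real A := by
  have h1 : IndepFun (A.indicator (fun _ => (1 : ℝ))) (fun ω => ξ m ω ^ 2) P :=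
    (indepFun_of_pastAlg hξ hind (measurable_const.indicator hA)).comp measurable_id
      (measurable_id.pow_const 2)
  have h2 := h1.integral_fun_mul_eq_mul_integral
    ((measurable_const.indicator (pastAlg_le hξ m _ hA)).aestronglyMeasurable)
    ((hξ m).pow_const 2).aestronglyMeasurable
  rw [integral_sq_of_variance hL2 hmean hvar,
    integral_indicator_const _ (pastAlg_le hξ m _ hA)] at h2
  simp only [smul_eq_mul, mul_one] at h2
  rw [mul_comm, ← h2]
  refine integral_congr_ae (ae_of_all _ fun ω => ?_)
  by_cases h : ω ∈ A <;> simp [h]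

/-- The second moment of a stopped sum of independent centred variables (Wald's identity). -/
theorem integral_stoppedSum_sq (hξ : ∀ i, Measurable (ξ i)) (hind : iIndepFun ξ P)
    (hL2 : ∀ i, MemLp (ξ i) 2 P) (hmean : ∀ i, ∫ ω, ξ i ω ∂P = 0)
    (hvar : ∀ i, variance (ξ i) P = σ ^ 2) (a : ℕ → ℝ) {A : ℕ → Set Ω}
    (hA : ∀ i, MeasurableSet[pastAlg ξ i] (A i)) (m : ℕ) :
    ∫ ω, stoppedSum ξ a A m ω ^ 2 ∂P =
      σ ^ 2 * ∑ i ∈ Finset.range m, a i ^ 2 * P.real (A i) := by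
  induction m with
  | zero => simp [stoppedSum]
  | succ m ih =>
    have hS := memLp_stoppedSum hξ hL2 a hA m
    have hAm := pastAlg_le hξ m _ (hA m)
    have hT : MemLp ((A m).indicator (fun ω => a m * ξ m ω)) 2 P :=
      ((hL2 m).const_mul _).indicator hAm
    -- Orthogonality of the increments: the stopped sum and the event `A m` depend on the first `m`
    -- variables only, hence are independent of the centred `ξ m`.
    have hcross : ∫ ω, stoppedSum ξ a A m ω * (A m).indicator (fun ω => a m * ξ m ω) ω ∂P = 0 := by
      have h1 : IndepFun ((A m).indicator (stoppedSum ξ a A m)) (ξ m) P :=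
        indepFun_of_pastAlg hξ hind ((measurable_stoppedSum a hA m).indicator (hA m))
      have h2 := h1.integral_fun_mul_eq_mul_integral
        (hS.indicator hAm).aestronglyMeasurable (hξ m).aestronglyMeasurable
      rw [hmean, mul_zero] at h2
      have h3 : (fun ω => stoppedSum ξ a A m ω * (A m).indicator (fun ω => a m * ξ m ω) ω) =
          fun ω => a m * ((A m).indicator (stoppedSum ξ a A m) ω * ξ m ω) := by
        funext ω
        by_cases h : ω ∈ A m
        · simp [h]; ring
        · simp [h]
      rw [h3, integral_const_mul, h2, mul_zero]
    have hsq : ∫ ω, (A m).indicator (fun ω => a m * ξ m ω) ω ^ 2 ∂P =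
        σ ^ 2 * (a m ^ 2 * P.real (A m)) := by
      have h3 : (fun ω => (A m).indicator (fun ω => a m * ξ m ω) ω ^ 2) =
          fun ω => a m ^ 2 * (A m).indicator (fun ω => ξ m ω ^ 2) ω := by
        funext ω
        by_cases h : ω ∈ A m
        · simp [h]; ring
        · simp [h]
      rw [h3, integral_const_mul, integral_indicator_sq hξ hind hL2 hmean hvar (hA m)]
      ring
    have hexp : (fun ω => stoppedSum ξ a A (m + 1) ω ^ 2) = fun ω =>
        stoppedSum ξ a A m ω ^ 2 +
          2 * (stoppedSum ξ a A m ω * (A m).indicator (fun ω => a m * ξ m ω) ω) +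
          (A m).indicator (fun ω => a m * ξ m ω) ω ^ 2 := by
      funext ω
      simp only [stoppedSum, Finset.sum_range_succ]
      ring
    have i2 : Integrable (fun ω => 2 *
        (stoppedSum ξ a A m ω * (A m).indicator (fun ω => a m * ξ m ω) ω)) P :=
      (hS.integrable_mul hT).const_mul 2
    have i12 : Integrable (fun ω => stoppedSum ξ a A m ω ^ 2 +
        2 * (stoppedSum ξ a A m ω * (A m).indicator (fun ω => a m * ξ m ω) ω)) P :=
      hS.integrable_sq.add i2
    rw [hexp, integral_add i12 hT.integrable_sq, integral_add hS.integrable_sq i2, integral_const_mul,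
      hcross, hsq, ih,
      Finset.sum_range_succ]
    ring

/-- Kolmogorov's maximal inequality for weighted sums. -/
theorem measureReal_exists_le_abs_sum (hξ : ∀ i, Measurable (ξ i)) (hind : iIndepFun ξ P)
    (hL2 : ∀ i, MemLp (ξ i) 2 P) (hmean : ∀ i, ∫ ω, ξ i ω ∂P = 0)
    (hvar : ∀ i, variance (ξ i) P = σ ^ 2) (a : ℕ → ℝ) (m : ℕ) {c : ℝ} (hc : 0 < c) :
    P.real {ω | ∃ k ≤ m, c ≤ |∑ i ∈ Finset.range k, a i * ξ i ω|} ≤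
      σ ^ 2 * (∑ i ∈ Finset.range m, a i ^ 2) / c ^ 2 := by
  classical
  set S : ℕ → Ω → ℝ := fun k ω => ∑ i ∈ Finset.range k, a i * ξ i ω with hS
  -- Stop at the first passage of `c`: on a path that crosses by time `m`, the stopped sum is the
  -- partial sum at the crossing. Wald's identity and Markov's inequality then suffice.
  set A : ℕ → Set Ω := fun i => {ω | ∀ k ≤ i, |S k ω| < c} with hAdef
  have hSm : ∀ k i, k ≤ i → Measurable[pastAlg ξ i] (S k) := fun k i hki =>
    Finset.measurable_fun_sum _ fun l hl =>
      (measurable_pastAlg ξ (lt_of_lt_of_le (Finset.mem_range.1 hl) hki)).const_mul _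
  have hA : ∀ i, MeasurableSet[pastAlg ξ i] (A i) := by
    intro i
    have : A i = ⋂ k ∈ Finset.range (i + 1), {ω | |S k ω| < c} := by
      ext ω; simp [hAdef]
    rw [this]
    refine Finset.measurableSet_biInter _ fun k hk => ?_
    have hm := hSm k i (Nat.lt_succ_iff.1 (Finset.mem_range.1 hk))
    exact @measurableSet_lt _ _ _ _ _ (pastAlg ξ i) _ _ _ _ _
      (continuous_abs.measurable.comp hm) measurable_const
  have hsub : {ω | ∃ k ≤ m, c ≤ |S k ω|} ⊆ {ω | c ^ 2 ≤ stoppedSum ξ a A m ω ^ 2} := by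
    rintro ω ⟨k₀, hk₀, hk₀c⟩
    have hex : ∃ k, c ≤ |S k ω| := ⟨k₀, hk₀c⟩
    set τ := Nat.find hex with hτ
    have hτm : τ ≤ m := (Nat.find_min' hex hk₀c).trans hk₀
    have hstopped : stoppedSum ξ a A m ω = S τ ω := by
      have hmem : ∀ i, ω ∈ A i ↔ i < τ := by
        intro i
        constructor
        · intro h
          by_contra hlt
          exact absurd (Nat.find_spec hex) (not_le.2 (h τ (not_lt.1 hlt)))
        · intro h k hk
          exact not_le.1 (Nat.find_min hex (lt_of_le_of_lt hk h))
      have h1 : stoppedSum ξ a A m ω =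
          ∑ i ∈ Finset.range m, if i < τ then a i * ξ i ω else 0 := by
        refine Finset.sum_congr rfl fun i _ => ?_
        simp only [Set.indicator_apply, hmem]
      rw [h1, ← Finset.sum_filter]
      refine Finset.sum_congr ?_ fun _ _ => rfl
      ext i; simp only [Finset.mem_filter, Finset.mem_range]; omega
    have := Nat.find_spec hex
    change c ^ 2 ≤ stoppedSum ξ a A m ω ^ 2
    rw [hstopped, ← sq_abs (S τ ω)]
    exact pow_le_pow_left₀ hc.le this 2
  have hint := (memLp_stoppedSum hξ hL2 a hA m).integrable_sq
  have hmarkov := mul_meas_ge_le_integral_of_nonneg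
    (ae_of_all P fun ω => sq_nonneg (stoppedSum ξ a A m ω)) hint (c ^ 2)
  rw [integral_stoppedSum_sq hξ hind hL2 hmean hvar a hA m] at hmarkov
  rw [le_div_iff₀ (by positivity), mul_comm]
  calc c ^ 2 * P.real {ω | ∃ k ≤ m, c ≤ |S k ω|}
      ≤ c ^ 2 * P.real {ω | c ^ 2 ≤ stoppedSum ξ a A m ω ^ 2} := by
        exact mul_le_mul_of_nonneg_left (measureReal_mono hsub) (sq_nonneg c)
    _ ≤ _ := hmarkov
    _ ≤ _ := by
        gcongr with i hi
        exact mul_le_of_le_one_right (sq_nonneg _) measureReal_le_one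

/-- A strong law with rate: if the sums of squares of the weights grow at most linearly, then the
weighted sums are `o(n ^ (1 - δ))` for every `δ < 1 / 2`. -/
theorem ae_tendsto_sum_div_rpow (hξ : ∀ i, Measurable (ξ i)) (hind : iIndepFun ξ P)
    (hL2 : ∀ i, MemLp (ξ i) 2 P) (hmean : ∀ i, ∫ ω, ξ i ω ∂P = 0)
    (hvar : ∀ i, variance (ξ i) P = σ ^ 2) (a : ℕ → ℝ) {C : ℝ}
    (ha : ∀ n : ℕ, ∑ i ∈ Finset.range n, a i ^ 2 ≤ C * n) {δ : ℝ} (hδ : δ < 1 / 2) :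
    ∀ᵐ ω ∂P, Tendsto (fun n : ℕ => (∑ i ∈ Finset.range n, a i * ξ i ω) / (n : ℝ) ^ (1 - δ))
      atTop (𝓝 0) := by
  have key : ∀ q : ℕ, ∀ᵐ ω ∂P, ∀ᶠ n : ℕ in atTop,
      |∑ i ∈ Finset.range n, a i * ξ i ω| < 1 / ((q : ℝ) + 1) * (n : ℝ) ^ (1 - δ) := by
    intro q
    set κ : ℝ := 1 / ((q : ℝ) + 1) with hκ
    have hκ0 : 0 < κ := by positivity
    -- Dyadic blocks: crossing the level valid at `2 ^ k` at any time up to `2 ^ (k + 1)`.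
    -- Kolmogorov bounds the probability by a multiple of `2 ^ k / 2 ^ (2 k (1 - δ)) = r ^ k`, and
    -- `r < 1` since `δ < 1 / 2`; Borel–Cantelli concludes.
    set E : ℕ → Set Ω := fun k => {ω | ∃ n ≤ 2 ^ (k + 1),
      κ * ((2 : ℝ) ^ k) ^ (1 - δ) ≤ |∑ i ∈ Finset.range n, a i * ξ i ω|} with hE
    set r : ℝ := (2 : ℝ) ^ (2 * δ - 1) with hr
    have hr0 : 0 ≤ r := by positivity
    have hr1 : r < 1 := Real.rpow_lt_one_of_one_lt_of_neg (by norm_num) (by linarith)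
    have hC : 0 ≤ C := by
      have := ha 1
      simp only [Nat.cast_one, mul_one] at this
      exact (Finset.sum_nonneg fun i _ => sq_nonneg (a i)).trans this
    have hbound : ∀ k, P.real (E k) ≤ (2 * σ ^ 2 * C / κ ^ 2) * r ^ k := by
      intro k
      have h1 := measureReal_exists_le_abs_sum hξ hind hL2 hmean hvar a (2 ^ (k + 1))
        (c := κ * ((2 : ℝ) ^ k) ^ (1 - δ)) (by positivity)
      refine h1.trans ?_
      have h2 := ha (2 ^ (k + 1))
      have h3 : (((2 : ℝ) ^ k) ^ (1 - δ)) ^ 2 * r ^ k = 2 ^ k := by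
        rw [hr, ← Real.rpow_natCast ((2 : ℝ) ^ (2 * δ - 1)) k,
          ← Real.rpow_natCast (((2 : ℝ) ^ k) ^ (1 - δ)) 2, ← Real.rpow_natCast 2 k,
          ← Real.rpow_mul (by norm_num), ← Real.rpow_mul (by norm_num),
          ← Real.rpow_mul (by norm_num), ← Real.rpow_add (by norm_num)]
        congr 1
        push_cast
        ring
      rw [div_le_iff₀ (by positivity), mul_pow]
      calc σ ^ 2 * ∑ i ∈ Finset.range (2 ^ (k + 1)), a i ^ 2
          ≤ σ ^ 2 * (C * ((2 ^ (k + 1) : ℕ) : ℝ)) := by gcongr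
        _ = 2 * σ ^ 2 * C / κ ^ 2 * κ ^ 2 * 2 ^ k := by
            push_cast; rw [div_mul_cancel₀ _ (by positivity)]; ring
        _ = _ := by linear_combination (-(2 * σ ^ 2 * C / κ ^ 2 * κ ^ 2)) * h3
    have hsum : ∑' k, P (E k) ≠ ⊤ := by
      have hs : Summable fun k => P.real (E k) :=
        Summable.of_nonneg_of_le (fun _ => measureReal_nonneg) hbound
          ((summable_geometric_of_lt_one hr0 hr1).mul_left _)
      have : ∀ k, P (E k) = ENNReal.ofReal (P.real (E k)) := fun k => by simp
      simp_rw [this]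
      exact hs.tsum_ofReal_ne_top
    filter_upwards [ae_eventually_notMem hsum] with ω hω
    obtain ⟨k₀, hk₀⟩ := eventually_atTop.1 hω
    filter_upwards [eventually_ge_atTop (2 ^ k₀)] with n hn
    have hn0 : n ≠ 0 := by
      have : 0 < 2 ^ k₀ := by positivity
      omega
    have hlog : k₀ ≤ Nat.log 2 n := Nat.le_log_of_pow_le (by norm_num) hn
    have h1 := hk₀ _ hlog
    simp only [hE, Set.mem_ofPred_eq, not_exists, not_and, not_le] at h1
    refine (h1 n (Nat.lt_pow_succ_log_self (by norm_num) n).le).trans_le ?_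
    gcongr
    · linarith
    · exact_mod_cast Nat.pow_log_le_self 2 hn0
  filter_upwards [ae_all_iff.2 key] with ω hω
  rw [Metric.tendsto_atTop']
  intro η hη
  obtain ⟨q, hq⟩ := exists_nat_one_div_lt hη
  obtain ⟨n₀, hn₀⟩ := eventually_atTop.1 (hω q)
  refine ⟨n₀ , fun n hn => ?_⟩
  have hnpos : (0 : ℝ) < n := by exact_mod_cast (Nat.zero_le n₀).trans_lt hn
  have hp : (0 : ℝ) < (n : ℝ) ^ (1 - δ) := by positivity
  rw [Real.dist_eq, sub_zero, abs_div, abs_of_pos hp, div_lt_iff₀ hp]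
  exact (hn₀ n hn.le).trans (by gcongr)

end StoppedSums

/-! ### The chi-square distribution: absence of atoms, quantiles, Gaussian norms -/

section ChiSquare

instance isProbabilityMeasure_chiSq (m : ℕ) : IsProbabilityMeasure (chiSq m) :=
  Measure.isProbabilityMeasure_map (Measurable.aemeasurable (by fun_prop))

/-- The chi-square distribution with at least one degree of freedom has no atoms. -/
theorem chiSq_singleton {m : ℕ} (hm : 0 < m) (q : ℝ) : chiSq m {q} = 0 := by
  obtain ⟨n, rfl⟩ := Nat.exists_eq_succ_of_ne_zero hm.ne'
  rw [chiSq, Measure.map_apply (by fun_prop) (measurableSet_singleton q)]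
  -- Split off one coordinate: given the others, it is one of at most two square roots, and the
  -- Gaussian law has no atoms.
  set s : Set (ℝ × (Fin n → ℝ)) := {u | u.1 ^ 2 + ∑ i, u.2 i ^ 2 = q} with hs
  have hsm : MeasurableSet s := by
    refine measurableSet_eq_fun ?_ measurable_const
    fun_prop
  have hpre : (fun z : Fin (n + 1) → ℝ => ∑ i, z i ^ 2) ⁻¹' {q} =
      MeasurableEquiv.piFinSuccAbove (fun _ => ℝ) 0 ⁻¹' s := by
    ext z
    simp [hs, Fin.sum_univ_succ, Fin.tail]
  rw [hpre, (measurePreserving_piFinSuccAbove (fun _ : Fin (n + 1) => gaussianReal 0 1)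
    0).measure_preimage hsm.nullMeasurableSet, Measure.prod_apply_symm hsm]
  refine lintegral_eq_zero_of_ae_eq_zero (ae_of_all _ fun v => ?_)
  have : NullSingletonClass (gaussianReal 0 1) := nullSingletonClass_gaussianReal one_ne_zero
  refine Set.Finite.measure_zero (Set.Finite.subset
    (Set.toFinite {Real.sqrt (q - ∑ i, v i ^ 2), -Real.sqrt (q - ∑ i, v i ^ 2)}) ?_) _
  intro u hu
  have hu' : u ^ 2 = q - ∑ i, v i ^ 2 := by
    have : u ^ 2 + ∑ i, v i ^ 2 = q := hu
    linarith
  have := Real.sqrt_sq_eq_abs u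
  rw [hu'] at this
  rcases abs_cases u with h | h
  · left; rw [this]; exact h.1.symm
  · right; change u = _; rw [this, h.1]; ring

/-- A distribution function jumps only at atoms. Continuity makes it attain `1 - α` exactly at the
quantile and, in the coverage limit, absorbs small shifts of the threshold. -/
theorem continuous_chiSq_cdf {m : ℕ} (hm : 0 < m) :
    Continuous fun q => (chiSq m).real (Set.Iic q) := by
  have h : (fun q => (chiSq m).real (Set.Iic q)) = fun q => cdf (chiSq m) q := by
    funext q; rw [cdf_eq_real]
  rw [h]
  have : NullSingletonClass (chiSq m) := ⟨fun q => chiSq_singleton hm q⟩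
  refine continuous_iff_continuousAt.2 fun q => ?_
  rw [(cdf (chiSq m)).mono.continuousAt_iff_leftLim_eq_rightLim, (cdf (chiSq m)).rightLim_eq]
  have h1 := (cdf (chiSq m)).measure_singleton q
  rw [measure_cdf, measure_singleton] at h1
  have h2 := (cdf (chiSq m)).mono.leftLim_le (le_refl q)
  have h3 := ENNReal.ofReal_eq_zero.1 h1.symm
  linarith

theorem chiSq_Iic_zero {m : ℕ} (hm : 0 < m) {q : ℝ} (hq : q ≤ 0) :
    (chiSq m).real (Set.Iic q) = 0 := by
  have : chiSq m (Set.Iic q) = 0 := by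
    refine measure_mono_null (t := Set.Iio 0 ∪ {0}) ?_ (measure_union_null ?_ ?_)
    · intro u hu
      rcases lt_or_eq_of_le (le_trans (show u ≤ q from hu) hq) with h | h
      · exact Or.inl h
      · exact Or.inr h
    · rw [chiSq, Measure.map_apply (by fun_prop) measurableSet_Iio]
      convert measure_empty (μ := Measure.pi fun _ : Fin m => gaussianReal 0 1)
      ext z
      simp only [Set.mem_preimage, Set.mem_Iio, Set.mem_empty_iff_false, iff_false, not_lt]
      exact Finset.sum_nonneg fun i _ => sq_nonneg _
    · exact chiSq_singleton hm 0
  simp [measureReal_def, this]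

variable {m : ℕ} {α : ℝ}

/-- The distribution function vanishes below zero while `1 - α > 0`. Without a lower bound the
infimum defining the quantile would be a default value. -/
theorem chiSqQuantile_bddBelow (hm : 0 < m) (hα₁ : α < 1) :
    BddBelow {q : ℝ | 1 - α ≤ (chiSq m).real (Set.Iic q)} := by
  refine ⟨0, fun q hq => ?_⟩
  by_contra h
  have : 1 - α ≤ (chiSq m).real (Set.Iic q) := hq
  rw [chiSq_Iic_zero hm (not_le.1 h).le] at this
  linarith

theorem chiSqQuantile_nonempty (hα₀ : 0 < α) :
    {q : ℝ | 1 - α ≤ (chiSq m).real (Set.Iic q)}.Nonempty := by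
  have h := tendsto_cdf_atTop (chiSq m)
  have : ∀ᶠ q in atTop, 1 - α < cdf (chiSq m) q := h.eventually_const_lt (by linarith)
  obtain ⟨q, hq⟩ := this.exists
  refine ⟨q, ?_⟩
  rw [cdf_eq_real] at hq
  exact hq.le

/-- The chi-square distribution function takes the value `1 - α` at the quantile. -/
theorem chiSq_Iic_quantile (hm : 0 < m) (hα₀ : 0 < α) (hα₁ : α < 1) :
    (chiSq m).real (Set.Iic (chiSqQuantile m α)) = 1 - α := by
  have hb := chiSqQuantile_bddBelow hm hα₁
  have hc := continuous_chiSq_cdf hm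
  refine le_antisymm ?_ ?_
  -- Points to the left of the infimum have distribution function below `1 - α`, and continuity
  -- carries this to the infimum; the converse bound holds because the set is closed.
  · have ht : Tendsto (fun q => (chiSq m).real (Set.Iic q)) (𝓝[<] (chiSqQuantile m α))
        (𝓝 ((chiSq m).real (Set.Iic (chiSqQuantile m α)))) :=
      (hc.tendsto _).mono_left nhdsWithin_le_nhds
    refine le_of_tendsto ht ?_
    filter_upwards [self_mem_nhdsWithin] with q hq
    by_contra h
    exact absurd (csInf_le hb (show q ∈ {q : ℝ | 1 - α ≤ (chiSq m).real (Set.Iic q)} from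
      (not_le.1 h).le)) (not_le.2 hq)
  · exact (isClosed_le continuous_const hc).csInf_mem (chiSqQuantile_nonempty hα₀) hb

theorem chiSqQuantile_pos (hm : 0 < m) (hα₀ : 0 < α) (hα₁ : α < 1) : 0 < chiSqQuantile m α := by
  by_contra h
  have h1 := chiSq_Iic_quantile hm hα₀ hα₁
  rw [chiSq_Iic_zero hm (not_lt.1 h)] at h1
  linarith

/-- The squared norm of a standard Gaussian vector has a chi-square distribution. -/
theorem map_norm_sq_stdGaussian (ι : Type*) [Fintype ι] :
    (stdGaussian (EuclideanSpace ℝ ι)).map (fun v => ‖v‖ ^ 2) = chiSq (Fintype.card ι) := by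
  have e := Fintype.equivFin ι
  have h := stdGaussian_map (LinearIsometryEquiv.piLpCongrLeft 2 ℝ ℝ e)
  have h2 : (stdGaussian (EuclideanSpace ℝ (Fin (Fintype.card ι)))).map (fun v => ‖v‖ ^ 2) =
      chiSq (Fintype.card ι) := by
    rw [← map_pi_eq_stdGaussian, Measure.map_map (by fun_prop) (by fun_prop), chiSq]
    congr 1
    funext z
    simp [EuclideanSpace.real_norm_sq_eq]
  rw [← h2, ← h, Measure.map_map (by fun_prop) (by fun_prop)]
  congr 1
  funext v
  simp

end ChiSquare

/-! ### A weighted central limit theorem by characteristic functions -/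

section CentralLimit

/-- Exchange the factors one at a time; all the others stay in the unit disc. -/
theorem norm_prod_sub_prod_le {a b : ℕ → ℂ} (ha : ∀ i, ‖a i‖ ≤ 1) (hb : ∀ i, ‖b i‖ ≤ 1) (n : ℕ) :
    ‖∏ i ∈ Finset.range n, a i - ∏ i ∈ Finset.range n, b i‖ ≤
      ∑ i ∈ Finset.range n, ‖a i - b i‖ := by
  induction n with
  | zero => simp
  | succ n ih =>
    rw [Finset.prod_range_succ, Finset.prod_range_succ, Finset.sum_range_succ]
    have h : (∏ i ∈ Finset.range n, a i) * a n - (∏ i ∈ Finset.range n, b i) * b n =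
        (∏ i ∈ Finset.range n, a i - ∏ i ∈ Finset.range n, b i) * a n +
          (∏ i ∈ Finset.range n, b i) * (a n - b n) := by ring
    have hB : ‖∏ i ∈ Finset.range n, b i‖ ≤ 1 := by
      rw [norm_prod]
      exact Finset.prod_le_one (fun i _ => norm_nonneg _) fun i _ => hb i
    rw [h]
    refine (norm_add_le _ _).trans (add_le_add ?_ ?_)
    · rw [norm_mul]
      exact (mul_le_of_le_one_right (norm_nonneg _) (ha n)).trans ih
    · rw [norm_mul]
      exact mul_le_of_le_one_left (norm_nonneg _) hB

/-- If the averages of the squares converge, then each square is negligible against the sum. -/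
theorem eventually_forall_sq_le {b : ℕ → ℝ} {q : ℝ}
    (hb : Tendsto (fun n : ℕ => 1 / (n : ℝ) * ∑ i ∈ Finset.range n, b i ^ 2) atTop (𝓝 q))
    {η : ℝ} (hη : 0 < η) :
    ∀ᶠ n : ℕ in atTop, ∀ i < n, b i ^ 2 ≤ η * n := by
  -- `b n ^ 2 / (n + 1)` is the average at `n + 1` minus `n / (n + 1)` times the average at `n`, and
  -- both have the limit `q`.
  have h1 : Tendsto (fun n : ℕ => b n ^ 2 / ((n : ℝ) + 1)) atTop (𝓝 0) := by
    have h2 := hb.comp (tendsto_add_atTop_nat 1)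
    have h3 := (tendsto_natCast_div_add_atTop (1 : ℝ)).mul hb
    have h4 := h2.sub h3
    simp only [one_mul, sub_self] at h4
    refine h4.congr' ?_
    filter_upwards [eventually_gt_atTop 0] with n hn
    have : (n : ℝ) ≠ 0 := by positivity
    simp only [Function.comp, Finset.sum_range_succ]
    push_cast
    field_simp
    ring
  obtain ⟨i₀, hi₀⟩ := eventually_atTop.1 (h1.eventually_lt_const hη)
  set K := ∑ i ∈ Finset.range i₀, b i ^ 2 with hK
  have h5 : ∀ᶠ n : ℕ in atTop, K ≤ η * n :=
    ((tendsto_natCast_atTop_atTop (R := ℝ)).const_mul_atTop hη).eventually_ge_atTop K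
  filter_upwards [h5] with n hn i hi
  rcases lt_or_ge i i₀ with h | h
  · exact (Finset.single_le_sum (f := fun i => b i ^ 2) (fun j _ => sq_nonneg (b j))
      (Finset.mem_range.2 h)).trans hn
  · have h6 := hi₀ i h
    rw [div_lt_iff₀ (by positivity)] at h6
    have : ((i : ℝ) + 1) ≤ n := by exact_mod_cast hi
    exact h6.le.trans (by gcongr)

/-- The Gaussian characteristic function has the same second-order expansion as that of a
standardized error; this is `exp z - 1 - z = o(z)` at `z = -s² / 2`. -/
theorem isLittleO_exp_neg_sq :
    (fun s : ℝ => Complex.exp (-(s : ℂ) ^ 2 / 2) - (1 - (s : ℂ) ^ 2 / 2)) =o[𝓝 0]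
      fun s => s ^ 2 := by
  have h : (fun z : ℂ => Complex.exp z - 1 - z) =o[𝓝 0] fun z => z := by
    have := (Complex.hasDerivAt_exp 0).isLittleO
    simpa using this
  have ht : Tendsto (fun s : ℝ => -(s : ℂ) ^ 2 / 2) (𝓝 0) (𝓝 0) := by
    have : Continuous fun s : ℝ => -(s : ℂ) ^ 2 / 2 := by fun_prop
    simpa using this.tendsto 0
  have h2 := h.comp_tendsto ht
  refine Asymptotics.IsLittleO.trans_isBigO (h2.congr_left fun s => ?_) ?_
  · simp only [Function.comp]; ring
  · refine Asymptotics.IsBigO.of_bound 1 (Eventually.of_forall fun s => ?_)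
    simp only [Function.comp, norm_div, norm_neg, norm_pow, Complex.norm_real, one_mul]
    norm_num
    nlinarith [sq_nonneg s]

/-- Products of values of a characteristic function at small weights converge to a Gaussian one. -/
theorem tendsto_prod_charFun {φ : ℝ → ℂ} (hφ₁ : ∀ s, ‖φ s‖ ≤ 1)
    (hφ : (fun s : ℝ => φ s - (1 - (s : ℂ) ^ 2 / 2)) =o[𝓝 0] fun s => s ^ 2)
    {b : ℕ → ℝ} {q : ℝ}
    (hb : Tendsto (fun n : ℕ => 1 / (n : ℝ) * ∑ i ∈ Finset.range n, b i ^ 2) atTop (𝓝 q)) :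
    Tendsto (fun n : ℕ => ∏ i ∈ Finset.range n, φ (b i / √n)) atTop
      (𝓝 (Complex.exp (-(q : ℂ) / 2))) := by
  have hsq : ∀ n : ℕ, ∑ i ∈ Finset.range n, (b i / √n) ^ 2 =
      1 / (n : ℝ) * ∑ i ∈ Finset.range n, b i ^ 2 := by
    intro n
    rw [Finset.mul_sum]
    refine Finset.sum_congr rfl fun i _ => ?_
    rw [div_pow, Real.sq_sqrt (Nat.cast_nonneg n)]; ring
  have hG : Tendsto (fun n : ℕ => ∏ i ∈ Finset.range n, Complex.exp (-((b i / √n : ℝ) : ℂ) ^ 2 / 2))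
      atTop (𝓝 (Complex.exp (-(q : ℂ) / 2))) := by
    have h1 : ∀ n : ℕ, ∏ i ∈ Finset.range n, Complex.exp (-((b i / √n : ℝ) : ℂ) ^ 2 / 2) =
        Complex.exp (-((1 / (n : ℝ) * ∑ i ∈ Finset.range n, b i ^ 2 : ℝ) : ℂ) / 2) := by
      intro n
      rw [← Complex.exp_sum, ← hsq n, Complex.ofReal_sum, ← Finset.sum_div,
        ← Finset.sum_neg_distrib]
      congr 2
      refine Finset.sum_congr rfl fun i _ => ?_
      push_cast; ring
    simp_rw [h1]
    have hc : Continuous fun r : ℝ => Complex.exp (-(r : ℂ) / 2) := by fun_prop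
    exact (hc.tendsto q).comp hb
  have hdiff : (fun s : ℝ => φ s - Complex.exp (-(s : ℂ) ^ 2 / 2)) =o[𝓝 0] fun s => s ^ 2 :=
    (hφ.sub isLittleO_exp_neg_sq).congr_left fun s => by ring
  have hE : ∀ s : ℝ, ‖Complex.exp (-(s : ℂ) ^ 2 / 2)‖ ≤ 1 := by
    intro s
    rw [Complex.norm_exp]
    have : (-(s : ℂ) ^ 2 / 2).re = -(s ^ 2) / 2 := by
      rw [show (-(s : ℂ) ^ 2 / 2) = ((-(s ^ 2) / 2 : ℝ) : ℂ) by push_cast; ring,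
        Complex.ofReal_re]
    rw [this]
    exact Real.exp_le_one_iff.2 (by nlinarith [sq_nonneg s])
  -- Lindeberg replacement: the arguments `b i / √n` are uniformly small, so each factor changes by
  -- at most a small multiple of its squared argument. The squares sum to less than `|q| + 1`, which
  -- fixes the multiple `η / (2 (|q| + 1))`.
  have hzero : Tendsto (fun n : ℕ => ∏ i ∈ Finset.range n, φ (b i / √n) -
      ∏ i ∈ Finset.range n, Complex.exp (-((b i / √n : ℝ) : ℂ) ^ 2 / 2)) atTop (𝓝 0) := by
    rw [Metric.tendsto_nhds]
    intro η hη
    have hq0 : 0 < |q| + 1 := by positivity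
    obtain ⟨κ, hκ, hκ'⟩ := Metric.eventually_nhds_iff.1
      (hdiff.def (show 0 < η / (2 * (|q| + 1)) by positivity))
    have hlt : ∀ᶠ n : ℕ in atTop, 1 / (n : ℝ) * ∑ i ∈ Finset.range n, b i ^ 2 < |q| + 1 :=
      hb.eventually_lt_const (lt_of_le_of_lt (le_abs_self q) (by linarith))
    filter_upwards [hlt, eventually_forall_sq_le hb (show 0 < κ ^ 2 / 4 by positivity),
      eventually_gt_atTop 0] with n hn hmax hn0
    have hn0' : (0 : ℝ) < n := by exact_mod_cast hn0
    rw [dist_zero_right]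
    refine (norm_prod_sub_prod_le (fun i => hφ₁ _) (fun i => hE _) n).trans_lt ?_
    have hterm : ∀ i ∈ Finset.range n, ‖φ (b i / √n) -
        Complex.exp (-((b i / √n : ℝ) : ℂ) ^ 2 / 2)‖ ≤
          η / (2 * (|q| + 1)) * (b i / √n) ^ 2 := by
      intro i hi
      have h1 : (b i / √n) ^ 2 ≤ κ ^ 2 / 4 := by
        rw [div_pow, Real.sq_sqrt hn0'.le, div_le_iff₀ hn0']
        exact hmax i (Finset.mem_range.1 hi)
      have h2 : dist (b i / √n) 0 < κ := by
        rw [Real.dist_eq, sub_zero]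
        refine abs_lt_of_sq_lt_sq ?_ hκ.le
        nlinarith
      have := hκ' h2
      rwa [Real.norm_of_nonneg (sq_nonneg _)] at this
    refine (Finset.sum_le_sum hterm).trans_lt ?_
    rw [← Finset.mul_sum, hsq]
    calc η / (2 * (|q| + 1)) * (1 / (n : ℝ) * ∑ i ∈ Finset.range n, b i ^ 2)
        ≤ η / (2 * (|q| + 1)) * (|q| + 1) := by gcongr
      _ = η / 2 := by field_simp
      _ < η := by linarith
  have := hzero.add hG
  simpa using this

variable {Ω : Type*} [MeasurableSpace Ω] {P : Measure Ω} [IsProbabilityMeasure P]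

/-- A central limit theorem for weighted sums over several independent sequences: the squared
norms of the normalized sums are asymptotically chi-square. -/
theorem tendsto_measureReal_norm_sq_le {M : ℕ} {ι : Type*} [Fintype ι]
    (hι : 0 < Fintype.card ι) {ξ : Fin M → ℕ → Ω → ℝ}
    (hmeas : ∀ j i, Measurable (ξ j i))
    (hind : iIndepFun (fun q : Fin M × ℕ => ξ q.1 q.2) P)
    (hident : ∀ j i, IdentDistrib (ξ j i) (ξ j 0) P P)
    (hmean : ∀ j i, ∫ ω, ξ j i ω ∂P = 0) (hsq : ∀ j i, ∫ ω, ξ j i ω ^ 2 ∂P = 1)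
    (z : Fin M → ℕ → EuclideanSpace ℝ ι) (r : Fin M → ℝ) (hr : ∑ j, r j = 1)
    (hz : ∀ j t, Tendsto (fun n : ℕ => 1 / (n : ℝ) * ∑ i ∈ Finset.range n, (inner ℝ (z j i) t) ^ 2)
      atTop (𝓝 (r j * ‖t‖ ^ 2))) (q : ℝ) :
    Tendsto (fun n : ℕ => P.real {ω | ‖∑ j, ∑ i ∈ Finset.range n, (ξ j i ω / √n) • z j i‖ ^ 2 ≤ q})
      atTop (𝓝 ((chiSq (Fintype.card ι)).real (Set.Iic q))) := by
  set h : ℕ → Ω → EuclideanSpace ℝ ι :=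
    fun n ω => ∑ j, ∑ i ∈ Finset.range n, (ξ j i ω / √n) • z j i with hh
  have hhm : ∀ n, Measurable (h n) := fun n =>
    Finset.measurable_fun_sum _ fun j _ => Finset.measurable_fun_sum _ fun i _ =>
      ((hmeas j i).div_const _).smul_const _
  have hterm : ∀ (n : ℕ) (t : EuclideanSpace ℝ ι), charFun (P.map (h n)) t =
      ∏ j, ∏ i ∈ Finset.range n, charFun (P.map (ξ j 0)) (inner ℝ (z j i) t / √n) := by
    intro n t
    have h1 : h n = fun ω => ∑ k ∈ (Finset.univ : Finset (Fin M)) ×ˢ Finset.range n,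
        (ξ k.1 k.2 ω / √n) • z k.1 k.2 := by
      funext ω; rw [Finset.sum_product]
    have hind' : iIndepFun (fun (k : Fin M × ℕ) ω => (ξ k.1 k.2 ω / √n) • z k.1 k.2) P :=
      hind.comp (fun k x => (x / √n) • z k.1 k.2) (fun k => by fun_prop)
    rw [h1, (hind'.restrict _).charFun_map_fun_finsetSum_eq_prod
      (fun k _ => (((hmeas k.1 k.2).div_const _).smul_const _).aemeasurable), Finset.prod_apply,
      Finset.prod_product]
    refine Finset.prod_congr rfl fun j _ => Finset.prod_congr rfl fun i _ => ?_
    rw [← (hident j i).map_eq, charFun_apply, charFun_apply_real,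
      integral_map (((hmeas j i).div_const _).smul_const _).aemeasurable (by fun_prop),
      integral_map (hmeas j i).aemeasurable (by fun_prop)]
    refine integral_congr_ae (ae_of_all _ fun ω => ?_)
    simp only [inner_smul_left]
    congr 1
    simp
    ring
  have hlim : ∀ t : EuclideanSpace ℝ ι, Tendsto (fun n => charFun (P.map (h n)) t) atTop
      (𝓝 (charFun (stdGaussian (EuclideanSpace ℝ ι)) t)) := by
    intro t
    simp_rw [hterm]
    have hφ : ∀ j, Tendsto (fun n : ℕ => ∏ i ∈ Finset.range n,
        charFun (P.map (ξ j 0)) (inner ℝ (z j i) t / √n)) atTop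
          (𝓝 (Complex.exp (-((r j * ‖t‖ ^ 2 : ℝ) : ℂ) / 2))) := by
      intro j
      have : IsProbabilityMeasure (P.map (ξ j 0)) :=
        Measure.isProbabilityMeasure_map (hmeas j 0).aemeasurable
      exact tendsto_prod_charFun (fun s => norm_charFun_le_one s)
        (taylor_charFun_two (hmeas j 0).aemeasurable (hmean j 0) (hsq j 0)) (hz j t)
    have h2 := tendsto_finsetProd Finset.univ fun j _ => hφ j
    rw [← Complex.exp_sum] at h2
    convert h2 using 2
    rw [charFun_stdGaussian, ← Finset.sum_div, Finset.sum_neg_distrib, ← Complex.ofReal_sum,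
      ← Finset.sum_mul, hr, one_mul, Complex.ofReal_pow]
  have hmp : ∀ n, IsProbabilityMeasure (P.map (h n)) :=
    fun n => Measure.isProbabilityMeasure_map (hhm n).aemeasurable
  have hw : Tendsto
      (fun n => (show ProbabilityMeasure (EuclideanSpace ℝ ι) from ⟨P.map (h n), hmp n⟩))
      atTop (𝓝 (show ProbabilityMeasure (EuclideanSpace ℝ ι) from
        ⟨stdGaussian (EuclideanSpace ℝ ι), inferInstance⟩)) :=
    ProbabilityMeasure.tendsto_of_tendsto_charFun hlim
  set B : Set (EuclideanSpace ℝ ι) := {v | ‖v‖ ^ 2 ≤ q} with hB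
  have hBm : MeasurableSet B := measurableSet_le (by fun_prop) measurable_const
  -- The frontier lies in the sphere `‖v‖ ^ 2 = q`, a null set as the chi-square law has no atoms;
  -- weak convergence thus gives convergence of the probabilities of `B`.
  have hfr : stdGaussian (EuclideanSpace ℝ ι) (frontier B) = 0 := by
    refine measure_mono_null (frontier_le_subset_eq (by fun_prop) continuous_const) ?_
    have := chiSq_singleton hι q
    rwa [← map_norm_sq_stdGaussian ι, Measure.map_apply (by fun_prop)
      (measurableSet_singleton q)] at this
  have hp := ProbabilityMeasure.tendsto_measure_of_null_frontier_of_tendsto' hw (E := B) hfr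
  have hp' := (ENNReal.tendsto_toReal (measure_ne_top (stdGaussian (EuclideanSpace ℝ ι)) B)).comp hp
  have h3 : (chiSq (Fintype.card ι)).real (Set.Iic q) =
      (stdGaussian (EuclideanSpace ℝ ι) B).toReal := by
    rw [← map_norm_sq_stdGaussian ι, measureReal_def, Measure.map_apply (by fun_prop)
      measurableSet_Iic]
    rfl
  rw [h3]
  refine hp'.congr fun n => ?_
  simp only [Function.comp, measureReal_def]
  change (P.map (h n) B).toReal = _
  rw [Measure.map_apply (hhm n) hBm]
  rfl

end CentralLimit

/-! ### The largest eigenvalue as a maximal Rayleigh quotient -/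

section LargestEigenvalue

variable {p : ℕ} {A B : Matrix (Fin p) (Fin p) ℝ}

theorem bddAbove_spectrum (hA : A.IsHermitian) : BddAbove (spectrum ℝ A) := by
  rw [hA.spectrum_real_eq_range_eigenvalues]
  exact (Set.finite_range _).bddAbove

/-- The spectrum of `lambdaMax A - A` is nonnegative, so this matrix is positive semidefinite. -/
theorem dotProduct_mulVec_le_lambdaMax (hA : A.IsHermitian) (v : Fin p → ℝ) :
    v ⬝ᵥ A.mulVec v ≤ lambdaMax A * (v ⬝ᵥ v) := by
  have h : (algebraMap ℝ (Matrix (Fin p) (Fin p) ℝ) (lambdaMax A) - A).PosSemidef := by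
    rw [Matrix.posSemidef_iff_isHermitian_and_spectrum_nonneg]
    refine ⟨?_, ?_⟩
    · refine Matrix.IsHermitian.sub ?_ hA
      rw [Matrix.algebraMap_eq_diagonal]
      exact Matrix.isHermitian_diagonal _
    · rw [← spectrum.singleton_sub_eq]
      rintro _ ⟨_, rfl, t, ht, rfl⟩
      exact sub_nonneg.2 (le_csSup (bddAbove_spectrum hA) ht)
  have h2 := h.dotProduct_mulVec_nonneg v
  simp only [star_trivial, Matrix.sub_mulVec, Algebra.algebraMap_eq_smul_one, Matrix.smul_mulVec,
    Matrix.one_mulVec, dotProduct_sub, dotProduct_smul, smul_eq_mul] at h2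
  linarith

theorem exists_dotProduct_mulVec_eq_lambdaMax (hp : 0 < p) (hA : A.IsHermitian) :
    ∃ v : Fin p → ℝ, v ⬝ᵥ v = 1 ∧ v ⬝ᵥ A.mulVec v = lambdaMax A := by
  have : Nonempty (Fin p) := ⟨⟨0, hp⟩⟩
  have hmem : lambdaMax A ∈ spectrum ℝ A := by
    unfold lambdaMax
    rw [hA.spectrum_real_eq_range_eigenvalues]
    exact (Set.range_nonempty _).csSup_mem (Set.finite_range _)
  rw [hA.spectrum_real_eq_range_eigenvalues] at hmem
  obtain ⟨i, hi⟩ := hmem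
  have h1 : (hA.eigenvectorBasis i : Fin p → ℝ) ⬝ᵥ hA.eigenvectorBasis i = 1 := by
    have h2 := EuclideanSpace.real_norm_sq_eq (hA.eigenvectorBasis i)
    rw [hA.eigenvectorBasis.orthonormal.1 i] at h2
    simp only [dotProduct]
    rw [one_pow] at h2
    rw [h2]
    exact Finset.sum_congr rfl fun j _ => (sq _).symm
  refine ⟨hA.eigenvectorBasis i, h1, ?_⟩
  rw [hA.mulVec_eigenvectorBasis, dotProduct_smul, h1, hi]
  simp

theorem abs_dotProduct_mulVec_le (C : Matrix (Fin p) (Fin p) ℝ) {v : Fin p → ℝ}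
    (hv : v ⬝ᵥ v = 1) : |v ⬝ᵥ C.mulVec v| ≤ ∑ i, ∑ j, |C i j| := by
  have h1 : ∀ i, |v i| ≤ 1 := by
    intro i
    rw [abs_le_one_iff_mul_self_le_one, ← hv]
    exact Finset.single_le_sum (f := fun i => v i * v i) (fun j _ => mul_self_nonneg (v j))
      (Finset.mem_univ i)
  simp only [dotProduct, Matrix.mulVec, Finset.mul_sum]
  refine (Finset.abs_sum_le_sum_abs _ _).trans (Finset.sum_le_sum fun i _ =>
    (Finset.abs_sum_le_sum_abs _ _).trans (Finset.sum_le_sum fun j _ => ?_))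
  rw [abs_mul, abs_mul]
  calc |v i| * (|C i j| * |v j|) ≤ 1 * (|C i j| * 1) := by
        gcongr
        · exact h1 i
        · exact h1 j
    _ = |C i j| := by ring

/-- Compare the two Rayleigh quotients at a unit top eigenvector of `A`. By symmetry `lambdaMax` is
Lipschitz for the entrywise `ℓ¹` distance. -/
theorem lambdaMax_le_add (hp : 0 < p) (hA : A.IsHermitian) (hB : B.IsHermitian) :
    lambdaMax A ≤ lambdaMax B + ∑ i, ∑ j, |A i j - B i j| := by
  obtain ⟨v, hv, hAv⟩ := exists_dotProduct_mulVec_eq_lambdaMax hp hA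
  have h1 := dotProduct_mulVec_le_lambdaMax hB v
  have h2 := abs_dotProduct_mulVec_le (A - B) hv
  rw [hv, mul_one] at h1
  rw [Matrix.sub_mulVec, dotProduct_sub] at h2
  have h3 := (le_abs_self _).trans h2
  simp only [Matrix.sub_apply] at h3
  linarith

/-- The largest eigenvalue depends continuously on a symmetric matrix. -/
theorem tendsto_lambdaMax {ι : Type*} {l : Filter ι} (hp : 0 < p)
    {F : ι → Matrix (Fin p) (Fin p) ℝ} (hF : ∀ i, (F i).IsHermitian) (hA : A.IsHermitian)
    (h : Tendsto F l (𝓝 A)) : Tendsto (fun i => lambdaMax (F i)) l (𝓝 (lambdaMax A)) := by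
  have hent : Tendsto (fun i => ∑ k, ∑ m, |F i k m - A k m|) l (𝓝 0) := by
    have hc : Continuous fun C : Matrix (Fin p) (Fin p) ℝ => ∑ k, ∑ m, |C k m - A k m| := by
      fun_prop
    have := (hc.tendsto A).comp h
    simpa [Function.comp_def] using this
  rw [tendsto_iff_dist_tendsto_zero]
  refine squeeze_zero (fun _ => dist_nonneg) (fun i => ?_) hent
  rw [Real.dist_eq, abs_le]
  have h1 := lambdaMax_le_add hp (hF i) hA
  have h2 := lambdaMax_le_add hp hA (hF i)
  have h3 : ∑ k, ∑ m, |A k m - F i k m| = ∑ k, ∑ m, |F i k m - A k m| :=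
    Finset.sum_congr rfl fun k _ => Finset.sum_congr rfl fun m _ => abs_sub_comm _ _
  constructor <;> linarith

theorem le_lambdaMax_of_diag (hA : A.IsHermitian) (l : Fin p) : A l l ≤ lambdaMax A := by
  have := dotProduct_mulVec_le_lambdaMax hA (Pi.single l 1)
  simpa using this

end LargestEigenvalue

/-! ### Limits of inverse matrices -/

section Inverses

variable {ι κ : Type*} [Fintype κ] [DecidableEq κ] {l : Filter ι} {F : ι → Matrix κ κ ℝ}
  {A : Matrix κ κ ℝ}

/-- The inverse is the adjugate divided by the determinant, both continuous, and the limiting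
determinant is nonzero. -/
theorem tendsto_matrix_inv (hA : IsUnit A) (h : Tendsto F l (𝓝 A)) :
    Tendsto (fun i => (F i)⁻¹) l (𝓝 A⁻¹) := by
  have hd : A.det ≠ 0 := ((Matrix.isUnit_iff_isUnit_det A).1 hA).ne_zero
  simp only [Matrix.inv_def, Ring.inverse_eq_inv']
  have h1 : Tendsto (fun i => (F i).det) l (𝓝 A.det) :=
    ((continuous_id.matrix_det).tendsto A).comp h
  have h2 : Tendsto (fun i => (F i).adjugate) l (𝓝 A.adjugate) :=
    ((continuous_id.matrix_adjugate).tendsto A).comp h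
  exact (h1.inv₀ hd).smul h2

theorem eventually_isUnit_of_tendsto (hA : IsUnit A) (h : Tendsto F l (𝓝 A)) :
    ∀ᶠ i in l, IsUnit (F i) := by
  have hd : A.det ≠ 0 := ((Matrix.isUnit_iff_isUnit_det A).1 hA).ne_zero
  have h1 : Tendsto (fun i => (F i).det) l (𝓝 A.det) :=
    ((continuous_id.matrix_det).tendsto A).comp h
  filter_upwards [h1.eventually_ne hd] with i hi
  exact (Matrix.isUnit_iff_isUnit_det _).2 (isUnit_iff_ne_zero.2 hi)

theorem inv_smul_of_ne_zero {k : ℝ} (hk : k ≠ 0) (hA : IsUnit A) : (k • A)⁻¹ = k⁻¹ • A⁻¹ :=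
  Matrix.inv_smul' (A := A) (Units.mk0 k hk) ((Matrix.isUnit_iff_isUnit_det A).1 hA)

end Inverses

/-! ### Schur complements and the selected block of the inverse -/

section SchurComplement

variable {p : ℕ}

/-- The Schur complement of the block of coordinates with `c l ≠ 1`. -/
noncomputable def schurMat (c : Fin p → ℕ) (G : Matrix (Fin p) (Fin p) ℝ) :
    Matrix {l : Fin p // c l = 1} {l : Fin p // c l = 1} ℝ :=
  G.toBlock (fun l => c l = 1) (fun l => c l = 1) -
    G.toBlock (fun l => c l = 1) (fun l => ¬ c l = 1) *
      (G.toBlock (fun l => ¬ c l = 1) (fun l => ¬ c l = 1))⁻¹ *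
      (G.toBlock (fun l => c l = 1) (fun l => ¬ c l = 1)).transpose

/-- The zero blocks remove the unselected coordinates. In terms of `schurMat` the random selection
becomes a parameter that can be replaced by the true one. -/
theorem quadS_eq {M : ℕ} (T : Tuning) (x : Fin M → ℕ → Fin p → ℝ) (y : Fin M → ℕ → ℝ) (d : ℝ)
    (z : Fin p → ℝ) :
    quadS T x y d z =
      (fun l : {l : Fin p // combInd T x y d l = 1} => (z - combEst T x y d) l) ⬝ᵥ
        (schurMat (combInd T x y d) (combInfo T x y d)).mulVec
          (fun l : {l : Fin p // combInd T x y d l = 1} => (z - combEst T x y d) l) := by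
  simp only [quadS, Matrix.fromBlocks_mulVec, dotProduct, Fintype.sum_sum_type, Sum.elim_inl,
    Sum.elim_inr, Matrix.zero_mulVec, add_zero, Pi.zero_apply, mul_zero, Finset.sum_const_zero]
  rfl

variable {c : Fin p → ℕ} {G : Matrix (Fin p) (Fin p) ℝ}

theorem posDef_toBlock (hG : G.PosDef) (q : Fin p → Prop) : (G.toBlock q q).PosDef :=
  hG.submatrix Subtype.val_injective

theorem schurMat_smul (hG : G.PosDef) {k : ℝ} (hk : k ≠ 0) :
    schurMat c (k • G) = k • schurMat c G := by
  have hb : ∀ q r : Fin p → Prop, (k • G).toBlock q r = k • G.toBlock q r := fun _ _ => rfl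
  simp only [schurMat, hb]
  rw [inv_smul_of_ne_zero hk (posDef_toBlock hG _).isUnit]
  simp only [Matrix.transpose_smul, Matrix.smul_mul, Matrix.mul_smul, smul_sub, smul_smul]
  congr 2
  field_simp

/-- The Schur complement is the inverse of the corresponding block of the inverse. -/
theorem schurMat_mul_toBlock_inv (hG : G.PosDef) :
    schurMat c G * G⁻¹.toBlock (fun l => c l = 1) (fun l => c l = 1) = 1 := by
  set s : Fin p → Prop := fun l => c l = 1 with hs
  have hmul : G * G⁻¹ = 1 :=
    Matrix.mul_nonsing_inv _ ((Matrix.isUnit_iff_isUnit_det _).1 hG.isUnit)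
  -- Read off the two blocks of `G * G⁻¹ = 1` in the selected columns and eliminate the off-diagonal
  -- block of `G⁻¹`.
  have h1 := Matrix.toBlock_mul_eq_add s s s G G⁻¹
  have h2 := Matrix.toBlock_mul_eq_add (fun l => ¬ s l) s s G G⁻¹
  rw [hmul, Matrix.toBlock_one_self] at h1
  rw [hmul, Matrix.toBlock_one_disjoint] at h2
  swap
  · rw [Pi.disjoint_iff]
    intro l
    rw [Prop.disjoint_iff]
    by_cases h : s l <;> simp [h]
  have hT : (G.toBlock s fun l => ¬ s l).transpose = G.toBlock (fun l => ¬ s l) s := by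
    ext i j
    have := hG.isHermitian.apply i.1 j.1
    simpa using this
  have hD := (Matrix.isUnit_iff_isUnit_det _).1 (posDef_toBlock hG (fun l => ¬ s l)).isUnit
  have h3 : (G.toBlock (fun l => ¬ s l) fun l => ¬ s l)⁻¹ *
      (G.toBlock (fun l => ¬ s l) s * G⁻¹.toBlock s s) =
        -(G⁻¹.toBlock (fun l => ¬ s l) s) := by
    have h4 : G.toBlock (fun l => ¬ s l) s * G⁻¹.toBlock s s =
        -((G.toBlock (fun l => ¬ s l) fun l => ¬ s l) * G⁻¹.toBlock (fun l => ¬ s l) s) :=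
      eq_neg_of_add_eq_zero_left h2.symm
    rw [h4, Matrix.mul_neg, Matrix.nonsing_inv_mul_cancel_left _ _ hD]
  change (G.toBlock s s - (G.toBlock s fun l => ¬ s l) *
      (G.toBlock (fun l => ¬ s l) fun l => ¬ s l)⁻¹ *
      (G.toBlock s fun l => ¬ s l).transpose) * _ = 1
  rw [hT, Matrix.sub_mul, Matrix.mul_assoc, Matrix.mul_assoc, h3, Matrix.mul_neg, sub_neg_eq_add]
  exact h1.symm

/-- The Schur complement is continuous at positive definite matrices. -/
theorem tendsto_schurMat {ι : Type*} {l : Filter ι} {F : ι → Matrix (Fin p) (Fin p) ℝ}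
    (hG : G.PosDef) (h : Tendsto F l (𝓝 G)) :
    Tendsto (fun i => schurMat c (F i)) l (𝓝 (schurMat c G)) := by
  have hb : ∀ q r : Fin p → Prop,
      Tendsto (fun i => (F i).toBlock q r) l (𝓝 (G.toBlock q r)) := by
    intro q r
    have hc : Continuous fun B : Matrix (Fin p) (Fin p) ℝ => B.toBlock q r :=
      continuous_id.matrix_submatrix _ _
    exact (hc.tendsto G).comp h
  have hi := tendsto_matrix_inv (posDef_toBlock hG (fun l => ¬ c l = 1)).isUnit
    (hb (fun l => ¬ c l = 1) fun l => ¬ c l = 1)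
  have hc : Continuous fun B : (Matrix {l : Fin p // c l = 1} {l : Fin p // c l = 1} ℝ ×
      Matrix {l : Fin p // c l = 1} {l : Fin p // ¬ c l = 1} ℝ) ×
      Matrix {l : Fin p // ¬ c l = 1} {l : Fin p // ¬ c l = 1} ℝ =>
      B.1.1 - B.1.2 * B.2 * B.1.2.transpose := by fun_prop
  exact (hc.tendsto _).comp (((hb _ _).prodMk_nhds (hb _ _)).prodMk_nhds hi)

/-- A square root of the Schur complement normalizes the corresponding block of the inverse. -/
theorem exists_factor_schurMat (hG : G.PosDef) :
    ∃ R : Matrix {l : Fin p // c l = 1} {l : Fin p // c l = 1} ℝ,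
      R.transpose * R = schurMat c G ∧
        R * G⁻¹.toBlock (fun l => c l = 1) (fun l => c l = 1) * R.transpose = 1 := by
  have h1 := schurMat_mul_toBlock_inv (c := c) hG
  have h2 : schurMat c G = (G⁻¹.toBlock (fun l => c l = 1) (fun l => c l = 1))⁻¹ :=
    (Matrix.inv_eq_left_inv h1).symm
  have h3 : (schurMat c G).PosSemidef := by
    rw [h2]
    exact (posDef_toBlock hG.inv _).inv.posSemidef
  open scoped MatrixOrder in
  obtain ⟨R, hR⟩ := CStarAlgebra.nonneg_iff_eq_star_mul_self.mp h3.nonneg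
  rw [Matrix.star_eq_conjTranspose, Matrix.conjTranspose_eq_transpose_of_trivial] at hR
  refine ⟨R, hR.symm, ?_⟩
  rw [hR, Matrix.mul_assoc] at h1
  -- With `V` the block of `G⁻¹`, `h1` says `Rᵀ (R V) = 1`. For square matrices a left inverse is a
  -- right inverse.
  exact mul_eq_one_comm.1 h1

end SchurComplement

/-! ### Least squares: error formulas and consistency -/

section LeastSquares

variable {p : ℕ} {x : ℕ → Fin p → ℝ}

/-- The vector `X e` for the first `n` covariates and errors. -/
def score (x : ℕ → Fin p → ℝ) (e : ℕ → ℝ) (n : ℕ) (l : Fin p) : ℝ :=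
  ∑ i ∈ Finset.range n, x i l * e i

theorem designMatrix_mulVec (x : ℕ → Fin p → ℝ) (e : ℕ → ℝ) (n : ℕ) :
    ((designMatrix x n).mulVec fun i => e i) = score x e n := by
  funext l
  simp only [Matrix.mulVec, dotProduct, designMatrix, Matrix.of_apply, score]
  exact Fin.sum_univ_eq_sum_range (fun i => x i l * e i) n

theorem infoMatrix_apply (x : ℕ → Fin p → ℝ) (n : ℕ) (l m : Fin p) :
    infoMatrix x n l m = ∑ i ∈ Finset.range n, x i l * x i m := by
  simp only [infoMatrix, Matrix.mul_apply, designMatrix, Matrix.of_apply, Matrix.transpose_apply]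
  exact Fin.sum_univ_eq_sum_range (fun i => x i l * x i m) n

theorem posSemidef_infoMatrix (x : ℕ → Fin p → ℝ) (n : ℕ) : (infoMatrix x n).PosSemidef := by
  have := Matrix.posSemidef_self_mul_conjTranspose (designMatrix x n)
  rwa [Matrix.conjTranspose_eq_transpose_of_trivial] at this

theorem dotProduct_infoMatrix_mulVec (x : ℕ → Fin p → ℝ) (n : ℕ) (v : Fin p → ℝ) :
    v ⬝ᵥ (infoMatrix x n).mulVec v = ∑ i ∈ Finset.range n, (x i ⬝ᵥ v) ^ 2 := by
  rw [infoMatrix, ← Matrix.mulVec_mulVec, Matrix.dotProduct_mulVec, ← Matrix.mulVec_transpose,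
    ← Fin.sum_univ_eq_sum_range (fun i => (x i ⬝ᵥ v) ^ 2) n]
  simp only [dotProduct, sq]
  refine Finset.sum_congr rfl fun i _ => ?_
  simp [Matrix.mulVec, dotProduct, designMatrix]

variable {y e : ℕ → ℝ} {β : Fin p → ℝ}

/-- The estimation error of least squares is `(X Xᵀ)⁻¹ X e`. -/
theorem lse_eq (hy : ∀ i, y i = x i ⬝ᵥ β + e i) {n : ℕ} (hn : IsUnit (infoMatrix x n)) :
    lse x y n = β + (infoMatrix x n)⁻¹.mulVec (score x e n) := by
  have h1 : (designMatrix x n).mulVec (fun i => y i) =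
      (infoMatrix x n).mulVec β + score x e n := by
    rw [← designMatrix_mulVec x e n, infoMatrix, ← Matrix.mulVec_mulVec, ← Matrix.mulVec_add]
    congr 1
    funext i
    simp only [hy, Pi.add_apply, Matrix.mulVec, dotProduct, Matrix.transpose_apply, designMatrix,
      Matrix.of_apply]
  rw [lse, h1, Matrix.mulVec_add, Matrix.mulVec_mulVec,
    Matrix.nonsing_inv_mul _ ((Matrix.isUnit_iff_isUnit_det _).1 hn), Matrix.one_mulVec]

/-- The residuals are `e i - x i ⬝ᵥ u` with `u` the estimation error. By the normal equations the
cross term `∑ e i (x i ⬝ᵥ u)` and the square term `∑ (x i ⬝ᵥ u) ^ 2` both equal `score ⬝ᵥ u`. -/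
theorem sigmaSqHat_eq (hy : ∀ i, y i = x i ⬝ᵥ β + e i) {n : ℕ} (hn : IsUnit (infoMatrix x n)) :
    sigmaSqHat x y n = 1 / ((n : ℝ) - p) * (∑ i ∈ Finset.range n, e i ^ 2 -
      score x e n ⬝ᵥ (infoMatrix x n)⁻¹.mulVec (score x e n)) := by
  set u := (infoMatrix x n)⁻¹.mulVec (score x e n) with hu
  have h1 : ∀ i, y i - x i ⬝ᵥ lse x y n = e i - x i ⬝ᵥ u := by
    intro i
    rw [lse_eq hy hn, dotProduct_add, hy i]
    ring
  have h2 : ∑ i ∈ Finset.range n, e i * (x i ⬝ᵥ u) = score x e n ⬝ᵥ u := by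
    simp only [dotProduct, score, Finset.mul_sum, Finset.sum_mul]
    rw [Finset.sum_comm]
    exact Finset.sum_congr rfl fun l _ => Finset.sum_congr rfl fun i _ => by ring
  have h3 : ∑ i ∈ Finset.range n, (x i ⬝ᵥ u) ^ 2 = score x e n ⬝ᵥ u := by
    rw [← dotProduct_infoMatrix_mulVec, hu, Matrix.mulVec_mulVec,
      Matrix.mul_nonsing_inv _ ((Matrix.isUnit_iff_isUnit_det _).1 hn), Matrix.one_mulVec,
      dotProduct_comm]
  rw [sigmaSqHat, Fin.sum_univ_eq_sum_range (fun i => (y i - x i ⬝ᵥ lse x y n) ^ 2) n]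
  congr 1
  simp only [h1, sub_sq, Finset.sum_add_distrib, Finset.sum_sub_distrib, h3]
  have h4 : ∑ i ∈ Finset.range n, 2 * e i * (x i ⬝ᵥ u) = 2 * (score x e n ⬝ᵥ u) := by
    rw [← h2, Finset.mul_sum]
    exact Finset.sum_congr rfl fun i _ => by ring
  rw [h4]
  ring

/-- The residual variance is at most a multiple of the sum of the squared errors. -/
theorem sigmaSqHat_le (hy : ∀ i, y i = x i ⬝ᵥ β + e i) {n : ℕ} (hn : IsUnit (infoMatrix x n))
    (hpn : p < n) :
    sigmaSqHat x y n ≤ 1 / ((n : ℝ) - p) * ∑ i ∈ Finset.range n, e i ^ 2 := by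
  rw [sigmaSqHat_eq hy hn]
  have h1 : (0 : ℝ) < (n : ℝ) - p := sub_pos.2 (by exact_mod_cast hpn)
  have h2 := (posSemidef_infoMatrix x n).inv.dotProduct_mulVec_nonneg (score x e n)
  simp only [star_trivial] at h2
  gcongr
  linarith

theorem sigmaSqHat_nonneg {n : ℕ} (hpn : p < n) : 0 ≤ sigmaSqHat x y n := by
  have h1 : (0 : ℝ) < (n : ℝ) - p := sub_pos.2 (by exact_mod_cast hpn)
  unfold sigmaSqHat
  exact mul_nonneg (by positivity) (Finset.sum_nonneg fun i _ => sq_nonneg _)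

variable {Sig : Matrix (Fin p) (Fin p) ℝ}

theorem eventually_isUnit_infoMatrix (hSig : Sig.PosDef)
    (hA1 : Tendsto (fun n : ℕ => (1 / (n : ℝ)) • infoMatrix x n) atTop (𝓝 Sig)) :
    ∀ᶠ n in atTop, IsUnit (infoMatrix x n) := by
  filter_upwards [eventually_isUnit_of_tendsto hSig.isUnit hA1, eventually_gt_atTop 0] with n hn hn0
  have hk : (1 / (n : ℝ)) ≠ 0 := by positivity
  rw [Matrix.isUnit_iff_isUnit_det, Matrix.det_smul, isUnit_iff_ne_zero] at hn
  rw [Matrix.isUnit_iff_isUnit_det, isUnit_iff_ne_zero]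
  exact right_ne_zero_of_mul hn

/-- The rescaled inverses of the information matrices converge. -/
theorem tendsto_smul_inv_infoMatrix (hSig : Sig.PosDef)
    (hA1 : Tendsto (fun n : ℕ => (1 / (n : ℝ)) • infoMatrix x n) atTop (𝓝 Sig)) :
    Tendsto (fun n : ℕ => (n : ℝ) • (infoMatrix x n)⁻¹) atTop (𝓝 Sig⁻¹) := by
  refine (tendsto_matrix_inv hSig.isUnit hA1).congr' ?_
  filter_upwards [eventually_isUnit_infoMatrix hSig hA1, eventually_gt_atTop 0] with n hn hn0
  have hk : (1 / (n : ℝ)) ≠ 0 := by positivity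
  rw [inv_smul_of_ne_zero hk hn, one_div, inv_inv]

/-- The error is `n (X Xᵀ)⁻¹` applied to `score / n`, and the matrix converges, so any rate
available for `score / n` passes to the estimate. It is applied with `r = n ^ δ` and `r = 1`. -/
theorem tendsto_lse_sub_mul {r : ℕ → ℝ} (hSig : Sig.PosDef)
    (hA1 : Tendsto (fun n : ℕ => (1 / (n : ℝ)) • infoMatrix x n) atTop (𝓝 Sig))
    (hy : ∀ i, y i = x i ⬝ᵥ β + e i)
    (hr : ∀ l, Tendsto (fun n : ℕ => r n * (score x e n l / n)) atTop (𝓝 0)) (l : Fin p) :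
    Tendsto (fun n => r n * (lse x y n l - β l)) atTop (𝓝 0) := by
  have h1 : Tendsto (fun n : ℕ => ∑ m, ((n : ℝ) • (infoMatrix x n)⁻¹) l m *
      (r n * (score x e n m / n))) atTop (𝓝 (∑ m, Sig⁻¹ l m * 0)) := by
    refine tendsto_finsetSum _ fun m _ => Tendsto.mul ?_ (hr m)
    have hc : Continuous fun A : Matrix (Fin p) (Fin p) ℝ => A l m := by fun_prop
    exact (hc.tendsto _).comp (tendsto_smul_inv_infoMatrix hSig hA1)
  simp only [mul_zero, Finset.sum_const_zero] at h1
  refine h1.congr' ?_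
  filter_upwards [eventually_isUnit_infoMatrix hSig hA1, eventually_gt_atTop 0] with n hn hn0
  have hn0' : (n : ℝ) ≠ 0 := by positivity
  rw [lse_eq hy hn, Pi.add_apply, add_sub_cancel_left]
  simp only [Matrix.mulVec, dotProduct, Finset.mul_sum, Matrix.smul_apply, smul_eq_mul]
  refine Finset.sum_congr rfl fun m _ => ?_
  field_simp

/-- The residual variance is consistent if the scores are negligible and the averages of the squared
errors converge. -/
theorem tendsto_sigmaSqHat {σ2 : ℝ} (hSig : Sig.PosDef)
    (hA1 : Tendsto (fun n : ℕ => (1 / (n : ℝ)) • infoMatrix x n) atTop (𝓝 Sig))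
    (hy : ∀ i, y i = x i ⬝ᵥ β + e i)
    (hs : ∀ l, Tendsto (fun n : ℕ => score x e n l / n) atTop (𝓝 0))
    (he : Tendsto (fun n : ℕ => (∑ i ∈ Finset.range n, e i ^ 2) / n) atTop (𝓝 σ2)) :
    Tendsto (fun n => sigmaSqHat x y n) atTop (𝓝 σ2) := by
  have h1 : Tendsto (fun n : ℕ => (n : ℝ) / (n - p)) atTop (𝓝 1) := by
    have := tendsto_natCast_div_add_atTop (-(p : ℝ))
    simpa [sub_eq_add_neg] using this
  have h2 : Tendsto (fun n : ℕ => ∑ l, ∑ m, score x e n l / n *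
      (((n : ℝ) • (infoMatrix x n)⁻¹) l m * (score x e n m / n))) atTop
      (𝓝 (∑ l : Fin p, ∑ m : Fin p, 0 * (Sig⁻¹ l m * 0))) := by
    refine tendsto_finsetSum _ fun l _ => tendsto_finsetSum _ fun m _ =>
      (hs l).mul (Tendsto.mul ?_ (hs m))
    have hc : Continuous fun A : Matrix (Fin p) (Fin p) ℝ => A l m := by fun_prop
    exact (hc.tendsto _).comp (tendsto_smul_inv_infoMatrix hSig hA1)
  simp only [zero_mul, Finset.sum_const_zero] at h2
  have h3 := h1.mul (he.sub h2)
  simp only [sub_zero, one_mul] at h3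
  refine h3.congr' ?_
  filter_upwards [eventually_isUnit_infoMatrix hSig hA1, eventually_gt_atTop p] with n hn hn0
  have hn0' : (n : ℝ) ≠ 0 := by
    have : 0 < n := by omega
    positivity
  have hnp : (n : ℝ) - p ≠ 0 := (sub_pos.2 (by exact_mod_cast hn0)).ne'
  rw [sigmaSqHat_eq hy hn]
  have h4 : ∑ l, ∑ m, score x e n l / n *
      (((n : ℝ) • (infoMatrix x n)⁻¹) l m * (score x e n m / n)) =
      (score x e n ⬝ᵥ (infoMatrix x n)⁻¹.mulVec (score x e n)) / n := by
    simp only [Matrix.mulVec, dotProduct, Finset.mul_sum, Finset.sum_div, Matrix.smul_apply,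
      smul_eq_mul]
    refine Finset.sum_congr rfl fun l _ => Finset.sum_congr rfl fun m _ => ?_
    field_simp
  rw [h4]
  field_simp

end LeastSquares

/-! ### First passage of a convergent function below a line of small slope -/

section FirstPassage

/-- First passage of `g k ≤ d² k`: if `g` tends to a positive limit `L`, then the first passage time
is finite, tends to infinity, and is asymptotic to `L / d²` as `d → 0`. -/
theorem tendsto_firstPassage {n₀ : ℕ} {U : ℕ → Prop} {g : ℕ → ℝ} {L : ℝ}
    (hU : ∀ᶠ k in atTop, U k) (hg : Tendsto g atTop (𝓝 L))
    (hpos : ∀ k, n₀ ≤ k → U k → 0 < g k) {s : ℝ → Set ℕ}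
    (hs : ∀ d k, k ∈ s d ↔ n₀ ≤ k ∧ U k ∧ g k ≤ d ^ 2 * k) :
    (∀ d, 0 < d → (s d).Nonempty) ∧ Tendsto (fun d => sInf (s d)) (𝓝[>] 0) atTop ∧
      Tendsto (fun d => d ^ 2 * (sInf (s d) : ℕ)) (𝓝[>] 0) (𝓝 L) := by
  have hne : ∀ d, 0 < d → (s d).Nonempty := by
    intro d hd
    have h1 : ∀ᶠ k : ℕ in atTop, L + 1 ≤ d ^ 2 * k :=
      ((tendsto_natCast_atTop_atTop (R := ℝ)).const_mul_atTop
        (by positivity : 0 < d ^ 2)).eventually_ge_atTop _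
    obtain ⟨k, hk1, hk2, hk3, hk4⟩ := (h1.and (hU.and ((eventually_ge_atTop n₀).and
      (hg.eventually_lt_const (by linarith : L < L + 1))))).exists
    exact ⟨k, (hs d k).2 ⟨hk3, hk2, (hk4.trans_le hk1).le⟩⟩
  have hsq : Tendsto (fun d : ℝ => d ^ 2) (𝓝[>] 0) (𝓝 0) := by
    have : Continuous fun d : ℝ => d ^ 2 := by fun_prop
    have h := this.tendsto 0
    simp only [ne_eq, OfNat.ofNat_ne_zero, not_false_eq_true, zero_pow] at h
    exact h.mono_left nhdsWithin_le_nhds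
  have htop : Tendsto (fun d => sInf (s d)) (𝓝[>] 0) atTop := by
    rw [tendsto_atTop]
    intro K
    -- For a fixed `k` the line value `d² k` falls below `g k > 0`, so each of the finitely many
    -- early stages is eventually excluded.
    have h1 : ∀ k ∈ Finset.range K, ∀ᶠ d in 𝓝[>] (0 : ℝ), k ∉ s d := by
      intro k _
      by_cases hk : n₀ ≤ k ∧ U k
      · have h2 : Tendsto (fun d : ℝ => d ^ 2 * (k : ℝ)) (𝓝[>] 0) (𝓝 0) := by
          simpa using hsq.mul_const (k : ℝ)
        filter_upwards [h2.eventually_lt_const (hpos k hk.1 hk.2)] with d hd hmem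
        exact absurd ((hs d k).1 hmem).2.2 (not_le.2 hd)
      · exact Eventually.of_forall fun d hmem => hk ⟨((hs d k).1 hmem).1, ((hs d k).1 hmem).2.1⟩
    rw [← Finset.eventually_all] at h1
    filter_upwards [h1, self_mem_nhdsWithin] with d hd hd0
    by_contra hlt
    exact hd _ (Finset.mem_range.2 (not_le.1 hlt)) (Nat.sInf_mem (hne d hd0))
  refine ⟨hne, htop, ?_⟩
  -- With `N` the first passage time, `g N ≤ d² N < g (N - 1) + d²`: stage `N` is in the set and
  -- stage `N - 1`, eventually admissible, is not. Both bounds tend to `L`.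
  have hpred : Tendsto (fun d => sInf (s d) - 1) (𝓝[>] 0) atTop := by
    exact (tendsto_sub_atTop_nat 1).comp htop
  have hlow := hg.comp htop
  have hup : Tendsto (fun d => g (sInf (s d) - 1) + d ^ 2) (𝓝[>] 0) (𝓝 (L + 0)) :=
    (hg.comp hpred).add hsq
  rw [add_zero] at hup
  refine tendsto_of_tendsto_of_tendsto_of_le_of_le' hlow hup ?_ ?_
  · filter_upwards [self_mem_nhdsWithin] with d hd0
    exact ((hs d _).1 (Nat.sInf_mem (hne d hd0))).2.2
  · filter_upwards [hpred.eventually hU, hpred.eventually (eventually_ge_atTop n₀),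
      htop.eventually (eventually_ge_atTop 1)] with d h1 h2 h3
    have h4 : sInf (s d) - 1 ∉ s d := Nat.notMem_of_lt_sInf (by omega)
    rw [hs] at h4
    have h5 : d ^ 2 * ((sInf (s d) - 1 : ℕ) : ℝ) < g (sInf (s d) - 1) := by
      by_contra h6
      exact h4 ⟨h2, h1, not_lt.1 h6⟩
    rw [Nat.cast_sub h3, Nat.cast_one] at h5
    linarith

end FirstPassage

/-! ### Consistency of the variable selection -/

section Selection

variable {p : ℕ} {x : ℕ → Fin p → ℝ} {y e : ℕ → ℝ} {β : Fin p → ℝ} {T : Tuning} {δ : ℝ}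

open Classical in
/-- The indicators of the nonzero components, with values in the natural numbers. -/
noncomputable def suppInd (β : Fin p → ℝ) (l : Fin p) : ℕ := if β l ≠ 0 then 1 else 0

theorem trueP_eq (β : Fin p → ℝ) : trueP β = ∑ l, suppInd β l := rfl

theorem trueInd_eq (β : Fin p → ℝ) : trueInd β = Matrix.diagonal fun l => (suppInd β l : ℝ) := by
  simp [trueInd, suppInd]

theorem trueP_pos (hβ : β ≠ 0) : 0 < trueP β := by
  obtain ⟨l, hl⟩ := Function.ne_iff.1 hβ
  rw [trueP_eq]
  refine Finset.sum_pos' (fun _ _ => Nat.zero_le _) ⟨l, Finset.mem_univ l, ?_⟩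
  have : β l ≠ 0 := hl
  simp [suppInd, this]

theorem ind_le_one (T : Tuning) (x : ℕ → Fin p → ℝ) (y : ℕ → ℝ) (n : ℕ) (l : Fin p) :
    ind T x y n l ≤ 1 := by
  unfold ind
  split_ifs <;> simp

theorem pHat_le (T : Tuning) (x : ℕ → Fin p → ℝ) (y : ℕ → ℝ) (n : ℕ) : pHat T x y n ≤ p := by
  unfold pHat
  calc ∑ l, ind T x y n l ≤ ∑ _l : Fin p, 1 := Finset.sum_le_sum fun l _ => ind_le_one T x y n l
    _ = p := by simp

/-- The sign of `λ` is not prescribed, but divergence to `+∞` forces it. Comparing the criteria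
through `|β̂ₗ| ^ (-γ)` requires this sign. -/
theorem eventually_lam_nonneg
    (hlam₁ : Tendsto (fun n : ℕ => (n : ℝ) ^ (1 / 2 + T.γ * δ) * T.lam n) atTop atTop) :
    ∀ᶠ n in atTop, 0 ≤ T.lam n := by
  filter_upwards [hlam₁.eventually_ge_atTop 1] with n hn
  by_contra h
  have h1 : (n : ℝ) ^ (1 / 2 + T.γ * δ) * T.lam n ≤ 0 :=
    mul_nonpos_of_nonneg_of_nonpos (by positivity) (not_le.1 h).le
  linarith

/-- An effective variable is selected at all late stages at which its estimate is not too far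
off. -/
theorem eventually_forall_ind_eq_one (hε : 0 < T.ε) (hγ : 0 < T.γ)
    (hlam₀ : Tendsto (fun n : ℕ => (n : ℝ) ^ (1 / 2 : ℝ) * T.lam n) atTop (𝓝 0))
    (hlam₁ : Tendsto (fun n : ℕ => (n : ℝ) ^ (1 / 2 + T.γ * δ) * T.lam n) atTop atTop)
    {l : Fin p} (hl : β l ≠ 0) :
    ∀ᶠ n in atTop, ∀ y : ℕ → ℝ, |lse x y n l - β l| ≤ |β l| / 2 → ind T x y n l = 1 := by
  have hb : 0 < |β l| / 2 := by positivity
  -- An estimate of size at least `|β l| / 2` makes the selection criterion at most this null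
  -- sequence. It does not involve the data, which gives uniformity in `y`.
  have h1 := hlam₀.mul_const ((|β l| / 2) ^ (-T.γ))
  rw [zero_mul] at h1
  filter_upwards [h1.eventually_lt_const hε, eventually_lam_nonneg hlam₁] with n hn hlam y hy
  have h2 : |β l| / 2 ≤ |lse x y n l| := by
    have := abs_sub_abs_le_abs_sub (β l) (lse x y n l)
    rw [abs_sub_comm] at this
    linarith
  have h3 : lse x y n l ≠ 0 := abs_pos.1 (hb.trans_le h2)
  have h4 : |lse x y n l| ^ (-T.γ) ≤ (|β l| / 2) ^ (-T.γ) :=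
    Real.rpow_le_rpow_of_nonpos hb h2 (by linarith)
  have h5 : Real.sqrt n * (T.lam n * |lse x y n l| ^ (-T.γ)) < T.ε := by
    rw [Real.sqrt_eq_rpow, ← mul_assoc]
    refine lt_of_le_of_lt ?_ hn
    gcongr
  exact if_pos ⟨h3, h5⟩

variable {Sig : Matrix (Fin p) (Fin p) ℝ}

/-- Along a path on which the scores are `o(n ^ (1 - δ))`, the selected variables are eventually the
effective ones. -/
theorem eventually_ind_eq (hε : 0 < T.ε) (hγ : 0 < T.γ) (hδ : 0 < δ)
    (hlam₀ : Tendsto (fun n : ℕ => (n : ℝ) ^ (1 / 2 : ℝ) * T.lam n) atTop (𝓝 0))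
    (hlam₁ : Tendsto (fun n : ℕ => (n : ℝ) ^ (1 / 2 + T.γ * δ) * T.lam n) atTop atTop)
    (hSig : Sig.PosDef)
    (hA1 : Tendsto (fun n : ℕ => (1 / (n : ℝ)) • infoMatrix x n) atTop (𝓝 Sig))
    (hy : ∀ i, y i = x i ⬝ᵥ β + e i)
    (hs : ∀ l, Tendsto (fun n : ℕ => score x e n l / (n : ℝ) ^ (1 - δ)) atTop (𝓝 0)) :
    ∀ᶠ n in atTop, ind T x y n = suppInd β := by
  have hr : ∀ l, Tendsto (fun n : ℕ => (n : ℝ) ^ δ * (score x e n l / n)) atTop (𝓝 0) := by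
    intro l
    refine (hs l).congr' ?_
    filter_upwards [eventually_gt_atTop 0] with n hn
    have hn' : (0 : ℝ) < n := by exact_mod_cast hn
    rw [Real.rpow_sub hn', Real.rpow_one]
    field_simp
  have hconv : ∀ l, Tendsto (fun n : ℕ => (n : ℝ) ^ δ * (lse x y n l - β l)) atTop (𝓝 0) :=
    fun l => tendsto_lse_sub_mul hSig hA1 hy hr l
  have hall : ∀ l, ∀ᶠ n in atTop, ind T x y n l = suppInd β l := by
    intro l
    by_cases hl : β l = 0
    -- Inactive variable: `|β̂ₗ| ≤ n ^ (-δ)`, so the selection criterion is at least `n ^ (1/2 + γδ)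
    -- λ(n)`, eventually at least `ε`.
    · have h1 := (hconv l).eventually (Metric.ball_mem_nhds 0 one_pos)
      filter_upwards [h1, hlam₁.eventually_ge_atTop T.ε, eventually_lam_nonneg hlam₁,
        eventually_gt_atTop 0] with n hn hn2 hlam hn0
      have hn' : (0 : ℝ) < n := by exact_mod_cast hn0
      have hnd : (0 : ℝ) < (n : ℝ) ^ δ := by positivity
      have h0 : suppInd β l = 0 := by simp [suppInd, hl]
      rw [h0]
      unfold ind
      rw [if_neg]
      rintro ⟨hne, hlt⟩
      rw [Real.dist_eq, sub_zero, hl, sub_zero, abs_mul, abs_of_pos hnd] at hn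
      have h2 : |lse x y n l| ≤ (n : ℝ) ^ (-δ) := by
        rw [Real.rpow_neg hn'.le, ← one_div, le_div_iff₀ hnd, mul_comm]
        exact hn.le
      have h3 : ((n : ℝ) ^ (-δ)) ^ (-T.γ) ≤ |lse x y n l| ^ (-T.γ) :=
        Real.rpow_le_rpow_of_nonpos (abs_pos.2 hne) h2 (by linarith)
      rw [← Real.rpow_mul hn'.le] at h3
      have h4 : (n : ℝ) ^ (1 / 2 + T.γ * δ) * T.lam n ≤
          Real.sqrt n * (T.lam n * |lse x y n l| ^ (-T.γ)) := by
        rw [Real.rpow_add hn', Real.sqrt_eq_rpow, mul_assoc]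
        refine mul_le_mul_of_nonneg_left ?_ (by positivity)
        rw [mul_comm]
        refine mul_le_mul_of_nonneg_left ?_ hlam
        rwa [neg_mul_neg, mul_comm δ] at h3
      linarith
    · have h1 : Tendsto (fun n => lse x y n l - β l) atTop (𝓝 0) := by
        have h2 := tendsto_lse_sub_mul (r := fun _ => 1) hSig hA1 hy (fun l => ?_) l
        · simpa using h2
        · have h3 : Tendsto (fun n : ℕ => (n : ℝ) ^ (-δ)) atTop (𝓝 0) :=
            (tendsto_rpow_neg_atTop hδ).comp tendsto_natCast_atTop_atTop
          have h4 := h3.mul (hr l)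
          rw [zero_mul] at h4
          refine h4.congr' ?_
          filter_upwards [eventually_gt_atTop 0] with n hn
          have hn' : (0 : ℝ) < n := by exact_mod_cast hn
          rw [← mul_assoc, ← Real.rpow_add hn', neg_add_cancel, Real.rpow_zero]
      have hb : 0 < |β l| / 2 := by positivity
      filter_upwards [eventually_forall_ind_eq_one (x := x) hε hγ hlam₀ hlam₁ hl,
        h1.eventually (Metric.ball_mem_nhds 0 hb)] with n hn hn2
      rw [Real.dist_eq, sub_zero] at hn2
      rw [hn y hn2.le]
      simp [suppInd, hl]
  filter_upwards [eventually_all.2 hall] with n hn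
  exact funext hn

end Selection

/-! ### The stopping criterion of one procedure and its limit -/

section Criterion

variable {p : ℕ} {x : ℕ → Fin p → ℝ} {y e : ℕ → ℝ} {β : Fin p → ℝ} {T : Tuning} {δ : ℝ}

/-- The largest eigenvalue of `k I A⁻¹ I`, with `I` the diagonal matrix with entries `c`. -/
noncomputable def selEig (c : Fin p → ℕ) (k : ℝ) (A : Matrix (Fin p) (Fin p) ℝ) : ℝ :=
  lambdaMax (k • (Matrix.diagonal (fun l => (c l : ℝ)) * A⁻¹ *
    Matrix.diagonal (fun l => (c l : ℝ))))

theorem muTilde_eq (T : Tuning) (x : ℕ → Fin p → ℝ) (y : ℕ → ℝ) (k : ℕ) :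
    muTilde T x y k = selEig (ind T x y k) k (infoMatrix x k) := rfl

theorem isHermitian_selMatrix (c : Fin p → ℕ) (k : ℝ) {A : Matrix (Fin p) (Fin p) ℝ}
    (hA : A.IsHermitian) :
    (k • (Matrix.diagonal (fun l => (c l : ℝ)) * A⁻¹ *
      Matrix.diagonal (fun l => (c l : ℝ)))).IsHermitian := by
  have h := Matrix.isHermitian_mul_mul_conjTranspose
    (Matrix.diagonal (fun l => (c l : ℝ))) hA.inv
  rw [Matrix.diagonal_conjTranspose, star_trivial] at h
  rw [Matrix.IsHermitian, Matrix.conjTranspose_smul, h.eq, star_trivial]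

/-- A diagonal entry is at most the largest eigenvalue, and those of `A⁻¹` are positive. -/
theorem selEig_pos {c : Fin p → ℕ} {k : ℝ} (hk : 0 < k) {A : Matrix (Fin p) (Fin p) ℝ}
    (hA : A.PosDef) {l : Fin p} (hl : c l ≠ 0) : 0 < selEig c k A := by
  refine lt_of_lt_of_le ?_ (le_lambdaMax_of_diag (isHermitian_selMatrix c k hA.isHermitian) l)
  have h1 : 0 < A⁻¹ l l := hA.inv.diag_pos
  have h2 : (0 : ℝ) < c l := by exact_mod_cast Nat.pos_of_ne_zero hl
  simp only [Matrix.smul_apply, Matrix.mul_diagonal, Matrix.diagonal_mul, smul_eq_mul]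
  positivity

/-- A bound that does not depend on the selection, obtained from the Rayleigh quotient at a unit
eigenvector; zeroing rows and columns only decreases absolute entries. -/
theorem selEig_le (hp : 0 < p) {c : Fin p → ℕ} (hc : ∀ l, c l ≤ 1) (k : ℝ)
    {A : Matrix (Fin p) (Fin p) ℝ} (hA : A.IsHermitian) :
    selEig c k A ≤ ∑ l, ∑ m, |(k • A⁻¹) l m| := by
  obtain ⟨v, hv, hAv⟩ :=
    exists_dotProduct_mulVec_eq_lambdaMax hp (isHermitian_selMatrix c k hA)
  rw [selEig, ← hAv]
  refine (le_abs_self _).trans ((abs_dotProduct_mulVec_le _ hv).trans ?_)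
  refine Finset.sum_le_sum fun l _ => Finset.sum_le_sum fun m _ => ?_
  simp only [Matrix.smul_apply, Matrix.mul_diagonal, Matrix.diagonal_mul, smul_eq_mul]
  have h1 : |((c l : ℕ) : ℝ)| ≤ 1 := by
    rw [abs_of_nonneg (Nat.cast_nonneg _)]; exact_mod_cast hc l
  have h2 : |((c m : ℕ) : ℝ)| ≤ 1 := by
    rw [abs_of_nonneg (Nat.cast_nonneg _)]; exact_mod_cast hc m
  rw [abs_mul, abs_mul, abs_mul, abs_mul]
  calc |k| * (|((c l : ℕ) : ℝ)| * |A⁻¹ l m| * |((c m : ℕ) : ℝ)|)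
      ≤ |k| * (1 * |A⁻¹ l m| * 1) := by gcongr
    _ = |k| * |A⁻¹ l m| := by ring

theorem tendsto_selEig {ι : Type*} {f : Filter ι} (hp : 0 < p) (c : Fin p → ℕ) {k : ι → ℝ}
    {F : ι → Matrix (Fin p) (Fin p) ℝ} (hF : ∀ i, (F i).IsHermitian)
    {B : Matrix (Fin p) (Fin p) ℝ} (hB : B.IsHermitian)
    (h : Tendsto (fun i => k i • (F i)⁻¹) f (𝓝 B⁻¹)) :
    Tendsto (fun i => selEig c (k i) (F i)) f (𝓝 (selEig c 1 B)) := by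
  unfold selEig
  refine tendsto_lambdaMax hp (fun i => isHermitian_selMatrix c _ (hF i))
    (isHermitian_selMatrix c _ hB) ?_
  have hc : Continuous fun A : Matrix (Fin p) (Fin p) ℝ =>
      Matrix.diagonal (fun l => (c l : ℝ)) * A * Matrix.diagonal (fun l => (c l : ℝ)) := by
    fun_prop
  have h2 := (hc.tendsto B⁻¹).comp h
  rw [one_smul]
  refine h2.congr fun i => ?_
  simp

/-- The function of the stage that is compared with `d² k` by the stopping rule. -/
noncomputable def critFun (T : Tuning) (x : ℕ → Fin p → ℝ) (y : ℕ → ℝ) (M : ℕ) (k : ℕ) : ℝ :=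
  (sigmaSqHat x y k + 1 / k) * (chiSqQuantile (pHat T x y k) T.α / M * muTilde T x y k)

theorem posDef_infoMatrix {n : ℕ} (hn : IsUnit (infoMatrix x n)) : (infoMatrix x n).PosDef :=
  (posSemidef_infoMatrix x n).posDef_iff_isUnit.2 hn

theorem muTilde_pos {k : ℕ} (hk : 0 < k) (hu : IsUnit (infoMatrix x k))
    (hp : 0 < pHat T x y k) : 0 < muTilde T x y k := by
  obtain ⟨l, -, hl⟩ := Finset.exists_ne_zero_of_sum_ne_zero hp.ne'
  exact selEig_pos (by exact_mod_cast hk) (posDef_infoMatrix hu) hl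

variable {M : ℕ}

theorem denominator_pos (hM : 0 < M) (hα₀ : 0 < T.α) (hα₁ : T.α < 1) {k : ℕ} (hk : 0 < k)
    (hu : IsUnit (infoMatrix x k)) (hp : 0 < pHat T x y k) :
    0 < chiSqQuantile (pHat T x y k) T.α / M * muTilde T x y k :=
  mul_pos (div_pos (chiSqQuantile_pos hp hα₀ hα₁) (by exact_mod_cast hM)) (muTilde_pos hk hu hp)

theorem critFun_pos (hM : 0 < M) (hα₀ : 0 < T.α) (hα₁ : T.α < 1) {k : ℕ} (hk : p < k)
    (hu : IsUnit (infoMatrix x k)) (hp : 0 < pHat T x y k) : 0 < critFun T x y M k := by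
  have hk0 : 0 < k := by omega
  refine mul_pos ?_ (denominator_pos hM hα₀ hα₁ hk0 hu hp)
  have h1 := sigmaSqHat_nonneg (x := x) (y := y) hk
  have h2 : (0 : ℝ) < k := by exact_mod_cast hk0
  positivity

/-- Where the right-hand side is defined its denominator is positive, so it can be cleared; this
puts the rule into first-passage form. -/
theorem mem_stopSet_iff (hM : 0 < M) (hα₀ : 0 < T.α) (hα₁ : T.α < 1) (hn₀ : p < T.n₀) (d : ℝ)
    (k : ℕ) : k ∈ stopSet T x y M d ↔ T.n₀ ≤ k ∧
      (IsUnit (infoMatrix x k) ∧ 0 < pHat T x y k) ∧ critFun T x y M k ≤ d ^ 2 * k := by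
  simp only [stopSet, Set.mem_ofPred_eq, StopsAt, and_assoc]
  refine and_congr_right fun hk => and_congr_right fun hu => and_congr_right fun hp => ?_
  rw [le_div_iff₀ (denominator_pos hM hα₀ hα₁ (by omega) hu hp)]
  rfl

variable {Sig : Matrix (Fin p) (Fin p) ℝ}

/-- The selection is eventually constant, which freezes the quantile and the projection; only the
residual variance and the design vary. -/
theorem tendsto_critFun (hp : 0 < p) {σ2 : ℝ} (hSig : Sig.PosDef)
    (hA1 : Tendsto (fun n : ℕ => (1 / (n : ℝ)) • infoMatrix x n) atTop (𝓝 Sig))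
    (hσ : Tendsto (fun n => sigmaSqHat x y n) atTop (𝓝 σ2))
    (hind : ∀ᶠ n in atTop, ind T x y n = suppInd β) :
    Tendsto (critFun T x y M) atTop
      (𝓝 (σ2 * (chiSqQuantile (trueP β) T.α / M * selEig (suppInd β) 1 Sig))) := by
  have h1 : Tendsto (fun k : ℕ => (1 : ℝ) / k) atTop (𝓝 0) :=
    tendsto_one_div_atTop_nhds_zero_nat
  have h2 := tendsto_selEig hp (suppInd β) (fun n => (posSemidef_infoMatrix x n).isHermitian)
    hSig.isHermitian (tendsto_smul_inv_infoMatrix hSig hA1)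
  have h3 := (hσ.add h1).mul (h2.const_mul (chiSqQuantile (trueP β) T.α / M))
  rw [add_zero] at h3
  refine h3.congr' ?_
  filter_upwards [hind] with n hn
  simp only [critFun, muTilde_eq, hn, pHat, trueP_eq]

/-- The behaviour of one procedure along a path on which its scores are `o(n ^ (1 - δ))` and the
averages of its squared errors converge. -/
theorem tendsto_stopTime (hM : 0 < M) (hβ : β ≠ 0) {σ : ℝ} (hα₀ : 0 < T.α)
    (hα₁ : T.α < 1) (hn₀ : p < T.n₀) (hε : 0 < T.ε) (hγ : 0 < T.γ) (hδ : 0 < δ)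
    (hlam₀ : Tendsto (fun n : ℕ => (n : ℝ) ^ (1 / 2 : ℝ) * T.lam n) atTop (𝓝 0))
    (hlam₁ : Tendsto (fun n : ℕ => (n : ℝ) ^ (1 / 2 + T.γ * δ) * T.lam n) atTop atTop)
    (hSig : Sig.PosDef)
    (hA1 : Tendsto (fun n : ℕ => (1 / (n : ℝ)) • infoMatrix x n) atTop (𝓝 Sig))
    (hy : ∀ i, y i = x i ⬝ᵥ β + e i)
    (hs : ∀ l, Tendsto (fun n : ℕ => score x e n l / (n : ℝ) ^ (1 - δ)) atTop (𝓝 0))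
    (he : Tendsto (fun n : ℕ => (∑ i ∈ Finset.range n, e i ^ 2) / n) atTop (𝓝 (σ ^ 2))) :
    (∀ d, 0 < d → (stopSet T x y M d).Nonempty) ∧
      Tendsto (stopTime T x y M) (𝓝[>] 0) atTop ∧
      Tendsto (fun d => d ^ 2 * (stopTime T x y M d : ℝ)) (𝓝[>] 0)
        (𝓝 (σ ^ 2 * (chiSqQuantile (trueP β) T.α / M * selEig (suppInd β) 1 Sig))) := by
  have hp : 0 < p := by
    obtain ⟨l, -⟩ := Function.ne_iff.1 hβ
    exact l.pos
  have hind := eventually_ind_eq hε hγ hδ hlam₀ hlam₁ hSig hA1 hy hs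
  have hs' : ∀ l, Tendsto (fun n : ℕ => score x e n l / n) atTop (𝓝 0) := by
    intro l
    have h3 : Tendsto (fun n : ℕ => (n : ℝ) ^ (-δ)) atTop (𝓝 0) :=
      (tendsto_rpow_neg_atTop hδ).comp tendsto_natCast_atTop_atTop
    have h4 := (hs l).mul h3
    rw [zero_mul] at h4
    refine h4.congr' ?_
    filter_upwards [eventually_gt_atTop 0] with n hn
    have hn' : (0 : ℝ) < n := by exact_mod_cast hn
    rw [Real.rpow_sub hn', Real.rpow_one, Real.rpow_neg hn'.le]
    field_simp
  have hg := tendsto_critFun (M := M) hp hSig hA1 (tendsto_sigmaSqHat hSig hA1 hy hs' he) hind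
  refine tendsto_firstPassage (n₀ := T.n₀)
    (U := fun k => IsUnit (infoMatrix x k) ∧ 0 < pHat T x y k) ?_ hg
    (fun k hk hu => critFun_pos hM hα₀ hα₁ (by omega) hu.1 hu.2)
    (mem_stopSet_iff hM hα₀ hα₁ hn₀)
  filter_upwards [eventually_isUnit_infoMatrix hSig hA1, hind] with n hn hn2
  refine ⟨hn, ?_⟩
  simp only [pHat, hn2]
  exact trueP_pos hβ

end Criterion

/-! ### Measurability of the estimates and the stopping times -/

section Measurability

variable {Ω : Type*} [MeasurableSpace Ω] {p : ℕ} (T : Tuning) (x : ℕ → Fin p → ℝ)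
  {Y : Ω → ℕ → ℝ} {n : ℕ}

theorem measurable_lse (hY : ∀ i < n, Measurable fun ω => Y ω i) (l : Fin p) :
    Measurable fun ω => lse x (Y ω) n l := by
  simp only [lse, Matrix.mulVec, dotProduct]
  refine Finset.measurable_fun_sum _ fun m _ => Measurable.const_mul ?_ _
  exact Finset.measurable_fun_sum _ fun i _ => (hY i i.2).const_mul _

theorem measurable_sigmaSqHat (hY : ∀ i < n, Measurable fun ω => Y ω i) :
    Measurable fun ω => sigmaSqHat x (Y ω) n := by
  unfold sigmaSqHat
  refine Measurable.const_mul (Finset.measurable_fun_sum _ fun i _ => ?_) _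
  refine ((hY i i.2).sub ?_).pow_const 2
  simp only [dotProduct]
  exact Finset.measurable_fun_sum _ fun l _ => (measurable_lse x hY l).const_mul _

theorem measurable_ind (hY : ∀ i < n, Measurable fun ω => Y ω i) :
    Measurable fun ω => ind T x (Y ω) n := by
  refine measurable_pi_lambda _ fun l => ?_
  have h := measurable_lse x hY l
  unfold ind
  refine Measurable.ite (MeasurableSet.inter ?_ ?_) measurable_const measurable_const
  · exact (measurableSet_eq_fun h measurable_const).compl
  · have h2 : Measurable fun ω => |lse x (Y ω) n l| ^ (-T.γ) :=
      (continuous_abs.measurable.comp h).pow_const _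
    exact measurableSet_lt ((h2.const_mul _).const_mul _) measurable_const

/-- The selection takes values in a discrete space, so quantiles and eigenvalues depending on the
data through it alone need no separate argument. -/
theorem measurable_comp_ind {β : Type*} [MeasurableSpace β] (f : (Fin p → ℕ) → β)
    (hY : ∀ i < n, Measurable fun ω => Y ω i) : Measurable fun ω => f (ind T x (Y ω) n) :=
  (Measurable.of_discrete (f := f)).comp (measurable_ind T x hY)

/-- Only the first `n` observations need be measurable. Applied to the σ-algebra of the past, this
shows that the decision to stop is adapted. -/
theorem measurableSet_mem_stopSet (M : ℕ) (d : ℝ) (hY : ∀ i < n, Measurable fun ω => Y ω i) :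
    MeasurableSet {ω | n ∈ stopSet T x (Y ω) M d} := by
  have h1 : MeasurableSet {ω | 0 < pHat T x (Y ω) n} :=
    measurableSet_lt measurable_const (measurable_comp_ind T x (fun c => ∑ l, c l) hY)
  have h2 : MeasurableSet {ω | sigmaSqHat x (Y ω) n + 1 / n ≤
      d ^ 2 * n / (chiSqQuantile (pHat T x (Y ω) n) T.α / M * muTilde T x (Y ω) n)} :=
    measurableSet_le ((measurable_sigmaSqHat x hY).add_const _)
      (measurable_comp_ind T x (fun c => d ^ 2 * n / (chiSqQuantile (∑ l, c l) T.α / M *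
        selEig c n (infoMatrix x n))) hY)
  exact (MeasurableSet.const _).inter ((MeasurableSet.const _).inter (h1.inter h2))

theorem measurable_stopTime (M : ℕ) (d : ℝ) (hY : ∀ i, Measurable fun ω => Y ω i) :
    Measurable fun ω => stopTime T x (Y ω) M d := by
  have hm : ∀ k, MeasurableSet {ω | k ∈ stopSet T x (Y ω) M d} :=
    fun k => measurableSet_mem_stopSet T x M d fun i _ => hY i
  refine measurable_to_countable' fun k => ?_
  -- The second set collects the paths that never stop, on which `sInf ∅ = 0`.
  have h : (fun ω => stopTime T x (Y ω) M d) ⁻¹' {k} =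
      ({ω | k ∈ stopSet T x (Y ω) M d} ∩ ⋂ i ∈ Finset.range k, {ω | i ∈ stopSet T x (Y ω) M d}ᶜ) ∪
        ({_ω | k = 0} ∩ ⋂ i, {ω | i ∈ stopSet T x (Y ω) M d}ᶜ) := by
    ext ω
    simp only [Set.mem_preimage, Set.mem_singleton_iff, stopTime, Set.mem_union, Set.mem_inter_iff,
      Set.mem_iInter, Finset.mem_range, Set.mem_compl_iff, Set.mem_ofPred_eq]
    constructor
    · intro hk
      rcases Set.eq_empty_or_nonempty (stopSet T x (Y ω) M d) with h | h
      · right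
        rw [h] at hk ⊢
        simpa using hk.symm
      · left
        refine ⟨hk ▸ Nat.sInf_mem h, fun i hi => Nat.notMem_of_lt_sInf (hk ▸ hi)⟩
    · rintro (⟨h1, h2⟩ | ⟨h1, h2⟩)
      · refine le_antisymm (Nat.sInf_le h1) ?_
        by_contra hlt
        exact h2 _ (not_le.1 hlt) (Nat.sInf_mem ⟨k, h1⟩)
      · rw [Set.eq_empty_of_forall_notMem h2, h1, Nat.sInf_empty]
  rw [h]
  exact ((hm k).inter (Finset.measurableSet_biInter _ fun i _ => (hm i).compl)).union
    ((MeasurableSet.const _).inter (MeasurableSet.iInter fun i => (hm i).compl))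

end Measurability

/-! ### A deterministic bound at stages without stopping -/

section StageBound

variable {p : ℕ} {x : ℕ → Fin p → ℝ} {β : Fin p → ℝ} {T : Tuning} {δ : ℝ} {M : ℕ}
  {Sig : Matrix (Fin p) (Fin p) ℝ}

theorem eventually_abs_smul_inv_le (hSig : Sig.PosDef)
    (hA1 : Tendsto (fun n : ℕ => (1 / (n : ℝ)) • infoMatrix x n) atTop (𝓝 Sig)) :
    ∃ K : ℝ, 0 < K ∧ ∀ᶠ n : ℕ in atTop, ∑ l, ∑ m, |((n : ℝ) • (infoMatrix x n)⁻¹) l m| ≤ K := by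
  have hc : Continuous fun A : Matrix (Fin p) (Fin p) ℝ => ∑ l, ∑ m, |A l m| := by fun_prop
  have h := (hc.tendsto _).comp (tendsto_smul_inv_infoMatrix hSig hA1)
  refine ⟨∑ l, ∑ m, |Sig⁻¹ l m| + 1, by positivity, ?_⟩
  filter_upwards [h.eventually_lt_const (lt_add_one _)] with n hn
  exact hn.le

/-- Late stages at which a procedure does not stop have large scores or large squared errors. -/
theorem exists_bound_of_notMem_stopSet (hM : 0 < M) (hβ : β ≠ 0) (hα₀ : 0 < T.α) (hα₁ : T.α < 1)
    (hn₀ : p < T.n₀) (hε : 0 < T.ε) (hγ : 0 < T.γ)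
    (hlam₀ : Tendsto (fun n : ℕ => (n : ℝ) ^ (1 / 2 : ℝ) * T.lam n) atTop (𝓝 0))
    (hlam₁ : Tendsto (fun n : ℕ => (n : ℝ) ^ (1 / 2 + T.γ * δ) * T.lam n) atTop atTop)
    (hSig : Sig.PosDef)
    (hA1 : Tendsto (fun n : ℕ => (1 / (n : ℝ)) • infoMatrix x n) atTop (𝓝 Sig)) :
    ∃ C : ℝ, 0 < C ∧ ∃ k₀ : ℕ, ∀ k ≥ k₀, ∀ y e : ℕ → ℝ, (∀ i, y i = x i ⬝ᵥ β + e i) →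
      ∀ d : ℝ, 0 < d → d ≤ 1 → k ∉ stopSet T x y M d →
        d ^ 2 * (k : ℝ) ^ 2 ≤
          C * (∑ l, score x e k l ^ 2 + ∑ i ∈ Finset.range k, e i ^ 2 + 1) := by
  obtain ⟨l₀, hl₀⟩ := Function.ne_iff.1 hβ
  have hp : 0 < p := l₀.pos
  have hl₀' : β l₀ ≠ 0 := hl₀
  obtain ⟨K, hK, hKev⟩ := eventually_abs_smul_inv_le hSig hA1
  set X : ℝ := ∑ m ∈ Finset.range (p + 1), |chiSqQuantile m T.α| with hX
  have hX0 : 0 ≤ X := Finset.sum_nonneg fun _ _ => abs_nonneg _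
  set b : ℝ := |β l₀| / 2 with hb
  have hb0 : 0 < b := by positivity
  obtain ⟨k₀, hk₀⟩ := eventually_atTop.1 (((eventually_isUnit_infoMatrix hSig hA1).and hKev).and
    ((eventually_forall_ind_eq_one (x := x) hε hγ hlam₀ hlam₁ hl₀').and
      (eventually_ge_atTop T.n₀)))
  -- The two terms serve the two ways of not stopping: `K² p / b²` when no variable is selected, `X
  -- K (p + 1)` when the criterion exceeds `d² k`. The sum `X` dominates the quantiles of all
  -- possible degrees of freedom.
  refine ⟨K ^ 2 * p / b ^ 2 + X * K * (p + 1), by positivity, k₀, ?_⟩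
  intro k hk y e hy d hd hd1 hnot
  obtain ⟨⟨hu, hKk⟩, hsel, hkn⟩ := hk₀ k hk
  have hpk : p < k := by omega
  have hk0 : (0 : ℝ) < k := by
    have : 0 < k := by omega
    exact_mod_cast this
  have hd2 : d ^ 2 ≤ 1 := pow_le_one₀ hd.le hd1
  have hS0 : 0 ≤ ∑ l, score x e k l ^ 2 := Finset.sum_nonneg fun _ _ => sq_nonneg _
  have hQ0 : 0 ≤ ∑ i ∈ Finset.range k, e i ^ 2 := Finset.sum_nonneg fun _ _ => sq_nonneg _
  by_cases hpk0 : 0 < pHat T x y k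
  · have hcrit : d ^ 2 * k < critFun T x y M k := by
      by_contra h
      exact hnot ((mem_stopSet_iff hM hα₀ hα₁ hn₀ d k).2 ⟨hkn, ⟨hu, hpk0⟩, not_lt.1 h⟩)
    have hchi : chiSqQuantile (pHat T x y k) T.α / M ≤ X := by
      have h1 : chiSqQuantile (pHat T x y k) T.α ≤ X :=
        (le_abs_self _).trans (Finset.single_le_sum
          (f := fun m => |chiSqQuantile m T.α|) (fun _ _ => abs_nonneg _)
          (Finset.mem_range.2 (Nat.lt_succ_of_le (pHat_le T x y k))))
      refine (div_le_self (chiSqQuantile_pos hpk0 hα₀ hα₁).le ?_).trans h1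
      exact_mod_cast hM
    have hmu : muTilde T x y k ≤ K :=
      (selEig_le hp (ind_le_one T x y k) k (posSemidef_infoMatrix x k).isHermitian).trans hKk
    have hmu0 : 0 < muTilde T x y k := muTilde_pos (by omega) hu hpk0
    have hs0 := sigmaSqHat_nonneg (x := x) (y := y) hpk
    -- `1 / (k - p) ≤ (p + 1) / k` for `k ≥ p + 1`, as `p (k - p - 1) ≥ 0`.
    have hs1 : sigmaSqHat x y k ≤ (p + 1) / k * ∑ i ∈ Finset.range k, e i ^ 2 := by
      refine (sigmaSqHat_le hy hu hpk).trans (mul_le_mul_of_nonneg_right ?_ hQ0)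
      have h1 : (p : ℝ) + 1 ≤ k := by exact_mod_cast hpk
      rw [div_le_div_iff₀ (by linarith) hk0]
      nlinarith [(Nat.cast_nonneg p : (0 : ℝ) ≤ p)]
    have h2 : critFun T x y M k ≤
        ((p + 1) / k * ∑ i ∈ Finset.range k, e i ^ 2 + 1 / k) * (X * K) := by
      unfold critFun
      gcongr
      exact (denominator_pos hM hα₀ hα₁ (by omega) hu hpk0).le
    have h3 : d ^ 2 * (k : ℝ) ^ 2 ≤
        ((p + 1) * ∑ i ∈ Finset.range k, e i ^ 2 + 1) * (X * K) := by
      have h4 := mul_le_mul_of_nonneg_right (hcrit.le.trans h2) hk0.le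
      calc d ^ 2 * (k : ℝ) ^ 2 = d ^ 2 * k * k := by ring
        _ ≤ _ := h4
        _ = _ := by field_simp
    refine h3.trans ?_
    have hpos1 : 0 ≤ K ^ 2 * p / b ^ 2 := by positivity
    have hXK : 0 ≤ X * K := by positivity
    have hp0 : (0 : ℝ) ≤ p := Nat.cast_nonneg p
    have e1 : 0 ≤ K ^ 2 * p / b ^ 2 *
        (∑ l, score x e k l ^ 2 + ∑ i ∈ Finset.range k, e i ^ 2 + 1) := by positivity
    have e2 : 0 ≤ X * K * (p + 1) * ∑ l, score x e k l ^ 2 := by positivity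
    have e3 : 0 ≤ X * K * p := by positivity
    nlinarith
  -- If nothing is selected, the active variable `l₀` is missed; its estimate is off by more than
  -- `b`, which forces a score of order `k`.
  · have hind : ind T x y k l₀ = 0 := by
      have : pHat T x y k = 0 := by omega
      exact (Finset.sum_eq_zero_iff.1 this) l₀ (Finset.mem_univ _)
    have hfar : b < |lse x y k l₀ - β l₀| := by
      by_contra h
      have := hsel y (not_lt.1 h)
      omega
    have h1 : lse x y k l₀ - β l₀ =
        ∑ m, ((k : ℝ) • (infoMatrix x k)⁻¹) l₀ m * (score x e k m / k) := by
      rw [lse_eq hy hu, Pi.add_apply, add_sub_cancel_left]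
      simp only [Matrix.mulVec, dotProduct, Matrix.smul_apply, smul_eq_mul]
      refine Finset.sum_congr rfl fun m _ => ?_
      field_simp
    have h2 : ∀ m, |((k : ℝ) • (infoMatrix x k)⁻¹) l₀ m| ≤ K := fun m =>
      ((Finset.single_le_sum (f := fun m => |((k : ℝ) • (infoMatrix x k)⁻¹) l₀ m|)
        (fun _ _ => abs_nonneg _) (Finset.mem_univ m)).trans
        (Finset.single_le_sum (f := fun l => ∑ m, |((k : ℝ) • (infoMatrix x k)⁻¹) l m|)
          (fun _ _ => Finset.sum_nonneg fun _ _ => abs_nonneg _) (Finset.mem_univ l₀))).trans hKk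
    have h3 : |lse x y k l₀ - β l₀| ≤ K * (∑ m, |score x e k m|) / k := by
      rw [h1, mul_div_assoc, Finset.sum_div, Finset.mul_sum]
      refine (Finset.abs_sum_le_sum_abs _ _).trans (Finset.sum_le_sum fun m _ => ?_)
      rw [abs_mul, abs_div, abs_of_pos hk0]
      exact mul_le_mul_of_nonneg_right (h2 m) (by positivity)
    have h4 : b * k ≤ K * ∑ m, |score x e k m| := by
      have := hfar.le.trans h3
      rwa [le_div_iff₀ hk0] at this
    have h5 : (∑ m, |score x e k m|) ^ 2 ≤ p * ∑ m, score x e k m ^ 2 := by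
      have := sq_sum_le_card_mul_sum_sq (s := (Finset.univ : Finset (Fin p)))
        (f := fun m => |score x e k m|)
      simpa using this
    have h6 : b ^ 2 * (k : ℝ) ^ 2 ≤ K ^ 2 * (p * ∑ m, score x e k m ^ 2) := by
      calc b ^ 2 * (k : ℝ) ^ 2 = (b * k) ^ 2 := by ring
        _ ≤ (K * ∑ m, |score x e k m|) ^ 2 := pow_le_pow_left₀ (by positivity) h4 2
        _ = K ^ 2 * (∑ m, |score x e k m|) ^ 2 := by ring
        _ ≤ _ := by gcongr
    have h7 : (k : ℝ) ^ 2 ≤ K ^ 2 * p / b ^ 2 * ∑ m, score x e k m ^ 2 := by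
      rw [div_mul_eq_mul_div, le_div_iff₀ (by positivity)]
      linarith
    have e1 : 0 ≤ K ^ 2 * p / b ^ 2 * (∑ i ∈ Finset.range k, e i ^ 2 + 1) := by positivity
    have e2 : 0 ≤ X * K * (p + 1) *
        (∑ l, score x e k l ^ 2 + ∑ i ∈ Finset.range k, e i ^ 2 + 1) := by positivity
    have e3 : d ^ 2 * (k : ℝ) ^ 2 ≤ (k : ℝ) ^ 2 := mul_le_of_le_one_left (by positivity) hd2
    nlinarith

/-- The sums of squares of the covariates grow at most linearly. -/
theorem exists_sum_sq_le
    (hA1 : Tendsto (fun n : ℕ => (1 / (n : ℝ)) • infoMatrix x n) atTop (𝓝 Sig)) :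
    ∃ C : ℝ, 0 ≤ C ∧ ∀ l (n : ℕ), ∑ i ∈ Finset.range n, x i l ^ 2 ≤ C * n := by
  have h1 : ∀ l, ∃ C : ℝ, ∀ n : ℕ, ∑ i ∈ Finset.range n, x i l ^ 2 ≤ C * n := by
    intro l
    have hc : Continuous fun A : Matrix (Fin p) (Fin p) ℝ => A l l := by fun_prop
    obtain ⟨C, hC⟩ := ((hc.tendsto _).comp hA1).bddAbove_range
    refine ⟨C, fun n => ?_⟩
    rcases Nat.eq_zero_or_pos n with rfl | hn
    · simp
    · have hn' : (0 : ℝ) < n := by exact_mod_cast hn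
      have := hC ⟨n, rfl⟩
      simp only [Function.comp, Matrix.smul_apply, infoMatrix_apply, smul_eq_mul] at this
      rw [one_div, inv_mul_le_iff₀ hn', mul_comm] at this
      simpa [sq] using this
  choose C hC using h1
  refine ⟨∑ l, |C l|, Finset.sum_nonneg fun _ _ => abs_nonneg _, fun l n => (hC l n).trans ?_⟩
  gcongr
  exact (le_abs_self _).trans
    (Finset.single_le_sum (f := fun l => |C l|) (fun _ _ => abs_nonneg _) (Finset.mem_univ l))

end StageBound

/-! ### Second moments of the stopping times -/

section SecondMoment

variable {Ω : Type*} [mΩ : MeasurableSpace Ω]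

/-- Membership in a decreasing sequence of sets holds up to some index. -/
theorem exists_mem_iff_lt {A : ℕ → Set Ω} (hA : Antitone A) (m : ℕ) (ω : Ω) :
    ∃ τ ≤ m, ∀ i < m, ω ∈ A i ↔ i < τ := by
  induction m with
  | zero => exact ⟨0, le_rfl, by simp⟩
  | succ m ih =>
    obtain ⟨τ, hτ, h⟩ := ih
    by_cases hm : ω ∈ A m
    · exact ⟨m + 1, le_rfl, fun i hi => ⟨fun _ => hi, fun _ => hA (Nat.lt_succ_iff.1 hi) hm⟩⟩
    · refine ⟨τ, hτ.trans m.le_succ, fun i hi => ?_⟩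
      rcases Nat.lt_succ_iff_lt_or_eq.1 hi with hi | rfl
      · exact h i hi
      · exact ⟨fun h => absurd h hm, fun h => absurd h (not_lt.2 hτ)⟩

theorem sum_indicator_eq {A : ℕ → Set Ω} {m τ : ℕ} {ω : Ω} (hτ : τ ≤ m)
    (h : ∀ i < m, ω ∈ A i ↔ i < τ) (f : ℕ → Ω → ℝ) :
    ∑ i ∈ Finset.range m, (A i).indicator (f i) ω = ∑ i ∈ Finset.range τ, f i ω := by
  classical
  have h1 : ∑ i ∈ Finset.range m, (A i).indicator (f i) ω =
      ∑ i ∈ Finset.range m, if i < τ then f i ω else 0 :=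
    Finset.sum_congr rfl fun i hi => by
      simp only [Set.indicator_apply, h i (Finset.mem_range.1 hi)]
  rw [h1, ← Finset.sum_filter]
  refine Finset.sum_congr ?_ fun _ _ => rfl
  ext i
  simp only [Finset.mem_filter, Finset.mem_range]
  omega

variable {P : Measure Ω} [IsProbabilityMeasure P] {p M : ℕ} {x : ℕ → Fin p → ℝ} {β : Fin p → ℝ}
  {T : Tuning} {δ σ : ℝ} {Sig : Matrix (Fin p) (Fin p) ℝ} {e : ℕ → Ω → ℝ} {Y : Ω → ℕ → ℝ}

/-- The event that a procedure has not stopped by stage `i`. -/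
def notStopped (T : Tuning) (x : ℕ → Fin p → ℝ) (Y : Ω → ℕ → ℝ) (M : ℕ) (d : ℝ) (i : ℕ) : Set Ω :=
  {ω | ∀ k ≤ i, k ∉ stopSet T x (Y ω) M d}

theorem antitone_notStopped (d : ℝ) : Antitone (notStopped T x Y M d) :=
  fun _ _ hij _ h k hk => h k (hk.trans hij)

/-- The error `e i` first enters at stage `i + 1`, so whether sampling has stopped by stage `i`
depends on earlier errors only, as Wald's identity requires. -/
theorem measurableSet_notStopped (hY : ∀ ω i, Y ω i = x i ⬝ᵥ β + e i ω) (d : ℝ) (i : ℕ) :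
    MeasurableSet[pastAlg e i] (notStopped T x Y M d i) := by
  have h : notStopped T x Y M d i =
      ⋂ k ∈ Finset.range (i + 1), {ω | k ∈ stopSet T x (Y ω) M d}ᶜ := by
    ext ω
    simp [notStopped]
  rw [h]
  refine Finset.measurableSet_biInter _ fun k hk => MeasurableSet.compl ?_
  refine @measurableSet_mem_stopSet Ω (pastAlg e i) p T x Y k M d fun m hm => ?_
  have hmi : m < i := lt_of_lt_of_le hm (Nat.lt_succ_iff.1 (Finset.mem_range.1 hk))
  simp only [hY]
  exact (measurable_pastAlg e hmi).const_add _

/-- The number of stages before `m` at which a procedure has not yet stopped. -/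
noncomputable def runLength (T : Tuning) (x : ℕ → Fin p → ℝ) (Y : Ω → ℕ → ℝ) (M : ℕ) (d : ℝ)
    (m : ℕ) (ω : Ω) : ℝ :=
  ∑ i ∈ Finset.range m, (notStopped T x Y M d i).indicator (fun _ => (1 : ℝ)) ω

theorem runLength_eq_min {d : ℝ} {ω : Ω} (h : (stopSet T x (Y ω) M d).Nonempty) (m : ℕ) :
    runLength T x Y M d m ω = ((min (stopTime T x (Y ω) M d) m : ℕ) : ℝ) := by
  have h1 : ∀ i < m, ω ∈ notStopped T x Y M d i ↔ i < min (stopTime T x (Y ω) M d) m := by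
    intro i hi
    constructor
    · intro h2
      refine lt_min ?_ hi
      by_contra h3
      exact h2 _ (not_lt.1 h3) (Nat.sInf_mem h)
    · intro h2 k hk
      exact Nat.notMem_of_lt_sInf (lt_of_le_of_lt hk (lt_of_lt_of_le h2 (min_le_left _ _)))
  rw [runLength, sum_indicator_eq (min_le_right _ _) h1]
  simp

/-- The squared truncated stopping time is bounded by stopped sums. -/
theorem runLength_sq_le {C : ℝ} {k₀ : ℕ} {d : ℝ} (hC : 0 < C) (hd : 0 < d) (hd1 : d ≤ 1)
    (hY : ∀ ω i, Y ω i = x i ⬝ᵥ β + e i ω)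
    (hk₀ : ∀ k ≥ k₀, ∀ y e : ℕ → ℝ, (∀ i, y i = x i ⬝ᵥ β + e i) →
      ∀ d : ℝ, 0 < d → d ≤ 1 → k ∉ stopSet T x y M d →
        d ^ 2 * (k : ℝ) ^ 2 ≤
          C * (∑ l, score x e k l ^ 2 + ∑ i ∈ Finset.range k, e i ^ 2 + 1)) (m : ℕ) (ω : Ω) :
    d ^ 2 * runLength T x Y M d m ω ^ 2 ≤ (2 * C + 2 + ((k₀ : ℝ) + 1) ^ 2) *
      (2 * ∑ l, stoppedSum e (fun i => x i l) (notStopped T x Y M d) m ω ^ 2 +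
      2 * ∑ l, ∑ i ∈ Finset.range m,
        x i l ^ 2 * (notStopped T x Y M d i).indicator (fun ω => e i ω ^ 2) ω +
      ∑ i ∈ Finset.range m, (notStopped T x Y M d i).indicator (fun ω => e i ω ^ 2) ω + 1) := by
  set C₁ : ℝ := 2 * C + 2 + ((k₀ : ℝ) + 1) ^ 2 with hC₁
  have hC₁0 : 0 < C₁ := by positivity
  have hd2 : d ^ 2 ≤ 1 := pow_le_one₀ hd.le hd1
  set A : ℕ → Set Ω := notStopped T x Y M d with hAdef
  obtain ⟨τ, hτm, hτ⟩ := exists_mem_iff_lt (antitone_notStopped (T := T) (x := x) (Y := Y)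
    (M := M) d) m ω
  have h1 : runLength T x Y M d m ω = τ := by
    simp only [runLength]
    rw [sum_indicator_eq hτm hτ]
    simp
  have h2 : ∀ l, stoppedSum e (fun i => x i l) A m ω = score x (fun i => e i ω) τ l := fun l =>
    sum_indicator_eq hτm hτ _
  have h3 : ∑ i ∈ Finset.range m, (A i).indicator (fun ω => e i ω ^ 2) ω =
      ∑ i ∈ Finset.range τ, e i ω ^ 2 := sum_indicator_eq hτm hτ _
  have h4 : ∀ l, ∑ i ∈ Finset.range m, x i l ^ 2 * (A i).indicator (fun ω => e i ω ^ 2) ω =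
      ∑ i ∈ Finset.range τ, x i l ^ 2 * e i ω ^ 2 := by
    intro l
    rw [← sum_indicator_eq hτm hτ (fun i ω => x i l ^ 2 * e i ω ^ 2)]
    refine Finset.sum_congr rfl fun i _ => ?_
    by_cases h : ω ∈ A i
    · rw [Set.indicator_of_mem h, Set.indicator_of_mem h]
    · rw [Set.indicator_of_notMem h, Set.indicator_of_notMem h, mul_zero]
  simp only [h1, h2, h3, h4]
  have hS0 : 0 ≤ ∑ l, score x (fun i => e i ω) τ l ^ 2 :=
    Finset.sum_nonneg fun _ _ => sq_nonneg _
  have hQ0 : 0 ≤ ∑ i ∈ Finset.range τ, e i ω ^ 2 := Finset.sum_nonneg fun _ _ => sq_nonneg _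
  have hR0 : 0 ≤ ∑ l, ∑ i ∈ Finset.range τ, x i l ^ 2 * e i ω ^ 2 :=
    Finset.sum_nonneg fun _ _ => Finset.sum_nonneg fun _ _ => by positivity
  set Q := 2 * ∑ l, score x (fun i => e i ω) τ l ^ 2 +
    2 * ∑ l, ∑ i ∈ Finset.range τ, x i l ^ 2 * e i ω ^ 2 +
    ∑ i ∈ Finset.range τ, e i ω ^ 2 + 1 with hQ
  have hQ1 : 1 ≤ Q := by linarith
  rcases Nat.lt_or_ge k₀ τ with hlt | hge
  -- The bound holds at the last unstopped stage `k = τ - 1`, whereas the stopped sums run up to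
  -- `τ`. The extra term `x k l * e k ω` costs the factors `2` and the sums of `x² e²`; small `τ`
  -- are covered by `(k₀ + 1)²`.
  · obtain ⟨k, rfl⟩ : ∃ k, τ = k + 1 := ⟨τ - 1, by omega⟩
    have hk : k ∉ stopSet T x (Y ω) M d := (hτ k (by omega)).2 k.lt_succ_self k le_rfl
    have h5 := hk₀ k (by omega) (Y ω) (fun i => e i ω) (hY ω) d hd hd1 hk
    have h6 : ∀ l, score x (fun i => e i ω) k l ^ 2 ≤
        2 * score x (fun i => e i ω) (k + 1) l ^ 2 +
          2 * ∑ i ∈ Finset.range (k + 1), x i l ^ 2 * e i ω ^ 2 := by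
      intro l
      have h7 : score x (fun i => e i ω) (k + 1) l =
          score x (fun i => e i ω) k l + x k l * e k ω := Finset.sum_range_succ _ _
      have h8 : x k l ^ 2 * e k ω ^ 2 ≤ ∑ i ∈ Finset.range (k + 1), x i l ^ 2 * e i ω ^ 2 :=
        Finset.single_le_sum (f := fun i => x i l ^ 2 * e i ω ^ 2)
          (fun i _ => by positivity) (Finset.self_mem_range_succ k)
      rw [h7]
      -- With `S` the score and `u` the extra term, `2 (S + u)² + 2 u² - S² = (S + 2 u)²`.
      nlinarith [sq_nonneg (score x (fun i => e i ω) k l + 2 * (x k l * e k ω))]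
    have h9 : ∑ l, score x (fun i => e i ω) k l ^ 2 ≤
        2 * ∑ l, score x (fun i => e i ω) (k + 1) l ^ 2 +
          2 * ∑ l, ∑ i ∈ Finset.range (k + 1), x i l ^ 2 * e i ω ^ 2 := by
      rw [Finset.mul_sum, Finset.mul_sum, ← Finset.sum_add_distrib]
      exact Finset.sum_le_sum fun l _ => h6 l
    have h10 : ∑ i ∈ Finset.range k, e i ω ^ 2 ≤ ∑ i ∈ Finset.range (k + 1), e i ω ^ 2 := by
      rw [Finset.sum_range_succ]
      linarith [sq_nonneg (e k ω)]
    have h11 : d ^ 2 * (k : ℝ) ^ 2 ≤ C * Q := h5.trans (by gcongr; linarith)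
    push_cast
    calc d ^ 2 * ((k : ℝ) + 1) ^ 2 ≤ 2 * (d ^ 2 * (k : ℝ) ^ 2) + 2 * d ^ 2 := by
          nlinarith [mul_nonneg (sq_nonneg d) (sq_nonneg ((k : ℝ) - 1))]
      _ ≤ 2 * (C * Q) + 2 * Q := by linarith
      _ ≤ C₁ * Q := by
          have : 0 ≤ ((k₀ : ℝ) + 1) ^ 2 * Q := by positivity
          rw [hC₁]
          linarith
  · have h5 : (τ : ℝ) ≤ k₀ + 1 := by
      have : (τ : ℝ) ≤ k₀ := by exact_mod_cast hge
      linarith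
    calc d ^ 2 * (τ : ℝ) ^ 2 ≤ 1 * ((k₀ : ℝ) + 1) ^ 2 := by gcongr
      _ ≤ C₁ * 1 := by rw [hC₁]; linarith
      _ ≤ C₁ * Q := by gcongr

/-- Put `V = E (c t)²`. The hypothesis gives `V ≤ C (c E t + 1)`, and `c t ≤ (c t)² / (2 C) + C / 2`
lets half of `V` be absorbed on the left. -/
theorem integral_sq_le_of_le {t : Ω → ℝ} (htL : MemLp t 2 P) {c C : ℝ} (hc0 : 0 ≤ c) (hc : c ≤ 1)
    (hC : 0 < C) (hE : c * ∫ ω, t ω ^ 2 ∂P ≤ C * (∫ ω, t ω ∂P + 1)) :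
    ∫ ω, (c * t ω) ^ 2 ∂P ≤ C ^ 2 + 2 * C := by
  have htint : Integrable t P := htL.integrable (by norm_num)
  have hsq : ∫ ω, (c * t ω) ^ 2 ∂P = c * (c * ∫ ω, t ω ^ 2 ∂P) := by
    rw [← integral_const_mul, ← integral_const_mul]
    exact integral_congr_ae (ae_of_all _ fun ω => by ring)
  have hlin : c * ∫ ω, t ω ∂P ≤ (∫ ω, (c * t ω) ^ 2 ∂P) / (2 * C) + C / 2 := by
    have h1 : ∀ ω, c * t ω ≤ (c * t ω) ^ 2 / (2 * C) + C / 2 := by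
      intro ω
      rw [div_add' _ _ _ (by positivity), le_div_iff₀ (by positivity)]
      nlinarith [sq_nonneg (c * t ω - C)]
    have h2 : Integrable (fun ω => (c * t ω) ^ 2 / (2 * C)) P :=
      ((htL.const_mul c).integrable_sq).div_const _
    have h3 : ∫ ω, c * t ω ∂P ≤ ∫ ω, ((c * t ω) ^ 2 / (2 * C) + C / 2) ∂P :=
      integral_mono (htint.const_mul c) (h2.add (integrable_const (C / 2))) h1
    rw [integral_const_mul, integral_add h2 (integrable_const _), integral_div] at h3
    simpa using h3
  set V := ∫ ω, (c * t ω) ^ 2 ∂P with hV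
  set b := ∫ ω, t ω ∂P with hb
  have h1 : V ≤ C * (c * b + 1) := by
    rw [hsq]
    calc c * (c * ∫ ω, t ω ^ 2 ∂P) ≤ c * (C * (b + 1)) := by gcongr
      _ = C * (c * b + c) := by ring
      _ ≤ _ := by gcongr
  have h2 : V ≤ C * (V / (2 * C) + C / 2 + 1) := h1.trans (by gcongr)
  have h3 : C * (V / (2 * C) + C / 2 + 1) = V / 2 + C ^ 2 / 2 + C := by
    field_simp
  linarith

theorem integral_two_mul_add {S R Q : Ω → ℝ} (hS : Integrable S P) (hR : Integrable R P)
    (hQ : Integrable Q P) :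
    ∫ ω, (2 * S ω + 2 * R ω + Q ω + 1) ∂P =
      2 * ∫ ω, S ω ∂P + 2 * ∫ ω, R ω ∂P + ∫ ω, Q ω ∂P + 1 := by
  have h1 : Integrable (fun ω => 2 * S ω + 2 * R ω) P := (hS.const_mul 2).add (hR.const_mul 2)
  have h2 : Integrable (fun ω => 2 * S ω + 2 * R ω + Q ω) P := h1.add hQ
  rw [integral_add h2 (integrable_const 1), integral_add h1 hQ,
    integral_add (hS.const_mul 2) (hR.const_mul 2), integral_const_mul, integral_const_mul]
  simp

/-- The second moments of the truncated stopping times, multiplied by `d ^ 4`, are bounded. -/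
theorem exists_integral_runLength_sq_le (hM : 0 < M) (hβ : β ≠ 0) (hα₀ : 0 < T.α) (hα₁ : T.α < 1)
    (hn₀ : p < T.n₀) (hε : 0 < T.ε) (hγ : 0 < T.γ)
    (hlam₀ : Tendsto (fun n : ℕ => (n : ℝ) ^ (1 / 2 : ℝ) * T.lam n) atTop (𝓝 0))
    (hlam₁ : Tendsto (fun n : ℕ => (n : ℝ) ^ (1 / 2 + T.γ * δ) * T.lam n) atTop atTop)
    (hSig : Sig.PosDef)
    (hA1 : Tendsto (fun n : ℕ => (1 / (n : ℝ)) • infoMatrix x n) atTop (𝓝 Sig))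
    (hY : ∀ ω i, Y ω i = x i ⬝ᵥ β + e i ω)
    (he : ∀ i, Measurable (e i)) (hind : iIndepFun e P)
    (hL2 : ∀ i, MemLp (e i) 2 P) (hmean : ∀ i, ∫ ω, e i ω ∂P = 0)
    (hvar : ∀ i, variance (e i) P = σ ^ 2) :
    ∃ B : ℝ, ∀ d : ℝ, 0 < d → d ≤ 1 → ∀ m : ℕ,
      ∫ ω, (d ^ 2 * runLength T x Y M d m ω) ^ 2 ∂P ≤ B := by
  obtain ⟨C, hC, k₀, hk₀⟩ :=
    exists_bound_of_notMem_stopSet hM hβ hα₀ hα₁ hn₀ hε hγ hlam₀ hlam₁ hSig hA1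
  obtain ⟨Cx, hCx, hx⟩ := exists_sum_sq_le hA1
  set C₁ : ℝ := 2 * C + 2 + ((k₀ : ℝ) + 1) ^ 2 with hC₁
  have hC₁0 : 0 < C₁ := by positivity
  set C₂ : ℝ := C₁ * (4 * p * σ ^ 2 * Cx + σ ^ 2 + 1) with hC₂
  have hC₂0 : 0 < C₂ := by positivity
  refine ⟨C₂ ^ 2 + 2 * C₂, fun d hd hd1 m => ?_⟩
  have hd2 : d ^ 2 ≤ 1 := pow_le_one₀ hd.le hd1
  set A : ℕ → Set Ω := notStopped T x Y M d with hAdef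
  have hA : ∀ i, MeasurableSet[pastAlg e i] (A i) := measurableSet_notStopped hY d
  have hAm : ∀ i, MeasurableSet (A i) := fun i => pastAlg_le he i _ (hA i)
  set t : Ω → ℝ := runLength T x Y M d m with ht
  have ht0 : ∀ ω, 0 ≤ t ω := fun ω =>
    Finset.sum_nonneg fun i _ => Set.indicator_nonneg (fun _ _ => zero_le_one) _
  have htL : MemLp t 2 P := by
    refine memLp_finsetSum _ fun i _ => (memLp_const (1 : ℝ)).indicator (hAm i)
  have htint : Integrable t P := htL.integrable (by norm_num)
  have hEt : ∫ ω, t ω ∂P = ∑ i ∈ Finset.range m, P.real (A i) := by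
    simp only [ht, runLength]
    rw [integral_finsetSum _ fun i _ => (integrable_const (1 : ℝ)).indicator (hAm i)]
    refine Finset.sum_congr rfl fun i _ => ?_
    rw [integral_indicator_const _ (hAm i)]
    simp
  have hpt := runLength_sq_le (T := T) (M := M) hC hd hd1 hY hk₀ m
  have hi1 : ∀ l, Integrable (fun ω => stoppedSum e (fun i => x i l) A m ω ^ 2) P := fun l =>
    (memLp_stoppedSum he hL2 _ hA m).integrable_sq
  have hi2 : ∀ i, Integrable (fun ω => (A i).indicator (fun ω => e i ω ^ 2) ω) P := fun i =>
    (hL2 i).integrable_sq.indicator (hAm i)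
  have hi3 : Integrable (fun ω => ∑ l, stoppedSum e (fun i => x i l) A m ω ^ 2) P :=
    integrable_finsetSum _ fun l _ => hi1 l
  have hi4' : ∀ l, Integrable (fun ω => ∑ i ∈ Finset.range m,
      x i l ^ 2 * (A i).indicator (fun ω => e i ω ^ 2) ω) P := fun l =>
    integrable_finsetSum _ fun i _ => (hi2 i).const_mul _
  have hi4 : Integrable (fun ω => ∑ l, ∑ i ∈ Finset.range m,
      x i l ^ 2 * (A i).indicator (fun ω => e i ω ^ 2) ω) P :=
    integrable_finsetSum _ fun l _ => hi4' l
  have hi5 : Integrable (fun ω => ∑ i ∈ Finset.range m,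
      (A i).indicator (fun ω => e i ω ^ 2) ω) P :=
    integrable_finsetSum _ fun i _ => hi2 i
  -- Single covariates need not be bounded, but their squares summed up to a random `τ` are pathwise
  -- at most `Cx τ`; taking expectations gives the bound.
  have hxE : ∀ l, ∑ i ∈ Finset.range m, x i l ^ 2 * P.real (A i) ≤ Cx * ∫ ω, t ω ∂P := by
    intro l
    have h1 : ∑ i ∈ Finset.range m, x i l ^ 2 * P.real (A i) =
        ∫ ω, ∑ i ∈ Finset.range m, (A i).indicator (fun _ => x i l ^ 2) ω ∂P := by
      rw [integral_finsetSum _ fun i _ => (integrable_const _).indicator (hAm i)]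
      refine Finset.sum_congr rfl fun i _ => ?_
      rw [integral_indicator_const _ (hAm i), smul_eq_mul, mul_comm]
    rw [h1, ← integral_const_mul]
    refine integral_mono
      (integrable_finsetSum _ fun i _ => (integrable_const _).indicator (hAm i))
      (htint.const_mul _) fun ω => ?_
    obtain ⟨τ, hτm, hτ⟩ := exists_mem_iff_lt (antitone_notStopped (T := T) (x := x) (Y := Y)
      (M := M) d) m ω
    have h2 : t ω = τ := by
      simp only [ht, runLength]
      rw [sum_indicator_eq hτm hτ]
      simp
    change ∑ i ∈ Finset.range m, (A i).indicator (fun _ => x i l ^ 2) ω ≤ Cx * t ω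
    rw [h2, sum_indicator_eq hτm hτ (fun i _ => x i l ^ 2)]
    exact hx l τ
  -- Wald's identity turns every term into `σ²` times a weighted sum of `P (A i)`, hence into a
  -- multiple of `E t`. The score term and the correction term each contribute `2 p σ² Cx`.
  have hE : d ^ 2 * ∫ ω, t ω ^ 2 ∂P ≤ C₂ * (∫ ω, t ω ∂P + 1) := by
    have hi6 : Integrable (fun ω => C₁ * (2 * ∑ l, stoppedSum e (fun i => x i l) A m ω ^ 2 +
        2 * ∑ l, ∑ i ∈ Finset.range m, x i l ^ 2 * (A i).indicator (fun ω => e i ω ^ 2) ω +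
        ∑ i ∈ Finset.range m, (A i).indicator (fun ω => e i ω ^ 2) ω + 1)) P :=
      ((((hi3.const_mul 2).add (hi4.const_mul 2)).add hi5).add (integrable_const 1)).const_mul C₁
    have h1 := integral_mono (htL.integrable_sq.const_mul (d ^ 2)) hi6 hpt
    rw [integral_const_mul, integral_const_mul, integral_two_mul_add hi3 hi4 hi5,
      integral_finsetSum _ fun l _ => hi1 l, integral_finsetSum _ fun l _ => hi4' l,
      integral_finsetSum _ fun i _ => hi2 i] at h1
    have h2 : ∀ l, ∫ ω, stoppedSum e (fun i => x i l) A m ω ^ 2 ∂P ≤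
        σ ^ 2 * (Cx * ∫ ω, t ω ∂P) := by
      intro l
      rw [integral_stoppedSum_sq he hind hL2 hmean hvar _ hA m]
      exact mul_le_mul_of_nonneg_left (hxE l) (sq_nonneg σ)
    have h3 : ∀ l, ∫ ω, ∑ i ∈ Finset.range m,
        x i l ^ 2 * (A i).indicator (fun ω => e i ω ^ 2) ω ∂P ≤ σ ^ 2 * (Cx * ∫ ω, t ω ∂P) := by
      intro l
      rw [integral_finsetSum _ fun i _ => (hi2 i).const_mul _]
      refine le_trans (le_of_eq ?_) (mul_le_mul_of_nonneg_left (hxE l) (sq_nonneg σ))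
      rw [Finset.mul_sum]
      refine Finset.sum_congr rfl fun i _ => ?_
      rw [integral_const_mul, integral_indicator_sq he hind hL2 hmean hvar (hA i)]
      ring
    have h4 : ∑ i ∈ Finset.range m, ∫ ω, (A i).indicator (fun ω => e i ω ^ 2) ω ∂P =
        σ ^ 2 * ∫ ω, t ω ∂P := by
      rw [hEt, Finset.mul_sum]
      exact Finset.sum_congr rfl fun i _ => integral_indicator_sq he hind hL2 hmean hvar (hA i)
    have h5 := Finset.sum_le_sum fun l (_ : l ∈ (Finset.univ : Finset (Fin p))) => h2 l
    have h6 := Finset.sum_le_sum fun l (_ : l ∈ (Finset.univ : Finset (Fin p))) => h3 l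
    rw [Finset.sum_const, Finset.card_univ, Fintype.card_fin, nsmul_eq_mul] at h5 h6
    have ht1 : 0 ≤ ∫ ω, t ω ∂P := integral_nonneg ht0
    rw [h4] at h1
    refine h1.trans ?_
    rw [hC₂, mul_assoc]
    refine mul_le_mul_of_nonneg_left ?_ hC₁0.le
    calc _ ≤ 2 * (p * (σ ^ 2 * (Cx * ∫ ω, t ω ∂P))) + 2 * (p * (σ ^ 2 * (Cx * ∫ ω, t ω ∂P))) +
          σ ^ 2 * ∫ ω, t ω ∂P + 1 := by gcongr
      _ = (4 * p * σ ^ 2 * Cx + σ ^ 2) * ∫ ω, t ω ∂P + 1 := by ring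
      _ ≤ (4 * p * σ ^ 2 * Cx + σ ^ 2 + 1) * (∫ ω, t ω ∂P + 1) := by
          have h7 : 0 ≤ 4 * p * σ ^ 2 * Cx + σ ^ 2 := by positivity
          linarith
  exact integral_sq_le_of_le htL (sq_nonneg d) hd2 hC₂0 hE

/-- The second moments of `d ^ 2` times the stopping time are finite and bounded. -/
theorem exists_integral_stopTime_sq_le (hM : 0 < M) (hβ : β ≠ 0) (hα₀ : 0 < T.α) (hα₁ : T.α < 1)
    (hn₀ : p < T.n₀) (hε : 0 < T.ε) (hγ : 0 < T.γ)
    (hlam₀ : Tendsto (fun n : ℕ => (n : ℝ) ^ (1 / 2 : ℝ) * T.lam n) atTop (𝓝 0))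
    (hlam₁ : Tendsto (fun n : ℕ => (n : ℝ) ^ (1 / 2 + T.γ * δ) * T.lam n) atTop atTop)
    (hSig : Sig.PosDef)
    (hA1 : Tendsto (fun n : ℕ => (1 / (n : ℝ)) • infoMatrix x n) atTop (𝓝 Sig))
    (hY : ∀ ω i, Y ω i = x i ⬝ᵥ β + e i ω)
    (he : ∀ i, Measurable (e i)) (hind : iIndepFun e P)
    (hL2 : ∀ i, MemLp (e i) 2 P) (hmean : ∀ i, ∫ ω, e i ω ∂P = 0)
    (hvar : ∀ i, variance (e i) P = σ ^ 2)
    (hne : ∀ᵐ ω ∂P, ∀ d : ℝ, 0 < d → (stopSet T x (Y ω) M d).Nonempty) :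
    ∃ B : ℝ, ∀ d : ℝ, 0 < d → d ≤ 1 →
      MemLp (fun ω => d ^ 2 * (stopTime T x (Y ω) M d : ℝ)) 2 P ∧
        ∫ ω, (d ^ 2 * (stopTime T x (Y ω) M d : ℝ)) ^ 2 ∂P ≤ B := by
  obtain ⟨B, hB⟩ := exists_integral_runLength_sq_le hM hβ hα₀ hα₁ hn₀ hε hγ hlam₀ hlam₁ hSig hA1
    hY he hind hL2 hmean hvar
  refine ⟨B, fun d hd hd1 => ?_⟩
  have hYm : ∀ i, Measurable fun ω => Y ω i := fun i => by
    simp only [hY]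
    exact (he i).const_add _
  have hNm : Measurable fun ω => (stopTime T x (Y ω) M d : ℝ) :=
    measurable_from_top.comp (measurable_stopTime T x M d hYm)
  -- Truncation at `m` makes the moments finite, so the uniform bound applies; monotone convergence
  -- removes it.
  set f : ℕ → Ω → ℝ := fun m ω => (d ^ 2 * ((min (stopTime T x (Y ω) M d) m : ℕ) : ℝ)) ^ 2 with hf
  have hfm : ∀ m, Measurable (f m) := fun m =>
    (measurable_from_top (f := fun n : ℕ => (d ^ 2 * ((min n m : ℕ) : ℝ)) ^ 2)).comp
      (measurable_stopTime T x M d hYm)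
  have hfB : ∀ m, ∫⁻ ω, ENNReal.ofReal (f m ω) ∂P ≤ ENNReal.ofReal B := by
    intro m
    have hi : Integrable (f m) P := by
      refine Integrable.of_bound (C := (d ^ 2 * m) ^ 2) (hfm m).aestronglyMeasurable
        (ae_of_all _ fun ω => ?_)
      rw [Real.norm_of_nonneg (sq_nonneg _)]
      refine pow_le_pow_left₀ (by positivity) (mul_le_mul_of_nonneg_left ?_ (sq_nonneg d)) 2
      exact_mod_cast min_le_right _ _
    rw [← ofReal_integral_eq_lintegral_ofReal hi (ae_of_all _ fun ω => sq_nonneg _)]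
    refine ENNReal.ofReal_le_ofReal (le_trans (le_of_eq ?_) (hB d hd hd1 m))
    refine integral_congr_ae ?_
    filter_upwards [hne] with ω hω
    simp only [hf, runLength_eq_min (hω d hd)]
  have hlim : Tendsto (fun m => ∫⁻ ω, ENNReal.ofReal (f m ω) ∂P) atTop
      (𝓝 (∫⁻ ω, ENNReal.ofReal ((d ^ 2 * (stopTime T x (Y ω) M d : ℝ)) ^ 2) ∂P)) := by
    refine lintegral_tendsto_of_tendsto_of_monotone
      (fun m => (hfm m).ennreal_ofReal.aemeasurable) (ae_of_all _ fun ω m n hmn => ?_)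
      (ae_of_all _ fun ω => ?_)
    · refine ENNReal.ofReal_le_ofReal (pow_le_pow_left₀ (by positivity)
        (mul_le_mul_of_nonneg_left ?_ (sq_nonneg d)) 2)
      exact_mod_cast min_le_min le_rfl hmn
    · refine tendsto_const_nhds.congr' ?_
      filter_upwards [eventually_ge_atTop (stopTime T x (Y ω) M d)] with m hm
      simp only [hf]
      rw [min_eq_left hm]
  have hle := le_of_tendsto' hlim hfB
  have hgm : Measurable fun ω => d ^ 2 * (stopTime T x (Y ω) M d : ℝ) := hNm.const_mul _
  have hint : Integrable (fun ω => (d ^ 2 * (stopTime T x (Y ω) M d : ℝ)) ^ 2) P := by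
    refine ⟨(hgm.pow_const 2).aestronglyMeasurable, ?_⟩
    rw [hasFiniteIntegral_iff_ofReal (ae_of_all _ fun ω => sq_nonneg _)]
    exact hle.trans_lt ENNReal.ofReal_lt_top
  refine ⟨(memLp_two_iff_integrable_sq hgm.aestronglyMeasurable).2 hint, ?_⟩
  have hB0 : 0 ≤ B := (integral_nonneg fun ω => sq_nonneg _).trans (hB d hd hd1 0)
  rw [← ofReal_integral_eq_lintegral_ofReal hint (ae_of_all _ fun ω => sq_nonneg _)] at hle
  exact (ENNReal.ofReal_le_ofReal_iff hB0).1 hle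

/-- Almost sure convergence of nonnegative variables with bounded second moments implies
convergence of the expectations. -/
theorem tendsto_integral_of_sq_bounded {ι : Type*} {l : Filter ι} [l.IsCountablyGenerated]
    {f : ι → Ω → ℝ} {L B : ℝ} (hf0 : ∀ i ω, 0 ≤ f i ω) (hfL : ∀ᶠ i in l, MemLp (f i) 2 P)
    (hB : ∀ᶠ i in l, ∫ ω, f i ω ^ 2 ∂P ≤ B)
    (hlim : ∀ᵐ ω ∂P, Tendsto (fun i => f i ω) l (𝓝 L)) :
    Tendsto (fun i => ∫ ω, f i ω ∂P) l (𝓝 L) := by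
  rw [Metric.tendsto_nhds]
  intro η hη
  -- Truncation at `K ≥ L` preserves the limit. Since `f ≤ min f K + f² / K`, the part cut off has
  -- mean at most `B / K < η / 2`.
  set K : ℝ := |L| + 2 * (|B| + 1) / η with hK
  have hK0 : 0 < K := by positivity
  have hLK : L ≤ K := by
    have : 0 ≤ 2 * (|B| + 1) / η := by positivity
    linarith [le_abs_self L]
  have h1 : Tendsto (fun i => ∫ ω, min (f i ω) K ∂P) l (𝓝 (∫ _ω, L ∂P)) := by
    refine tendsto_integral_filter_of_dominated_convergence (fun _ => K) ?_ ?_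
      (integrable_const K) ?_
    · filter_upwards [hfL] with i hi
      exact hi.aestronglyMeasurable.inf aestronglyMeasurable_const
    · refine Eventually.of_forall fun i => ae_of_all _ fun ω => ?_
      rw [Real.norm_of_nonneg (le_min (hf0 i ω) hK0.le)]
      exact min_le_right _ _
    · filter_upwards [hlim] with ω hω
      have := hω.min (tendsto_const_nhds (x := K))
      rwa [min_eq_left hLK] at this
  simp only [integral_const, probReal_univ, smul_eq_mul, one_mul] at h1
  filter_upwards [hfL, hB, h1.eventually (Metric.ball_mem_nhds L (half_pos hη))] with i hi hBi hd
  have hfi : Integrable (f i) P := hi.integrable (by norm_num)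
  have hmi : Integrable (fun ω => min (f i ω) K) P := hfi.inf (integrable_const K)
  have h2 : ∫ ω, min (f i ω) K ∂P ≤ ∫ ω, f i ω ∂P :=
    integral_mono hmi hfi fun ω => min_le_left _ _
  have h3 : ∫ ω, f i ω ∂P ≤ ∫ ω, min (f i ω) K ∂P + B / K := by
    have h4 : ∫ ω, f i ω ∂P ≤ ∫ ω, (min (f i ω) K + f i ω ^ 2 / K) ∂P := by
      refine integral_mono hfi (hmi.add (hi.integrable_sq.div_const K)) fun ω => ?_
      change f i ω ≤ min (f i ω) K + f i ω ^ 2 / K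
      rcases le_total (f i ω) K with h | h
      · rw [min_eq_left h]
        have : 0 ≤ f i ω ^ 2 / K := by positivity
        linarith
      · have h5 : f i ω ≤ f i ω ^ 2 / K := by
          rw [le_div_iff₀ hK0]
          nlinarith [hf0 i ω]
        rw [min_eq_right h]
        linarith
    rw [integral_add hmi (hi.integrable_sq.div_const K), integral_div] at h4
    refine h4.trans ?_
    gcongr
  have h6 : B / K < η / 2 := by
    rw [div_lt_iff₀ hK0, hK]
    have h7 : η / 2 * (|L| + 2 * (|B| + 1) / η) = η / 2 * |L| + (|B| + 1) := by
      field_simp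
    rw [h7]
    have : 0 ≤ η / 2 * |L| := by positivity
    linarith [le_abs_self B]
  rw [Real.dist_eq] at hd ⊢
  rw [abs_lt] at hd ⊢
  constructor <;> linarith [hd.1, hd.2]

end SecondMoment

/-! ### Convergence in probability and a Slutsky argument -/

section InProbability

variable {Ω : Type*} [mΩ : MeasurableSpace Ω] {P : Measure Ω} [IsProbabilityMeasure P]
  {ι : Type*} {l : Filter ι}

/-- For variables with values in a discrete space, an almost sure eventual statement implies the
corresponding statement in probability. -/
theorem tendsto_measureReal_of_ae_eventually [l.IsCountablyGenerated] {γ : Type*}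
    [MeasurableSpace γ] [DiscreteMeasurableSpace γ] {Z : ι → Ω → γ} (hZ : ∀ i, Measurable (Z i))
    {W : ι → Set γ} (h : ∀ᵐ ω ∂P, ∀ᶠ i in l, Z i ω ∉ W i) :
    Tendsto (fun i => P.real {ω | Z i ω ∈ W i}) l (𝓝 0) := by
  have h1 := tendsto_measure_of_ae_tendsto_indicator_of_isFiniteMeasure (μ := P) l
    MeasurableSet.empty (As := fun i => {ω | Z i ω ∈ W i})
    (fun i => hZ i (MeasurableSet.of_discrete (s := W i))) (by
      filter_upwards [h] with ω hω
      filter_upwards [hω] with i hi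
      simpa using hi)
  have h2 := (ENNReal.tendsto_toReal (measure_ne_top P ∅)).comp h1
  simpa [Function.comp_def, measureReal_def] using h2

theorem tendsto_measureReal_union {s t : ι → Set Ω} (hs : Tendsto (fun i => P.real (s i)) l (𝓝 0))
    (ht : Tendsto (fun i => P.real (t i)) l (𝓝 0)) :
    Tendsto (fun i => P.real (s i ∪ t i)) l (𝓝 0) := by
  have h := hs.add ht
  rw [add_zero] at h
  exact squeeze_zero (fun _ => measureReal_nonneg) (fun i => measureReal_union_le _ _) h

theorem tendsto_measureReal_iUnion {κ : Type*} [Fintype κ] {s : κ → ι → Set Ω}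
    (hs : ∀ k, Tendsto (fun i => P.real (s k i)) l (𝓝 0)) :
    Tendsto (fun i => P.real (⋃ k, s k i)) l (𝓝 0) := by
  have h := tendsto_finsetSum Finset.univ fun k _ => hs k
  rw [Finset.sum_const_zero] at h
  exact squeeze_zero (fun _ => measureReal_nonneg)
    (fun i => measureReal_iUnion_fintype_le _) h

/-- If `X` is bounded in probability and `Y` converges in probability to a constant, then the
latter may be replaced by the former in continuous functions of `X` and `Y`. -/
theorem tendsto_measureReal_le_abs_sub {E F : Type*} [NormedAddCommGroup E] [ProperSpace E]
    [TopologicalSpace F] {X : ι → Ω → E} {Y : ι → Ω → F} {y₀ : F} {g : E → F → ℝ}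
    (hg : Continuous fun u : E × F => g u.1 u.2)
    (hX : ∀ η : ℝ, 0 < η → ∃ K : ℝ, ∀ᶠ i in l, P.real {ω | K < ‖X i ω‖} ≤ η)
    (hY : ∀ V ∈ 𝓝 y₀, Tendsto (fun i => P.real {ω | Y i ω ∉ V}) l (𝓝 0)) {η : ℝ} (hη : 0 < η) :
    Tendsto (fun i => P.real {ω | η ≤ |g (X i ω) (Y i ω) - g (X i ω) y₀|}) l (𝓝 0) := by
  rw [Metric.tendsto_nhds]
  intro ζ hζ
  obtain ⟨K, hK⟩ := hX (ζ / 2) (half_pos hζ)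
  -- Tightness confines `X` to a compact ball, over which the dependence of `g` on its second
  -- argument near `y₀` is uniform.
  have hV : ∀ᶠ y in 𝓝 y₀, ∀ x ∈ Metric.closedBall (0 : E) K, |g x y - g x y₀| < η := by
    refine (isCompact_closedBall (0 : E) K).eventually_forall_of_forall_eventually ?_
    intro x _
    have hc : Continuous fun z : F × E => |g z.2 z.1 - g z.2 y₀| := by
      have h1 : Continuous fun z : F × E => g z.2 z.1 :=
        hg.comp (continuous_snd.prodMk continuous_fst)
      have h2 : Continuous fun z : F × E => g z.2 y₀ :=
        hg.comp (continuous_snd.prodMk continuous_const)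
      exact (h1.sub h2).abs
    refine (hc.tendsto (y₀, x)).eventually_lt_const ?_
    simpa using hη
  filter_upwards [hK, (hY _ hV).eventually_lt_const (half_pos hζ)] with i h1 h2
  rw [Real.dist_eq, sub_zero, abs_of_nonneg measureReal_nonneg]
  have hsub : {ω | η ≤ |g (X i ω) (Y i ω) - g (X i ω) y₀|} ⊆
      {ω | K < ‖X i ω‖} ∪ {ω | Y i ω ∉
        {y | ∀ x ∈ Metric.closedBall (0 : E) K, |g x y - g x y₀| < η}} := by
    intro ω hω
    by_cases hx : K < ‖X i ω‖
    · exact Or.inl hx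
    · refine Or.inr fun hy => ?_
      have := hy (X i ω) (mem_closedBall_zero_iff.2 (not_lt.1 hx))
      exact absurd hω (not_le.2 this)
  calc _ ≤ _ := measureReal_mono hsub
    _ ≤ _ := measureReal_union_le _ _
    _ < ζ / 2 + ζ / 2 := add_lt_add_of_le_of_lt h1 h2
    _ = ζ := add_halves ζ

/-- Slutsky's theorem for distribution functions: `φ s` are probabilities with fixed threshold `s`,
and `f` is one with a perturbed threshold, trapped between `r - η` and `r + η` up to the null error
`b η`. Continuity of `F` allows small `η`. -/
theorem tendsto_of_squeeze_continuous {F : ℝ → ℝ} (hF : Continuous F) {r : ℝ} {f : ι → ℝ}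
    {φ : ℝ → ι → ℝ} {b : ℝ → ι → ℝ} (hφ : ∀ s, Tendsto (φ s) l (𝓝 (F s)))
    (hb : ∀ η, 0 < η → Tendsto (b η) l (𝓝 0))
    (hlow : ∀ η, 0 < η → ∀ᶠ i in l, φ (r - η) i ≤ f i + b η i)
    (hup : ∀ η, 0 < η → ∀ᶠ i in l, f i ≤ φ (r + η) i + b η i) :
    Tendsto f l (𝓝 (F r)) := by
  rw [Metric.tendsto_nhds]
  intro ζ hζ
  obtain ⟨κ, hκ, hκF⟩ := Metric.continuousAt_iff.1 hF.continuousAt (ζ / 3)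
    (by positivity : 0 < ζ / 3)
  have hη : 0 < κ / 2 := half_pos hκ
  have e1 := hκF (x := r - κ / 2) (by
    rw [Real.dist_eq, sub_sub_cancel_left, abs_neg, abs_of_pos hη]; linarith)
  have e2 := hκF (x := r + κ / 2) (by
    rw [Real.dist_eq, add_sub_cancel_left, abs_of_pos hη]; linarith)
  rw [Real.dist_eq, abs_lt] at e1 e2
  filter_upwards [hlow _ hη, hup _ hη,
    (hφ (r - κ / 2)).eventually (Metric.ball_mem_nhds _ (by positivity : 0 < ζ / 3)),
    (hφ (r + κ / 2)).eventually (Metric.ball_mem_nhds _ (by positivity : 0 < ζ / 3)),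
    (hb _ hη).eventually (Metric.ball_mem_nhds _ (by positivity : 0 < ζ / 3))] with i h1 h2 h3 h4 h5
  rw [Real.dist_eq, abs_lt] at h3 h4 h5 ⊢
  constructor <;> linarith [h3.1, h3.2, h4.1, h4.2, h5.1, h5.2, e1.1, e1.2, e2.1, e2.2]

end InProbability

/-! ### Random sample sizes: tightness and Anscombe's condition -/

section RandomIndex

variable {Ω : Type*} [mΩ : MeasurableSpace Ω] {P : Measure Ω} [IsProbabilityMeasure P]
  {ι : Type*} {f : Filter ι} {ξ : ℕ → Ω → ℝ} {σ : ℝ}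

/-- The normalized weighted sums are bounded in probability. -/
theorem measureReal_lt_abs_sum_div_sqrt_le (hξ : ∀ i, Measurable (ξ i)) (hind : iIndepFun ξ P)
    (hL2 : ∀ i, MemLp (ξ i) 2 P) (hmean : ∀ i, ∫ ω, ξ i ω ∂P = 0)
    (hvar : ∀ i, variance (ξ i) P = σ ^ 2) (a : ℕ → ℝ) {C : ℝ}
    (ha : ∀ n : ℕ, ∑ i ∈ Finset.range n, a i ^ 2 ≤ C * n) {n : ℕ} (hn : 0 < n) {K : ℝ}
    (hK : 0 < K) :
    P.real {ω | K < |(∑ i ∈ Finset.range n, a i * ξ i ω) / √n|} ≤ σ ^ 2 * C / K ^ 2 := by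
  have hn' : (0 : ℝ) < n := by exact_mod_cast hn
  have hs : 0 < √(n : ℝ) := Real.sqrt_pos.2 hn'
  have h1 := measureReal_exists_le_abs_sum hξ hind hL2 hmean hvar a n (c := K * √n) (by positivity)
  have hsub : {ω | K < |(∑ i ∈ Finset.range n, a i * ξ i ω) / √n|} ⊆
      {ω | ∃ k ≤ n, K * √n ≤ |∑ i ∈ Finset.range k, a i * ξ i ω|} := by
    intro ω hω
    refine ⟨n, le_rfl, ?_⟩
    have h2 : K < |(∑ i ∈ Finset.range n, a i * ξ i ω) / √n| := hω
    rw [abs_div, abs_of_pos hs, lt_div_iff₀ hs] at h2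
    exact h2.le
  refine ((measureReal_mono hsub).trans h1).trans ?_
  rw [mul_pow, Real.sq_sqrt hn'.le, div_le_div_iff₀ (by positivity) (by positivity)]
  have := mul_le_mul_of_nonneg_left (ha n) (by positivity : 0 ≤ σ ^ 2 * K ^ 2)
  linarith

/-- Anscombe's condition: a random index that is asymptotic to `n` may be replaced by `n` in the
normalized sums. -/
theorem tendsto_measureReal_randomIndex [f.IsCountablyGenerated] (hξ : ∀ i, Measurable (ξ i))
    (hind : iIndepFun ξ P)
    (hL2 : ∀ i, MemLp (ξ i) 2 P) (hmean : ∀ i, ∫ ω, ξ i ω ∂P = 0)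
    (hvar : ∀ i, variance (ξ i) P = σ ^ 2) (a : ℕ → ℝ) {q : ℝ}
    (ha : Tendsto (fun n : ℕ => 1 / (n : ℝ) * ∑ i ∈ Finset.range n, a i ^ 2) atTop (𝓝 q))
    {n : ι → ℕ} (hn : Tendsto n f atTop) {N : ι → Ω → ℕ} (hN : ∀ i, Measurable (N i))
    (hNn : ∀ᵐ ω ∂P, Tendsto (fun i => (N i ω : ℝ) / n i) f (𝓝 1)) {κ : ℝ} (hκ : 0 < κ) :
    Tendsto (fun i => P.real {ω | κ ≤ |(∑ k ∈ Finset.range (N i ω), a k * ξ k ω -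
      ∑ k ∈ Finset.range (n i), a k * ξ k ω) / √(n i)|}) f (𝓝 0) := by
  have hq : 0 ≤ q := ge_of_tendsto' ha fun n =>
    mul_nonneg (by positivity) (Finset.sum_nonneg fun _ _ => sq_nonneg _)
  rw [Metric.tendsto_nhds]
  intro ζ hζ
  -- Between `(1 - η) n` and `(1 + η) n` the squared weights sum to about `2 q η n`; Kolmogorov's
  -- inequality at level `κ √n / 2` then gives the displayed bound.
  obtain ⟨η, hη0, hη1, hηζ⟩ : ∃ η : ℝ, 0 < η ∧ η < 1 ∧ 4 * σ ^ 2 / κ ^ 2 * (2 * q * η) < ζ / 2 := by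
    set D := 4 * σ ^ 2 / κ ^ 2 * (2 * q) with hD
    have hD0 : 0 ≤ D := by positivity
    refine ⟨min (1 / 2) (ζ / (4 * (D + 1))), by positivity,
      (min_le_left _ _).trans_lt (by norm_num), ?_⟩
    calc 4 * σ ^ 2 / κ ^ 2 * (2 * q * min (1 / 2) (ζ / (4 * (D + 1))))
        = D * min (1 / 2) (ζ / (4 * (D + 1))) := by rw [hD]; ring
      _ ≤ D * (ζ / (4 * (D + 1))) := by gcongr; exact min_le_right _ _
      _ ≤ (D + 1) * (ζ / (4 * (D + 1))) := by gcongr; linarith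
      _ = ζ / 4 := by field_simp
      _ < ζ / 2 := by linarith
  set n₁ : ι → ℕ := fun i => ⌊(1 - η) * n i⌋₊ with hn₁
  set n₂ : ι → ℕ := fun i => ⌈(1 + η) * n i⌉₊ with hn₂
  have hnR : Tendsto (fun i => (n i : ℝ)) f atTop := tendsto_natCast_atTop_atTop.comp hn
  have hlim₁ : Tendsto (fun i => (n₁ i : ℝ) / n i) f (𝓝 (1 - η)) :=
    (tendsto_nat_floor_mul_div_atTop (R := ℝ) (by linarith)).comp hnR
  have hlim₂ : Tendsto (fun i => (n₂ i : ℝ) / n i) f (𝓝 (1 + η)) :=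
    (tendsto_nat_ceil_mul_div_atTop (R := ℝ) (by linarith)).comp hnR
  have htop₁ : Tendsto n₁ f atTop :=
    tendsto_nat_floor_atTop.comp (hnR.const_mul_atTop (by linarith))
  have hA : ∀ {m : ι → ℕ} {c : ℝ}, Tendsto m f atTop → Tendsto (fun i => (m i : ℝ) / n i) f (𝓝 c) →
      Tendsto (fun i => (∑ k ∈ Finset.range (m i), a k ^ 2) / n i) f (𝓝 (q * c)) := by
    intro m c hm hc
    refine ((ha.comp hm).mul hc).congr' ?_
    filter_upwards [hm.eventually_gt_atTop 0] with i hi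
    have : (m i : ℝ) ≠ 0 := by positivity
    simp only [Function.comp]
    field_simp
  have hle₁ : ∀ i, n₁ i ≤ n i := fun i => by
    refine Nat.floor_le_of_le ?_
    nlinarith [(Nat.cast_nonneg (n i) : (0 : ℝ) ≤ n i)]
  have hle₂ : ∀ i, n i ≤ n₂ i := fun i => by
    have : (n i : ℝ) ≤ n₂ i := by
      refine le_trans ?_ (Nat.le_ceil _)
      nlinarith [(Nat.cast_nonneg (n i) : (0 : ℝ) ≤ n i)]
    exact_mod_cast this
  have htop₂ : Tendsto n₂ f atTop := tendsto_atTop_mono hle₂ hn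
  have hdiff := ((hA htop₂ hlim₂).sub (hA htop₁ hlim₁)).const_mul (4 * σ ^ 2 / κ ^ 2)
  have hdiff' : 4 * σ ^ 2 / κ ^ 2 * (q * (1 + η) - q * (1 - η)) < ζ / 2 := by
    refine lt_of_eq_of_lt ?_ hηζ
    ring
  have hout := tendsto_measureReal_of_ae_eventually (P := P) hN
    (W := fun i => {k | ¬ (n₁ i ≤ k ∧ k ≤ n₂ i)}) (l := f) (by
      filter_upwards [hNn] with ω hω
      filter_upwards [hω.eventually_const_lt (by linarith : 1 - η < 1),
        hω.eventually_lt_const (by linarith : 1 < 1 + η), hn.eventually_gt_atTop 0] with i h1 h2 h3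
      have h3' : (0 : ℝ) < n i := by exact_mod_cast h3
      rw [lt_div_iff₀ h3'] at h1
      rw [div_lt_iff₀ h3'] at h2
      simp only [not_not]
      refine ⟨Nat.floor_le_of_le h1.le, ?_⟩
      have : (N i ω : ℝ) ≤ n₂ i := h2.le.trans (Nat.le_ceil _)
      exact_mod_cast this)
  filter_upwards [hdiff.eventually_lt_const hdiff', hout.eventually_lt_const (half_pos hζ),
    hn.eventually_gt_atTop 0] with i h1 h2 h3
  have h3' : (0 : ℝ) < n i := by exact_mod_cast h3
  have hs : 0 < √(n i : ℝ) := Real.sqrt_pos.2 h3'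
  rw [Real.dist_eq, sub_zero, abs_of_nonneg measureReal_nonneg]
  -- Deleting the weights before `n₁` makes the partial sums start there. The sums at `N` and `n`
  -- differ by two such sums, one of which must reach half the level.
  set b : ℕ → ℝ := fun k => if n₁ i ≤ k then a k else 0 with hb
  have hbsum : ∀ k, n₁ i ≤ k → ∀ ω, ∑ m ∈ Finset.range k, b m * ξ m ω =
      ∑ m ∈ Finset.range k, a m * ξ m ω - ∑ m ∈ Finset.range (n₁ i), a m * ξ m ω := by
    intro k hk ω
    rw [← Finset.sum_range_add_sum_Ico _ hk, ← Finset.sum_range_add_sum_Ico _ hk,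
      add_sub_cancel_left]
    have e1 : ∑ m ∈ Finset.range (n₁ i), b m * ξ m ω = 0 :=
      Finset.sum_eq_zero fun m hm => by
        simp [hb, not_le.2 (Finset.mem_range.1 hm)]
    rw [e1, zero_add]
    exact Finset.sum_congr rfl fun m hm => by simp [hb, (Finset.mem_Ico.1 hm).1]
  have hbsq : ∑ m ∈ Finset.range (n₂ i), b m ^ 2 =
      ∑ m ∈ Finset.range (n₂ i), a m ^ 2 - ∑ m ∈ Finset.range (n₁ i), a m ^ 2 := by
    have hk := (hle₁ i).trans (hle₂ i)
    rw [← Finset.sum_range_add_sum_Ico _ hk, ← Finset.sum_range_add_sum_Ico (fun m => a m ^ 2) hk,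
      add_sub_cancel_left]
    have e1 : ∑ m ∈ Finset.range (n₁ i), b m ^ 2 = 0 :=
      Finset.sum_eq_zero fun m hm => by
        simp [hb, not_le.2 (Finset.mem_range.1 hm)]
    rw [e1, zero_add]
    exact Finset.sum_congr rfl fun m hm => by simp [hb, (Finset.mem_Ico.1 hm).1]
  have hkol := measureReal_exists_le_abs_sum hξ hind hL2 hmean hvar b (n₂ i)
    (c := κ * √(n i) / 2) (by positivity)
  have hsub : {ω | κ ≤ |(∑ k ∈ Finset.range (N i ω), a k * ξ k ω -
      ∑ k ∈ Finset.range (n i), a k * ξ k ω) / √(n i)|} ⊆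
      {ω | ∃ k ≤ n₂ i, κ * √(n i) / 2 ≤ |∑ m ∈ Finset.range k, b m * ξ m ω|} ∪
        {ω | N i ω ∈ {k | ¬ (n₁ i ≤ k ∧ k ≤ n₂ i)}} := by
    intro ω hω
    by_cases hin : n₁ i ≤ N i ω ∧ N i ω ≤ n₂ i
    · left
      have e1 : κ ≤ |(∑ k ∈ Finset.range (N i ω), a k * ξ k ω -
        ∑ k ∈ Finset.range (n i), a k * ξ k ω) / √(n i)| := hω
      rw [abs_div, abs_of_pos hs, le_div_iff₀ hs] at e1
      have e2 : ∑ k ∈ Finset.range (N i ω), a k * ξ k ω - ∑ k ∈ Finset.range (n i), a k * ξ k ω =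
          ∑ m ∈ Finset.range (N i ω), b m * ξ m ω - ∑ m ∈ Finset.range (n i), b m * ξ m ω := by
        rw [hbsum _ hin.1, hbsum _ (hle₁ i)]; ring
      rw [e2] at e1
      have e3 := e1.trans (abs_sub _ _)
      rcases le_or_gt (κ * √(n i) / 2) |∑ m ∈ Finset.range (N i ω), b m * ξ m ω| with h | h
      · exact ⟨_, hin.2, h⟩
      · exact ⟨_, hle₂ i, by linarith⟩
    · exact Or.inr hin
  calc _ ≤ _ := measureReal_mono hsub
    _ ≤ _ := measureReal_union_le _ _
    _ < ζ / 2 + ζ / 2 := by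
        refine add_lt_add (lt_of_le_of_lt (hkol.trans (le_of_eq ?_)) h1) h2
        rw [hbsq, div_pow, mul_pow, Real.sq_sqrt h3'.le]
        field_simp
        norm_num
    _ = ζ := by ring

end RandomIndex

/-! ### The combined procedure as a quadratic form in the scores -/

section Combination

variable {p M : ℕ}

/-- The quadratic form with matrix `A` of the selected components of `∑ j, B j (U j)`. -/
noncomputable def selForm {c : Fin p → ℕ}
    (A : Matrix {l : Fin p // c l = 1} {l : Fin p // c l = 1} ℝ)
    (B : Fin M → Matrix (Fin p) (Fin p) ℝ) (U : Fin M → Fin p → ℝ) : ℝ :=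
  (fun l : {l : Fin p // c l = 1} => ∑ j, (B j).mulVec (U j) l) ⬝ᵥ
    A.mulVec (fun l : {l : Fin p // c l = 1} => ∑ j, (B j).mulVec (U j) l)

/-- The sum of the information matrices at the stages `k j`. -/
def sumInfo (x : Fin M → ℕ → Fin p → ℝ) (k : Fin M → ℕ) : Matrix (Fin p) (Fin p) ℝ :=
  ∑ j, infoMatrix (x j) (k j)

/-- The sum of the stages `k j`. -/
def sumStages (k : Fin M → ℕ) : ℝ := ((∑ j, k j : ℕ) : ℝ)

theorem posSemidef_sumInfo (x : Fin M → ℕ → Fin p → ℝ) (k : Fin M → ℕ) :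
    (sumInfo x k).PosSemidef :=
  Matrix.posSemidef_sum _ fun j _ => posSemidef_infoMatrix (x j) (k j)

theorem suppInd_eq_zero_or_one (β : Fin p → ℝ) (l : Fin p) : suppInd β l = 0 ∨ suppInd β l = 1 := by
  unfold suppInd
  split_ifs
  · exact Or.inr rfl
  · exact Or.inl rfl

/-- Powers of zero and one; `M > 0` excludes the empty product, which would select every variable.
-/
theorem prod_suppInd (hM : 0 < M) (β : Fin p → ℝ) (l : Fin p) :
    ∏ _j : Fin M, suppInd β l = suppInd β l := by
  rw [Finset.prod_const, Finset.card_univ, Fintype.card_fin]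
  rcases suppInd_eq_zero_or_one β l with h | h
  · rw [h, zero_pow hM.ne']
  · rw [h, one_pow]

variable {T : Tuning} {x : Fin M → ℕ → Fin p → ℝ} {y e : Fin M → ℕ → ℝ} {d : ℝ} {β : Fin p → ℝ}

theorem combInd_eq_suppInd (hM : 0 < M)
    (hind : ∀ j, ind T (x j) (y j) (stopN T x y d j) = suppInd β) :
    combInd T x y d = suppInd β := by
  funext l
  simp only [combInd, hind]
  exact prod_suppInd hM β l

/-- When all procedures select the right variables, the membership of the true parameter in the
confidence set is an inequality for a quadratic form of the scores. -/
theorem mem_confSet_iff (hM : 0 < M) (hy : ∀ j i, y j i = x j i ⬝ᵥ β + e j i)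
    (hind : ∀ j, ind T (x j) (y j) (stopN T x y d j) = suppInd β)
    (hu : ∀ j, IsUnit (infoMatrix (x j) (stopN T x y d j)))
    (hG : (sumInfo x (stopN T x y d)).PosDef) (ht : 0 < sumStages (stopN T x y d))
    {n : ℕ} (hn : 0 < n) :
    β ∈ confSet T x y d ↔
      selForm (schurMat (suppInd β)
          ((1 / sumStages (stopN T x y d)) • sumInfo x (stopN T x y d)))
        (fun j => ((n : ℝ) / sumStages (stopN T x y d)) •
          ((stopN T x y d j : ℝ) • (infoMatrix (x j) (stopN T x y d j))⁻¹))
        (fun j l => score (x j) (e j) (stopN T x y d j) l / √n) ≤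
      n * (d ^ 2 / selEig (suppInd β) (sumStages (stopN T x y d))
        (sumInfo x (stopN T x y d))) := by
  have hc := combInd_eq_suppInd hM hind
  have hn' : (0 : ℝ) < n := by exact_mod_cast hn
  have hs : 0 < √(n : ℝ) := Real.sqrt_pos.2 hn'
  have hν : nuTilde T x y d = selEig (suppInd β) (sumStages (stopN T x y d))
      (sumInfo x (stopN T x y d)) := by
    rw [← hc]
    rfl
  have hzero : ∀ l, combInd T x y d l = 0 → β l = 0 := by
    intro l hl
    rw [hc] at hl
    by_contra h
    simp [suppInd, h] at hl
  have hQ : ∀ c : Fin p → ℕ, combInd T x y d = c → quadS T x y d β =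
      (fun l : {l : Fin p // c l = 1} => (β - combEst T x y d) l) ⬝ᵥ
        (schurMat c (sumInfo x (stopN T x y d))).mulVec
          (fun l : {l : Fin p // c l = 1} => (β - combEst T x y d) l) := by
    rintro c rfl
    exact quadS_eq T x y d β
  -- The combined estimate errs by the average, with weights `Nⱼ / N`, of `(X Xᵀ)⁻¹ X e`. Scaling by
  -- `√n` leaves convergent matrices acting on `score / √n`; the sign is immaterial in a quadratic
  -- form.
  have hw : ∀ l : {l : Fin p // suppInd β l = 1},
      ∑ j, ((((n : ℝ) / sumStages (stopN T x y d)) •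
          ((stopN T x y d j : ℝ) • (infoMatrix (x j) (stopN T x y d j))⁻¹)).mulVec
            (fun l => score (x j) (e j) (stopN T x y d j) l / √n)) l =
        -√n * (β - combEst T x y d) l := by
    intro l
    have hl : (combInd T x y d l : ℝ) = 1 := by rw [hc, l.2, Nat.cast_one]
    have h1 : combEst T x y d l =
        ∑ j, (stopN T x y d j : ℝ) / sumStages (stopN T x y d) *
          (β l + (infoMatrix (x j) (stopN T x y d j))⁻¹.mulVec
            (score (x j) (e j) (stopN T x y d j)) l) := by
      rw [combEst, combMatrix, Matrix.mulVec_diagonal, hl, one_mul, Finset.sum_apply]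
      refine Finset.sum_congr rfl fun j _ => ?_
      rw [Pi.smul_apply, aseEst, indMatrix, Matrix.mulVec_diagonal, hind j, l.2, Nat.cast_one,
        one_mul, lse_eq (hy j) (hu j), smul_eq_mul, Pi.add_apply]
      rfl
    have h2 : ∑ j, (stopN T x y d j : ℝ) / sumStages (stopN T x y d) = 1 := by
      rw [← Finset.sum_div, ← Nat.cast_sum]
      exact div_self ht.ne'
    have h3 : (β - combEst T x y d) l = -∑ j, (stopN T x y d j : ℝ) / sumStages (stopN T x y d) *
        (infoMatrix (x j) (stopN T x y d j))⁻¹.mulVec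
            (score (x j) (e j) (stopN T x y d j)) l := by
      rw [Pi.sub_apply, h1]
      simp only [mul_add, Finset.sum_add_distrib, ← Finset.sum_mul]
      rw [h2]
      ring
    rw [h3, neg_mul_neg, Finset.mul_sum]
    refine Finset.sum_congr rfl fun j _ => ?_
    simp only [Matrix.smul_mulVec, Pi.smul_apply, smul_eq_mul]
    have h4 : (fun l => score (x j) (e j) (stopN T x y d j) l / √n) =
        (√n)⁻¹ • score (x j) (e j) (stopN T x y d j) := by
      funext l
      simp [div_eq_inv_mul]
    rw [h4, Matrix.mulVec_smul, Pi.smul_apply, smul_eq_mul]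
    have h5 : (n : ℝ) = √n * √n := (Real.mul_self_sqrt hn'.le).symm
    field_simp
    rw [sq]
    linear_combination ((stopN T x y d j : ℝ) * (infoMatrix (x j) (stopN T x y d j))⁻¹.mulVec
      (score (x j) (e j) (stopN T x y d j)) l) * h5
  have hform : selForm (schurMat (suppInd β)
          ((1 / sumStages (stopN T x y d)) • sumInfo x (stopN T x y d)))
        (fun j => ((n : ℝ) / sumStages (stopN T x y d)) •
          ((stopN T x y d j : ℝ) • (infoMatrix (x j) (stopN T x y d j))⁻¹))
        (fun j l => score (x j) (e j) (stopN T x y d j) l / √n) =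
      n * (quadS T x y d β / totalN T x y d) := by
    have hk : 1 / sumStages (stopN T x y d) ≠ 0 := by positivity
    have h6 : (fun l : {l : Fin p // suppInd β l = 1} => -√n * (β - combEst T x y d) l) =
        (-√n) • fun l : {l : Fin p // suppInd β l = 1} => (β - combEst T x y d) l := rfl
    unfold selForm
    simp only [hw]
    rw [h6, schurMat_smul hG hk, hQ _ hc, Matrix.smul_mulVec, Matrix.mulVec_smul,
      dotProduct_smul, dotProduct_smul, smul_dotProduct]
    simp only [smul_eq_mul]
    have h7 : sumStages (stopN T x y d) = totalN T x y d := rfl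
    rw [h7]
    have h5 : (n : ℝ) = √n * √n := (Real.mul_self_sqrt hn'.le).symm
    set q := (fun l : {l : Fin p // suppInd β l = 1} => (β - combEst T x y d) l) ⬝ᵥ
        (schurMat (suppInd β) (sumInfo x (stopN T x y d))).mulVec
          (fun l : {l : Fin p // suppInd β l = 1} => (β - combEst T x y d) l)
    linear_combination (-(q / totalN T x y d)) * h5
  rw [hform, mul_le_mul_iff_right₀ hn', ← hν]
  exact ⟨fun h => h.1, fun h => ⟨h, hzero⟩⟩

variable {ι : Type*} {f : Filter ι} {Sig : Matrix (Fin p) (Fin p) ℝ} {k : ι → Fin M → ℕ}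
  {n : ι → ℕ}

theorem tendsto_div_sumStages (hM : 0 < M)
    (hkn : ∀ j, Tendsto (fun i => (k i j : ℝ) / n i) f (𝓝 1)) :
    Tendsto (fun i => (n i : ℝ) / sumStages (k i)) f (𝓝 (1 / M)) := by
  have hM' : (M : ℝ) ≠ 0 := by positivity
  have h1 : Tendsto (fun i => sumStages (k i) / n i) f (𝓝 M) := by
    have h2 := tendsto_finsetSum Finset.univ fun j _ => hkn j
    simp only [Finset.sum_const, Finset.card_univ, Fintype.card_fin, nsmul_eq_mul, mul_one] at h2
    refine h2.congr fun i => ?_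
    rw [← Finset.sum_div, sumStages, Nat.cast_sum]
  have h3 := h1.inv₀ hM'
  rw [← one_div] at h3
  exact h3.congr fun i => inv_div _ _

/-- The average information matrices converge. -/
theorem tendsto_smul_sumInfo (hM : 0 < M)
    (hA1 : ∀ j, Tendsto (fun n : ℕ => (1 / (n : ℝ)) • infoMatrix (x j) n) atTop (𝓝 Sig))
    (hn : Tendsto n f atTop) (hk : ∀ j, Tendsto (fun i => k i j) f atTop)
    (hkn : ∀ j, Tendsto (fun i => (k i j : ℝ) / n i) f (𝓝 1)) :
    Tendsto (fun i => (1 / sumStages (k i)) • sumInfo x (k i)) f (𝓝 Sig) := by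
  have hM' : (M : ℝ) ≠ 0 := by positivity
  have h1 := tendsto_div_sumStages hM hkn
  have h2 : Tendsto (fun i => ∑ j, ((k i j : ℝ) / n i * ((n i : ℝ) / sumStages (k i))) •
      ((1 / (k i j : ℝ)) • infoMatrix (x j) (k i j))) f
      (𝓝 (∑ _j : Fin M, ((1 : ℝ) * (1 / M)) • Sig)) :=
    tendsto_finsetSum _ fun j _ => ((hkn j).mul h1).smul ((hA1 j).comp (hk j))
  have h3 : ∑ _j : Fin M, ((1 : ℝ) * (1 / M)) • Sig = Sig := by
    rw [← Finset.sum_smul]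
    simp [hM']
  rw [h3] at h2
  refine h2.congr' ?_
  filter_upwards [hn.eventually_gt_atTop 0,
    eventually_all.2 fun j => (hk j).eventually_gt_atTop 0] with i hi hki
  rw [sumInfo, Finset.smul_sum]
  refine Finset.sum_congr rfl fun j _ => ?_
  have e1 : (n i : ℝ) ≠ 0 := by positivity
  have e2 : (k i j : ℝ) ≠ 0 := by
    have := hki j
    positivity
  rw [smul_smul]
  congr 1
  field_simp

theorem tendsto_selEig_sumInfo (hp : 0 < p) (hM : 0 < M) (hSig : Sig.PosDef)
    (hA1 : ∀ j, Tendsto (fun n : ℕ => (1 / (n : ℝ)) • infoMatrix (x j) n) atTop (𝓝 Sig))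
    (hn : Tendsto n f atTop) (hk : ∀ j, Tendsto (fun i => k i j) f atTop)
    (hkn : ∀ j, Tendsto (fun i => (k i j : ℝ) / n i) f (𝓝 1)) (c : Fin p → ℕ) :
    Tendsto (fun i => selEig c (sumStages (k i)) (sumInfo x (k i))) f (𝓝 (selEig c 1 Sig)) := by
  refine tendsto_selEig hp c (fun i => (posSemidef_sumInfo x (k i)).isHermitian)
    hSig.isHermitian ?_
  have h := tendsto_smul_sumInfo hM hA1 hn hk hkn
  refine (tendsto_matrix_inv hSig.isUnit h).congr' ?_
  filter_upwards [eventually_isUnit_of_tendsto hSig.isUnit h,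
    eventually_all.2 fun j => (hk j).eventually_gt_atTop 0] with i hi hki
  have hpos : 0 < sumStages (k i) := by
    unfold sumStages
    exact_mod_cast Finset.sum_pos (fun j _ => hki j) ⟨⟨0, hM⟩, Finset.mem_univ _⟩
  have hne : 1 / sumStages (k i) ≠ 0 := by positivity
  have hu : IsUnit (sumInfo x (k i)) := by
    rw [Matrix.isUnit_iff_isUnit_det, Matrix.det_smul, isUnit_iff_ne_zero] at hi
    rw [Matrix.isUnit_iff_isUnit_det, isUnit_iff_ne_zero]
    exact right_ne_zero_of_mul hi
  rw [inv_smul_of_ne_zero hne hu, one_div, inv_inv]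

theorem continuous_selForm {c : Fin p → ℕ} :
    Continuous fun u : (Matrix {l : Fin p // c l = 1} {l : Fin p // c l = 1} ℝ ×
      (Fin M → Matrix (Fin p) (Fin p) ℝ)) × (Fin M → Fin p → ℝ) => selForm u.1.1 u.1.2 u.2 := by
  simp only [selForm, dotProduct, Matrix.mulVec]
  fun_prop

end Combination

/-! ### The limiting chi-square law of the quadratic form -/

section Limit

variable {Ω : Type*} [MeasurableSpace Ω] {P : Measure Ω} [IsProbabilityMeasure P] {p M : ℕ}
  {x : Fin M → ℕ → Fin p → ℝ} {e : Fin M → ℕ → Ω → ℝ} {Sig : Matrix (Fin p) (Fin p) ℝ} {σ : ℝ}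

theorem card_suppInd (β : Fin p → ℝ) :
    Fintype.card {l : Fin p // suppInd β l = 1} = trueP β := by
  rw [Fintype.card_subtype, Finset.card_filter, trueP_eq]
  refine Finset.sum_congr rfl fun l _ => ?_
  rcases suppInd_eq_zero_or_one β l with h | h <;> simp [h]

/-- The quadratic forms of the normalized scores are asymptotically chi-square. -/
theorem tendsto_measureReal_selForm_le (hM : 0 < M) (hσ : 0 < σ) {β : Fin p → ℝ} (hβ : β ≠ 0)
    (he_meas : ∀ j i, Measurable (e j i))
    (he_indep : iIndepFun (fun q : Fin M × ℕ => e q.1 q.2) P)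
    (he_ident : ∀ j i, IdentDistrib (e j i) (e j 0) P P)
    (he_L2 : ∀ j i, MemLp (e j i) 2 P)
    (he_mean : ∀ j i, ∫ ω, e j i ω ∂P = 0)
    (he_var : ∀ j i, variance (e j i) P = σ ^ 2) (hSig : Sig.PosDef)
    (hA1 : ∀ j, Tendsto (fun n : ℕ => (1 / (n : ℝ)) • infoMatrix (x j) n) atTop (𝓝 Sig)) (s : ℝ) :
    Tendsto (fun n : ℕ => P.real {ω | selForm (schurMat (suppInd β) Sig)
      (fun _ : Fin M => (1 / (M : ℝ)) • Sig⁻¹)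
      (fun j l => score (x j) (fun i => e j i ω) n l / √n) ≤ s}) atTop
      (𝓝 ((chiSq (trueP β)).real (Set.Iic (M / σ ^ 2 * s)))) := by
  have hM' : (0 : ℝ) < M := by exact_mod_cast hM
  obtain ⟨R, hR1, hR2⟩ := exists_factor_schurMat (c := suppInd β) hSig
  obtain ⟨Q, hQ⟩ : ∃ Q : Matrix {l : Fin p // suppInd β l = 1} (Fin p) ℝ,
    Q = Sig⁻¹.submatrix Subtype.val id := ⟨_, rfl⟩
  -- `Q` consists of the selected rows of `Σ⁻¹`, so `Q Σ Qᵀ` is the selected block of `Σ⁻¹`, which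
  -- `R` normalizes: `W Σ Wᵀ = 1`.
  obtain ⟨W, hW⟩ : ∃ W : Matrix {l : Fin p // suppInd β l = 1} (Fin p) ℝ, W = R * Q := ⟨_, rfl⟩
  have hSinv : Sig⁻¹ * Sig = 1 :=
    Matrix.nonsing_inv_mul _ ((Matrix.isUnit_iff_isUnit_det _).1 hSig.isUnit)
  have hST : Sig⁻¹.transpose = Sig⁻¹ := by
    have := hSig.inv.isHermitian
    rwa [Matrix.IsHermitian, Matrix.conjTranspose_eq_transpose_of_trivial] at this
  have hWS : W * Sig * W.transpose = 1 := by
    have h2 : Q * Sig = (1 : Matrix (Fin p) (Fin p) ℝ).submatrix Subtype.val id := by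
      rw [← hSinv, hQ]
      exact (Matrix.submatrix_mul _ _ _ _ _ Function.bijective_id).symm
    have h1 : Q * Sig * Q.transpose =
        Sig⁻¹.toBlock (fun l => suppInd β l = 1) (fun l => suppInd β l = 1) := by
      rw [h2, hQ, Matrix.transpose_submatrix, hST,
        ← Matrix.submatrix_mul _ _ _ _ _ Function.bijective_id, Matrix.one_mul]
      rfl
    rw [hW, Matrix.transpose_mul, ← hR2, ← h1]
    simp only [Matrix.mul_assoc]
  -- The factor `1 / √M` gives each procedure asymptotic covariance `1 / M`, so that the `M` of them
  -- add up to the identity.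
  set z : Fin M → ℕ → EuclideanSpace ℝ {l : Fin p // suppInd β l = 1} :=
    fun j i => WithLp.toLp 2 ((√(M : ℝ))⁻¹ • W.mulVec (x j i)) with hz
  have hsM : √(M : ℝ) * √(M : ℝ) = M := Real.mul_self_sqrt hM'.le
  have hsM0 : 0 < √(M : ℝ) := Real.sqrt_pos.2 hM'
  have hinner : ∀ j i (t : EuclideanSpace ℝ {l : Fin p // suppInd β l = 1}),
      inner ℝ (z j i) t = (√(M : ℝ))⁻¹ * (x j i ⬝ᵥ W.transpose.mulVec t.ofLp) := by
    intro j i t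
    rw [EuclideanSpace.inner_eq_star_dotProduct, hz]
    simp only [star_trivial, dotProduct_smul, smul_eq_mul]
    rw [Matrix.dotProduct_mulVec, ← Matrix.mulVec_transpose, dotProduct_comm]
  have hlim : ∀ j t, Tendsto
      (fun n : ℕ => 1 / (n : ℝ) * ∑ i ∈ Finset.range n, (inner ℝ (z j i) t) ^ 2)
      atTop (𝓝 ((1 / M : ℝ) * ‖t‖ ^ 2)) := by
    intro j t
    set v := W.transpose.mulVec t.ofLp with hv
    have hc : Continuous fun A : Matrix (Fin p) (Fin p) ℝ => v ⬝ᵥ A.mulVec v := by fun_prop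
    have h1 := ((hc.tendsto Sig).comp (hA1 j)).const_mul (1 / M : ℝ)
    have h2 : v ⬝ᵥ Sig.mulVec v = ‖t‖ ^ 2 := by
      rw [hv, Matrix.mulVec_mulVec, Matrix.dotProduct_mulVec, ← Matrix.mulVec_transpose,
        Matrix.mulVec_mulVec, Matrix.transpose_mul, Matrix.transpose_transpose,
        EuclideanSpace.real_norm_sq_eq]
      have hSigT : Sig.transpose = Sig := by
        have := hSig.isHermitian
        rwa [Matrix.IsHermitian, Matrix.conjTranspose_eq_transpose_of_trivial] at this
      rw [hSigT, hWS, Matrix.one_mulVec]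
      simp only [dotProduct, sq]
    rw [h2] at h1
    refine h1.congr fun n => ?_
    simp only [Function.comp, Matrix.smul_mulVec, dotProduct_smul, smul_eq_mul,
      dotProduct_infoMatrix_mulVec, hinner, mul_pow, ← Finset.mul_sum]
    have h3 : ((√(M : ℝ))⁻¹) ^ 2 = 1 / M := by
      rw [inv_pow, sq, hsM, one_div]
    rw [h3]
    ring
  have hclt := tendsto_measureReal_norm_sq_le (P := P)
    (ι := {l : Fin p // suppInd β l = 1}) (by rw [card_suppInd]; exact trueP_pos hβ)
    (ξ := fun j i ω => e j i ω / σ) (fun j i => (he_meas j i).div_const σ)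
    (he_indep.comp (fun _ t => t / σ) fun _ => measurable_id.div_const σ)
    (fun j i => (he_ident j i).comp (measurable_id.div_const σ))
    (fun j i => by rw [integral_div, he_mean, zero_div])
    (fun j i => by
      simp only [div_pow]
      rw [integral_div, integral_sq_of_variance (he_L2 j) (he_mean j) (he_var j),
        div_self (by positivity)])
    z (fun _ => 1 / M) (by simp [hM'.ne']) hlim (M / σ ^ 2 * s)
  rw [card_suppInd] at hclt
  refine hclt.congr fun n => ?_
  congr 1
  ext ω
  set S : Fin p → ℝ := ∑ j, fun l => score (x j) (fun i => e j i ω) n l / √n with hS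
  have hsum : ∑ j, ∑ i ∈ Finset.range n, (e j i ω / σ / √n) • z j i =
      WithLp.toLp 2 ((√(M : ℝ))⁻¹ • σ⁻¹ • W.mulVec S) := by
    ext l
    simp only [WithLp.ofLp_sum, WithLp.ofLp_smul, Finset.sum_apply, Pi.smul_apply, smul_eq_mul, hz,
      Matrix.mulVec, dotProduct, hS, score, Finset.mul_sum, Finset.sum_div]
    rw [Finset.sum_comm (s := (Finset.univ : Finset (Fin p)))]
    refine Finset.sum_congr rfl fun j _ => ?_
    rw [Finset.sum_comm]
    refine Finset.sum_congr rfl fun i _ => Finset.sum_congr rfl fun m _ => ?_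
    field_simp
  have hnorm : ‖∑ j, ∑ i ∈ Finset.range n, (e j i ω / σ / √n) • z j i‖ ^ 2 =
      1 / (M * σ ^ 2) * (W.mulVec S ⬝ᵥ W.mulVec S) := by
    rw [hsum, EuclideanSpace.real_norm_sq_eq]
    simp only [Pi.smul_apply, smul_eq_mul, dotProduct, Finset.mul_sum]
    refine Finset.sum_congr rfl fun l _ => ?_
    have h3 : ((√(M : ℝ))⁻¹) ^ 2 = 1 / M := by
      rw [inv_pow, sq, hsM, one_div]
    rw [mul_pow, mul_pow, h3]
    field_simp
  have hsel : selForm (schurMat (suppInd β) Sig) (fun _ : Fin M => (1 / (M : ℝ)) • Sig⁻¹)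
      (fun j l => score (x j) (fun i => e j i ω) n l / √n) =
      1 / (M : ℝ) ^ 2 * (W.mulVec S ⬝ᵥ W.mulVec S) := by
    have h4 : (fun l : {l : Fin p // suppInd β l = 1} => ∑ j : Fin M, ((1 / (M : ℝ)) • Sig⁻¹).mulVec
        (fun l => score (x j) (fun i => e j i ω) n l / √n) l) =
        (1 / (M : ℝ)) • Q.mulVec S := by
      funext l
      rw [Pi.smul_apply, hS, Matrix.mulVec_sum, Finset.sum_apply, Finset.smul_sum]
      refine Finset.sum_congr rfl fun j _ => ?_
      rw [Matrix.smul_mulVec, Pi.smul_apply, hQ]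
      rfl
    unfold selForm
    rw [h4, ← hR1, Matrix.mulVec_smul, dotProduct_smul, smul_dotProduct, ← Matrix.mulVec_mulVec,
      Matrix.dotProduct_mulVec, Matrix.vecMul_transpose, Matrix.mulVec_mulVec, ← hW]
    simp only [smul_eq_mul]
    ring
  simp only [Set.mem_ofPred_eq]
  rw [hnorm, hsel]
  set v := W.mulVec S ⬝ᵥ W.mulVec S
  -- The form is `‖W S‖² / M²` while the standardized squared norm is `‖W S‖² / (M σ²)`; the ratio
  -- is the factor `M / σ²` in the threshold.
  have h5 : 1 / ((M : ℝ) * σ ^ 2) * v = M / σ ^ 2 * (1 / (M : ℝ) ^ 2 * v) := by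
    field_simp
  rw [h5]
  exact mul_le_mul_iff_right₀ (by positivity)

end Limit

/-! ### Convergence of the coverage probability -/

section Coverage

variable {Ω : Type*} [MeasurableSpace Ω] {P : Measure Ω} [IsProbabilityMeasure P] {p M : ℕ}
  {x : Fin M → ℕ → Fin p → ℝ} {e : Fin M → ℕ → Ω → ℝ} {Sig : Matrix (Fin p) (Fin p) ℝ} {σ : ℝ}

/-- As stages are countable, measurability at each fixed stage gives joint measurability on `ℕ × Ω`,
and a random stage can be inserted. -/
theorem measurable_ind_comp (T : Tuning) (x : ℕ → Fin p → ℝ) {Y : Ω → ℕ → ℝ}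
    (hY : ∀ i, Measurable fun ω => Y ω i) {N : Ω → ℕ} (hN : Measurable N) :
    Measurable fun ω => ind T x (Y ω) (N ω) := by
  obtain ⟨F, hF⟩ : ∃ F : ℕ × Ω → Fin p → ℕ, ∀ n ω, F (n, ω) = ind T x (Y ω) n :=
    ⟨fun q => ind T x (Y q.2) q.1, fun _ _ => rfl⟩
  have h : Measurable F := by
    refine measurable_from_prod_countable_right fun n => ?_
    simp only [hF]
    exact measurable_ind T x fun i _ => hY i
  have h2 := h.comp (hN.prodMk measurable_id)
  simpa only [Function.comp_def, hF, id] using h2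

theorem iIndepFun_row (he_indep : iIndepFun (fun q : Fin M × ℕ => e q.1 q.2) P) (j : Fin M) :
    iIndepFun (e j) P :=
  he_indep.precomp (g := fun i : ℕ => (j, i)) fun _ _ h => (Prod.ext_iff.1 h).2

theorem tendsto_average_sq
    (hA1 : ∀ j, Tendsto (fun n : ℕ => (1 / (n : ℝ)) • infoMatrix (x j) n) atTop (𝓝 Sig))
    (j : Fin M) (l : Fin p) :
    Tendsto (fun n : ℕ => 1 / (n : ℝ) * ∑ i ∈ Finset.range n, x j i l ^ 2) atTop
      (𝓝 (Sig l l)) := by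
  have h := tendsto_pi_nhds.1 (tendsto_pi_nhds.1 (hA1 j) l) l
  refine h.congr fun n => ?_
  rw [Matrix.smul_apply, infoMatrix_apply, smul_eq_mul]
  simp only [sq]

/-- The normalized scores are bounded in probability. -/
theorem exists_measureReal_lt_norm_score_le
    (he_meas : ∀ j i, Measurable (e j i))
    (he_indep : iIndepFun (fun q : Fin M × ℕ => e q.1 q.2) P)
    (he_L2 : ∀ j i, MemLp (e j i) 2 P)
    (he_mean : ∀ j i, ∫ ω, e j i ω ∂P = 0)
    (he_var : ∀ j i, variance (e j i) P = σ ^ 2)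
    (hA1 : ∀ j, Tendsto (fun n : ℕ => (1 / (n : ℝ)) • infoMatrix (x j) n) atTop (𝓝 Sig))
    {η : ℝ} (hη : 0 < η) :
    ∃ K : ℝ, ∀ n : ℕ, 0 < n → P.real {ω | K < ‖fun (j : Fin M) (l : Fin p) =>
      score (x j) (fun i => e j i ω) n l / √n‖} ≤ η := by
  choose C hC0 hC using fun j => exists_sum_sq_le (hA1 j)
  set D := ∑ j, ∑ _l : Fin p, σ ^ 2 * C j with hD
  have hD0 : 0 ≤ D := Finset.sum_nonneg fun j _ => Finset.sum_nonneg fun _ _ =>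
    mul_nonneg (sq_nonneg _) (hC0 j)
  -- Chebyshev's bound `D / K²` must not exceed `η`; the summand `1` keeps `K` positive when `D =
  -- 0`.
  set K := √(D / η) + 1 with hK
  have hK0 : 0 < K := by positivity
  have hDK : D / K ^ 2 ≤ η := by
    rw [div_le_iff₀ (by positivity), ← div_le_iff₀' hη]
    calc D / η = √(D / η) ^ 2 := (Real.sq_sqrt (by positivity)).symm
      _ ≤ K ^ 2 := by
        gcongr
        linarith
  refine ⟨K, fun n hn => ?_⟩
  have hsub : {ω | K < ‖fun (j : Fin M) (l : Fin p) =>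
      score (x j) (fun i => e j i ω) n l / √n‖} ⊆
      ⋃ j, ⋃ l, {ω | K < |(∑ i ∈ Finset.range n, x j i l * e j i ω) / √n|} := by
    intro ω hω
    by_contra hcon
    simp only [Set.mem_iUnion, Set.mem_ofPred_eq, not_exists, not_lt] at hcon
    have hω' : K < _ := hω
    refine absurd hω' (not_lt.2 ?_)
    rw [pi_norm_le_iff_of_nonneg hK0.le]
    intro j
    rw [pi_norm_le_iff_of_nonneg hK0.le]
    intro l
    exact hcon j l
  calc P.real _ ≤ P.real (⋃ j, ⋃ l, {ω | K < |(∑ i ∈ Finset.range n, x j i l * e j i ω) / √n|}) :=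
        measureReal_mono hsub
    _ ≤ ∑ j, P.real (⋃ l, {ω | K < |(∑ i ∈ Finset.range n, x j i l * e j i ω) / √n|}) :=
        measureReal_iUnion_fintype_le _
    _ ≤ ∑ j, ∑ l, P.real {ω | K < |(∑ i ∈ Finset.range n, x j i l * e j i ω) / √n|} :=
        Finset.sum_le_sum fun j _ => measureReal_iUnion_fintype_le _
    _ ≤ ∑ j, ∑ _l : Fin p, σ ^ 2 * C j / K ^ 2 :=
        Finset.sum_le_sum fun j _ => Finset.sum_le_sum fun l _ =>
          measureReal_lt_abs_sum_div_sqrt_le (he_meas j) (iIndepFun_row he_indep j) (he_L2 j)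
            (he_mean j) (he_var j) (fun i => x j i l) (hC j l) hn hK0
    _ = D / K ^ 2 := by simp only [hD, Finset.sum_div]
    _ ≤ η := hDK

variable {T : Tuning} {β : Fin p → ℝ} {Y : Ω → Fin M → ℕ → ℝ}

/-- The coverage probability converges, once the stopping times are of order `c / d²`. -/
theorem tendsto_measureReal_mem_confSet (hM : 0 < M) (hσ : 0 < σ) (hβ : β ≠ 0)
    (he_meas : ∀ j i, Measurable (e j i))
    (he_indep : iIndepFun (fun q : Fin M × ℕ => e q.1 q.2) P)
    (he_ident : ∀ j i, IdentDistrib (e j i) (e j 0) P P)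
    (he_L2 : ∀ j i, MemLp (e j i) 2 P)
    (he_mean : ∀ j i, ∫ ω, e j i ω ∂P = 0)
    (he_var : ∀ j i, variance (e j i) P = σ ^ 2) (hSig : Sig.PosDef)
    (hA1 : ∀ j, Tendsto (fun n : ℕ => (1 / (n : ℝ)) • infoMatrix (x j) n) atTop (𝓝 Sig))
    (hY : ∀ ω j i, Y ω j i = x j i ⬝ᵥ β + e j i ω)
    (hind : ∀ᵐ ω ∂P, ∀ j, ∀ᶠ n in atTop, ind T (x j) (Y ω j) n = suppInd β)
    (hNtop : ∀ᵐ ω ∂P, ∀ j, Tendsto (fun d => stopN T x (Y ω) d j) (𝓝[>] 0) atTop)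
    {c : ℝ} (hc : 0 < c)
    (hNc : ∀ᵐ ω ∂P, ∀ j, Tendsto (fun d => d ^ 2 * (stopN T x (Y ω) d j : ℝ)) (𝓝[>] 0) (𝓝 c)) :
    Tendsto (fun d => P.real {ω | β ∈ confSet T x (Y ω) d}) (𝓝[>] 0)
      (𝓝 ((chiSq (trueP β)).real (Set.Iic (M / σ ^ 2 * (c / selEig (suppInd β) 1 Sig))))) := by
  obtain ⟨l₀, hl₀⟩ := Function.ne_iff.1 hβ
  have hp : 0 < p := l₀.pos
  have hμ : 0 < selEig (suppInd β) 1 Sig :=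
    selEig_pos one_pos hSig (l := l₀) (by
      have : β l₀ ≠ 0 := hl₀
      simp [suppInd, this])
  have hYm : ∀ j i, Measurable fun ω => Y ω j i := by
    intro j i
    simp only [hY]
    exact (he_meas j i).const_add _
  have hNm : ∀ d j, Measurable fun ω => stopN T x (Y ω) d j := fun d j =>
    measurable_stopTime T (x j) M d (hYm j)
  -- the deterministic sample size
  set n : ℝ → ℕ := fun d => ⌊c * (d ^ 2)⁻¹⌋₊ with hn_def
  have hinv : Tendsto (fun d : ℝ => (d ^ 2)⁻¹) (𝓝[>] 0) atTop := by
    refine tendsto_inv_nhdsGT_zero.comp (tendsto_nhdsWithin_iff.2 ⟨?_, ?_⟩)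
    · have : Tendsto (fun d : ℝ => d ^ 2) (𝓝 0) (𝓝 (0 ^ 2)) := (continuous_pow 2).tendsto 0
      rw [zero_pow two_ne_zero] at this
      exact this.mono_left nhdsWithin_le_nhds
    · filter_upwards [self_mem_nhdsWithin] with d hd
      exact pow_pos (Set.mem_Ioi.1 hd) 2
  have hn_top : Tendsto n (𝓝[>] 0) atTop :=
    tendsto_nat_floor_atTop.comp (hinv.const_mul_atTop hc)
  have hn_c : Tendsto (fun d => d ^ 2 * (n d : ℝ)) (𝓝[>] 0) (𝓝 c) := by
    refine ((tendsto_nat_floor_mul_div_atTop hc.le).comp hinv).congr fun d => ?_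
    simp only [Function.comp, hn_def, div_inv_eq_mul]
    ring
  have hNn : ∀ᵐ ω ∂P, ∀ j,
      Tendsto (fun d => (stopN T x (Y ω) d j : ℝ) / n d) (𝓝[>] 0) (𝓝 1) := by
    filter_upwards [hNc] with ω hω j
    have h := (hω j).div hn_c hc.ne'
    rw [div_self hc.ne'] at h
    refine h.congr' ?_
    filter_upwards [self_mem_nhdsWithin] with d hd
    have hd' : d ^ 2 ≠ 0 := (pow_pos (Set.mem_Ioi.1 hd) 2).ne'
    exact mul_div_mul_left _ _ hd'
  -- the coefficients of the quadratic forms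
  set A : (Fin M → ℕ) → Matrix {l : Fin p // suppInd β l = 1} {l : Fin p // suppInd β l = 1} ℝ :=
    fun k => schurMat (suppInd β) ((1 / sumStages k) • sumInfo x k) with hA
  set B : ℝ → (Fin M → ℕ) → Fin M → Matrix (Fin p) (Fin p) ℝ := fun d k j =>
    ((n d : ℝ) / sumStages k) • ((k j : ℝ) • (infoMatrix (x j) (k j))⁻¹) with hB
  set r : ℝ → (Fin M → ℕ) → ℝ := fun d k =>
    n d * (d ^ 2 / selEig (suppInd β) (sumStages k) (sumInfo x k)) with hr
  set A₀ := schurMat (suppInd β) Sig with hA₀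
  set B₀ : Fin M → Matrix (Fin p) (Fin p) ℝ := fun _ => (1 / (M : ℝ)) • Sig⁻¹ with hB₀
  set r₀ := c / selEig (suppInd β) 1 Sig with hr₀
  have hcoef : ∀ᵐ ω ∂P, Tendsto (fun d =>
      (A (stopN T x (Y ω) d), B d (stopN T x (Y ω) d), r d (stopN T x (Y ω) d))) (𝓝[>] 0)
      (𝓝 (A₀, B₀, r₀)) := by
    filter_upwards [hNtop, hNn] with ω h1 h2
    refine Tendsto.prodMk_nhds ?_ (Tendsto.prodMk_nhds ?_ ?_)
    · exact tendsto_schurMat hSig (tendsto_smul_sumInfo hM hA1 hn_top h1 h2)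
    · refine tendsto_pi_nhds.2 fun j => (tendsto_div_sumStages hM h2).smul ?_
      exact (tendsto_smul_inv_infoMatrix hSig (hA1 j)).comp (h1 j)
    · have h3 := hn_c.div (tendsto_selEig_sumInfo hp hM hSig hA1 hn_top h1 h2 (suppInd β)) hμ.ne'
      refine h3.congr fun d => ?_
      simp only [hr, Pi.div_apply]
      ring
  -- the good event
  set good : Set ((Fin M → ℕ) × (Fin M → Fin p → ℕ)) := {z | (∀ j, z.2 j = suppInd β) ∧
    (∀ j, IsUnit (infoMatrix (x j) (z.1 j))) ∧ (sumInfo x z.1).PosDef ∧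
    0 < sumStages z.1} with hgood
  set Z : ℝ → Ω → (Fin M → ℕ) × (Fin M → Fin p → ℕ) := fun d ω =>
    (stopN T x (Y ω) d, fun j => ind T (x j) (Y ω j) (stopN T x (Y ω) d j)) with hZ
  have hZm : ∀ d, Measurable (Z d) := fun d =>
    (measurable_pi_lambda _ fun j => hNm d j).prodMk
      (measurable_pi_lambda _ fun j => measurable_ind_comp T (x j) (hYm j) (hNm d j))
  have hbad : Tendsto (fun d => P.real {ω | Z d ω ∈ goodᶜ}) (𝓝[>] 0) (𝓝 0) := by
    refine tendsto_measureReal_of_ae_eventually hZm ?_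
    filter_upwards [hNtop, hind] with ω h1 h2
    filter_upwards [eventually_all.2 fun j => (h1 j).eventually (h2 j),
      eventually_all.2 fun j => (h1 j).eventually (eventually_isUnit_infoMatrix hSig (hA1 j)),
      eventually_all.2 fun j => (h1 j).eventually_gt_atTop 0] with d e1 e2 e3
    have hne : (Finset.univ : Finset (Fin M)).Nonempty := ⟨⟨0, hM⟩, Finset.mem_univ _⟩
    rw [Set.mem_compl_iff, not_not]
    refine ⟨e1, e2, Matrix.posDef_sum hne fun j _ => posDef_infoMatrix (e2 j), ?_⟩
    unfold sumStages
    exact_mod_cast Finset.sum_pos (fun j _ => e3 j) hne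
  -- the scores at the deterministic sample size and their increments
  set U : ℝ → Ω → Fin M → Fin p → ℝ := fun d ω j l =>
    score (x j) (fun i => e j i ω) (n d) l / √(n d) with hU
  set D : ℝ → Ω → Fin M → Fin p → ℝ := fun d ω j l =>
    (score (x j) (fun i => e j i ω) (stopN T x (Y ω) d j) l -
      score (x j) (fun i => e j i ω) (n d) l) / √(n d) with hD
  have hUD : ∀ d ω, (fun j l => score (x j) (fun i => e j i ω) (stopN T x (Y ω) d j) l / √(n d)) =
      U d ω + D d ω := by
    intro d ω
    funext j l
    simp only [hU, hD, Pi.add_apply]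
    ring
  -- All that converges in probability to constants is collected in `R`: coefficients, threshold
  -- and, by Anscombe, the increments `D`. The scores `U` at deterministic times are only tight.
  set R : ℝ → Ω → (Matrix {l : Fin p // suppInd β l = 1} {l : Fin p // suppInd β l = 1} ℝ ×
      (Fin M → Matrix (Fin p) (Fin p) ℝ) × ℝ) × (Fin M → Fin p → ℝ) := fun d ω =>
    ((A (stopN T x (Y ω) d), B d (stopN T x (Y ω) d), r d (stopN T x (Y ω) d)), D d ω) with hR
  have hRlim : ∀ V ∈ 𝓝 (((A₀, B₀, r₀), 0) : (Matrix {l : Fin p // suppInd β l = 1}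
      {l : Fin p // suppInd β l = 1} ℝ × (Fin M → Matrix (Fin p) (Fin p) ℝ) × ℝ) ×
        (Fin M → Fin p → ℝ)), Tendsto (fun d => P.real {ω | R d ω ∉ V}) (𝓝[>] 0) (𝓝 0) := by
    intro V hV
    obtain ⟨V₁, hV₁, V₂, hV₂, hV12⟩ := mem_nhds_prod_iff.1 hV
    obtain ⟨κ, hκ, hκV⟩ := Metric.mem_nhds_iff.1 hV₂
    have t1 : Tendsto (fun d => P.real {ω | Z d ω ∈
        {z : (Fin M → ℕ) × (Fin M → Fin p → ℕ) | (A z.1, B d z.1, r d z.1) ∉ V₁}}) (𝓝[>] 0)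
        (𝓝 0) := by
      refine tendsto_measureReal_of_ae_eventually hZm ?_
      filter_upwards [hcoef] with ω hω
      filter_upwards [hω.eventually hV₁] with d hd
      exact not_not.2 hd
    have t2 : Tendsto (fun d => P.real (⋃ j, ⋃ l, {ω | κ ≤ |D d ω j l|})) (𝓝[>] 0) (𝓝 0) := by
      refine tendsto_measureReal_iUnion fun j => tendsto_measureReal_iUnion fun l => ?_
      exact tendsto_measureReal_randomIndex (he_meas j) (iIndepFun_row he_indep j) (he_L2 j)
        (he_mean j) (he_var j) (fun i => x j i l) (tendsto_average_sq hA1 j l) hn_top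
        (fun d => hNm d j) (hNn.mono fun ω h => h j) hκ
    refine squeeze_zero (fun _ => measureReal_nonneg) (fun d => measureReal_mono ?_)
      (tendsto_measureReal_union t1 t2)
    intro ω hω
    by_contra hcon
    simp only [Set.mem_union, Set.mem_iUnion, Set.mem_ofPred_eq, not_or, not_exists, not_le,
      not_not] at hcon
    refine hω (hV12 ⟨hcon.1, hκV ?_⟩)
    rw [mem_ball_zero_iff, pi_norm_lt_iff hκ]
    exact fun j => (pi_norm_lt_iff hκ).2 fun l => hcon.2 j l
  -- comparison with the limiting quadratic form
  set g : (Fin M → Fin p → ℝ) → (Matrix {l : Fin p // suppInd β l = 1}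
      {l : Fin p // suppInd β l = 1} ℝ × (Fin M → Matrix (Fin p) (Fin p) ℝ) × ℝ) ×
        (Fin M → Fin p → ℝ) → ℝ := fun u v => selForm v.1.1 v.1.2.1 (u + v.2) - v.1.2.2 with hg
  have hgc : Continuous fun u : (Fin M → Fin p → ℝ) × ((Matrix {l : Fin p // suppInd β l = 1}
      {l : Fin p // suppInd β l = 1} ℝ × (Fin M → Matrix (Fin p) (Fin p) ℝ) × ℝ) ×
        (Fin M → Fin p → ℝ)) => g u.1 u.2 := by
    have h1 : Continuous fun u : (Fin M → Fin p → ℝ) × ((Matrix {l : Fin p // suppInd β l = 1}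
        {l : Fin p // suppInd β l = 1} ℝ × (Fin M → Matrix (Fin p) (Fin p) ℝ) × ℝ) ×
          (Fin M → Fin p → ℝ)) => ((u.2.1.1, u.2.1.2.1), u.1 + u.2.2) := by fun_prop
    have h2 := continuous_selForm.comp h1
    exact h2.sub (by fun_prop)
  have htight : ∀ η : ℝ, 0 < η → ∃ K : ℝ, ∀ᶠ d in 𝓝[>] 0, P.real {ω | K < ‖U d ω‖} ≤ η := by
    intro η hη
    obtain ⟨K, hK⟩ := exists_measureReal_lt_norm_score_le he_meas he_indep he_L2 he_mean he_var
      hA1 hη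
    exact ⟨K, (hn_top.eventually_gt_atTop 0).mono fun d hd => hK (n d) hd⟩
  have hcomp := fun η hη => tendsto_measureReal_le_abs_sub (P := P) hgc htight hRlim (η := η) hη
  have hiff : ∀ d ω, 0 < n d → Z d ω ∈ good →
      (β ∈ confSet T x (Y ω) d ↔ g (U d ω) (R d ω) ≤ 0) := by
    rintro d ω hnd ⟨g1, g2, g3, g4⟩
    rw [mem_confSet_iff (e := fun j i => e j i ω) hM (hY ω) g1 g2 g3 g4 hnd, hUD]
    exact sub_nonpos.symm
  have hg₀ : ∀ d ω, g (U d ω) ((A₀, B₀, r₀), 0) = selForm A₀ B₀ (U d ω) - r₀ := by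
    intro d ω
    simp only [hg, add_zero]
  have hF : Continuous fun s => (chiSq (trueP β)).real (Set.Iic (M / σ ^ 2 * s)) :=
    (continuous_chiSq_cdf (trueP_pos hβ)).comp (continuous_const_mul _)
  -- Outside the bad event, and where `g` moves by less than `η`, coverage lies between the limiting
  -- form being at most `r₀ - η` and at most `r₀ + η`.
  refine tendsto_of_squeeze_continuous
    (φ := fun s d => P.real {ω | selForm A₀ B₀ (U d ω) ≤ s})
    (b := fun η d => P.real ({ω | η ≤ |g (U d ω) (R d ω) - g (U d ω) ((A₀, B₀, r₀), 0)|} ∪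
      {ω | Z d ω ∈ goodᶜ})) hF ?_ ?_ ?_ ?_
  · intro s
    exact (tendsto_measureReal_selForm_le hM hσ hβ he_meas he_indep he_ident he_L2 he_mean he_var
      hSig hA1 s).comp hn_top
  · exact fun η hη => tendsto_measureReal_union (hcomp η hη) hbad
  · intro η hη
    filter_upwards [hn_top.eventually_gt_atTop 0] with d hd
    refine (measureReal_mono ?_).trans (measureReal_union_le _ _)
    intro ω hω
    by_contra hcon
    simp only [Set.mem_union, Set.mem_ofPred_eq, not_or, not_le, Set.mem_compl_iff, not_not] at hcon
    obtain ⟨h1, h2, h3⟩ := hcon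
    rw [hiff d ω hd h3] at h1
    have h4 : selForm A₀ B₀ (U d ω) ≤ r₀ - η := hω
    rw [hg₀] at h2
    have h5 := (abs_lt.1 h2).2
    exact h1 (by linarith)
  · intro η hη
    filter_upwards [hn_top.eventually_gt_atTop 0] with d hd
    refine (measureReal_mono ?_).trans (measureReal_union_le _ _)
    intro ω hω
    by_contra hcon
    simp only [Set.mem_union, Set.mem_ofPred_eq, not_or, not_le, Set.mem_compl_iff, not_not] at hcon
    obtain ⟨h1, h2, h3⟩ := hcon
    have h4 := (hiff d ω hd h3).1 hω
    rw [hg₀] at h2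
    have h5 := (abs_lt.1 h2).1
    linarith

end Coverage

/-! ### Almost sure behaviour of the scores and squared errors -/

section Paths

variable {Ω : Type*} [MeasurableSpace Ω] {P : Measure Ω} [IsProbabilityMeasure P] {p : ℕ}
  {x : ℕ → Fin p → ℝ} {e : ℕ → Ω → ℝ} {Sig : Matrix (Fin p) (Fin p) ℝ} {σ δ : ℝ}

theorem ae_tendsto_score_div_rpow (he : ∀ i, Measurable (e i)) (hind : iIndepFun e P)
    (hL2 : ∀ i, MemLp (e i) 2 P) (hmean : ∀ i, ∫ ω, e i ω ∂P = 0)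
    (hvar : ∀ i, variance (e i) P = σ ^ 2)
    (hA1 : Tendsto (fun n : ℕ => (1 / (n : ℝ)) • infoMatrix x n) atTop (𝓝 Sig))
    (hδ : δ < 1 / 2) :
    ∀ᵐ ω ∂P, ∀ l, Tendsto
      (fun n : ℕ => score x (fun i => e i ω) n l / (n : ℝ) ^ (1 - δ)) atTop (𝓝 0) := by
  obtain ⟨C, _, hC⟩ := exists_sum_sq_le hA1
  exact ae_all_iff.2 fun l =>
    ae_tendsto_sum_div_rpow he hind hL2 hmean hvar (fun i => x i l) (hC l) hδ

theorem ae_tendsto_average_sq_error (hind : iIndepFun e P)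
    (hident : ∀ i, IdentDistrib (e i) (e 0) P P)
    (hL2 : ∀ i, MemLp (e i) 2 P) (hmean : ∀ i, ∫ ω, e i ω ∂P = 0)
    (hvar : ∀ i, variance (e i) P = σ ^ 2) :
    ∀ᵐ ω ∂P, Tendsto (fun n : ℕ => (∑ i ∈ Finset.range n, e i ω ^ 2) / n) atTop
      (𝓝 (σ ^ 2)) := by
  have hsq : Measurable fun t : ℝ => t ^ 2 := measurable_id.pow_const 2
  have h := strong_law_ae_real (μ := P) (fun i ω => e i ω ^ 2) (hL2 0).integrable_sq
    (fun i j hij => (hind.indepFun hij).comp hsq hsq) (fun i => (hident i).comp hsq)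
  rwa [integral_sq_of_variance hL2 hmean hvar 0] at h

end Paths

/-! ### Convergence of bounded counts -/

section DominatedCounts

variable {Ω : Type*} [MeasurableSpace Ω] {P : Measure Ω} [IsProbabilityMeasure P]

/-- Bounded counts that are almost surely eventually constant converge, also in mean. -/
theorem tendsto_count_and_integral {ι : Type*} {l : Filter ι} [l.IsCountablyGenerated]
    {f : ι → Ω → ℕ} {k b : ℕ} (hf : ∀ i, Measurable (f i)) (hb : ∀ i ω, f i ω ≤ b)
    (h : ∀ᵐ ω ∂P, ∀ᶠ i in l, f i ω = k) :
    (∀ᵐ ω ∂P, Tendsto (fun i => (f i ω : ℝ)) l (𝓝 (k : ℝ))) ∧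
      Tendsto (fun i => ∫ ω, (f i ω : ℝ) ∂P) l (𝓝 (k : ℝ)) := by
  have h1 : ∀ᵐ ω ∂P, Tendsto (fun i => (f i ω : ℝ)) l (𝓝 (k : ℝ)) := by
    filter_upwards [h] with ω hω
    exact tendsto_const_nhds.congr' (hω.mono fun i hi => (congrArg Nat.cast hi).symm)
  refine ⟨h1, ?_⟩
  have h2 := tendsto_integral_filter_of_dominated_convergence (μ := P) (l := l)
    (F := fun i ω => (f i ω : ℝ)) (f := fun _ => (k : ℝ)) (fun _ => (b : ℝ))
    (Eventually.of_forall fun i =>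
      (measurable_from_top.comp (hf i) : Measurable fun ω => (f i ω : ℝ)).aestronglyMeasurable)
    (Eventually.of_forall fun i => Eventually.of_forall fun ω => by
      rw [Real.norm_natCast]
      exact_mod_cast hb i ω) (integrable_const _) h1
  simpa using h2

end DominatedCounts

end DistSeq

/-! ### Assembly of the theorem -/

theorem theorem3 {Ω : Type*} [MeasurableSpace Ω] (P : Measure Ω) [IsProbabilityMeasure P]
    (p M : ℕ) (hM : 0 < M)
    -- the linear model: fixed design, independent errors, identically distributed in each procedure
    (β₀ : Fin p → ℝ) (hβ₀ : β₀ ≠ 0) (σ : ℝ) (hσ : 0 < σ)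
    (x : Fin M → ℕ → Fin p → ℝ) (e : Fin M → ℕ → Ω → ℝ) (y : Fin M → ℕ → Ω → ℝ)
    (hy : ∀ j i ω, y j i ω = x j i ⬝ᵥ β₀ + e j i ω)
    (he_meas : ∀ j i, Measurable (e j i))
    (he_indep : iIndepFun (fun q : Fin M × ℕ => e q.1 q.2) P)
    (he_ident : ∀ j i, IdentDistrib (e j i) (e j 0) P P)
    (he_L2 : ∀ j i, MemLp (e j i) 2 P)
    (he_mean : ∀ j i, ∫ ω, e j i ω ∂P = 0)
    (he_var : ∀ j i, variance (e j i) P = σ ^ 2)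
    -- condition on the design
    (Sig : Matrix (Fin p) (Fin p) ℝ) (hSig : Sig.PosDef)
    (hA1 : ∀ j, Tendsto (fun n : ℕ => (1 / (n : ℝ)) • DistSeq.infoMatrix (x j) n) atTop (𝓝 Sig))
    -- tuning constants
    (T : DistSeq.Tuning) (hn₀ : p < T.n₀) (hα₀ : 0 < T.α) (hα₁ : T.α < 1)
    (hε : 0 < T.ε) (hγ : 0 < T.γ) (δ : ℝ) (hδ₀ : 0 < δ) (hδ₁ : δ < 1 / 2)
    (hlam₀ : Tendsto (fun n : ℕ => (n : ℝ) ^ (1 / 2 : ℝ) * T.lam n) atTop (𝓝 0))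
    (hlam₁ : Tendsto (fun n : ℕ => (n : ℝ) ^ (1 / 2 + T.γ * δ) * T.lam n) atTop atTop) :
    let Y : Ω → Fin M → ℕ → ℝ := fun ω j i => y j i ω
    let N : ℝ → Ω → ℝ := fun d ω => (DistSeq.totalN T x (Y ω) d : ℝ)
    let p₀ : ℕ := DistSeq.trueP β₀
    let a2 : ℝ := DistSeq.chiSqQuantile p₀ T.α
    let μ : ℝ := DistSeq.lambdaMax (DistSeq.trueInd β₀ * Sig⁻¹ * DistSeq.trueInd β₀)
    -- almost surely, all procedures stop, for every precision
    (∀ᵐ ω ∂P, ∀ d : ℝ, 0 < d → ∀ j, (DistSeq.stopSet T (x j) (Y ω j) M d).Nonempty) ∧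
    -- (1) coverage
    Tendsto (fun d : ℝ => P.real {ω | β₀ ∈ DistSeq.confSet T x (Y ω) d}) (𝓝[>] 0)
      (𝓝 (1 - T.α)) ∧
    -- (2) total sample size, almost surely
    (∀ᵐ ω ∂P, Tendsto (fun d : ℝ => d ^ 2 * N d ω / (a2 * σ ^ 2 * μ)) (𝓝[>] 0) (𝓝 1)) ∧
    -- (3) total sample size, in expectation
    ((∀ᶠ d : ℝ in 𝓝[>] 0, Integrable (N d) P) ∧
      Tendsto (fun d : ℝ => d ^ 2 * (∫ ω, N d ω ∂P) / (a2 * σ ^ 2 * μ)) (𝓝[>] 0) (𝓝 1)) ∧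
    -- the number of selected variables, combined over the procedures and in each procedure
    ((∀ᵐ ω ∂P, Tendsto (fun d : ℝ => (DistSeq.combPHat T x (Y ω) d : ℝ)) (𝓝[>] 0)
        (𝓝 (p₀ : ℝ))) ∧
      Tendsto (fun d : ℝ => ∫ ω, (DistSeq.combPHat T x (Y ω) d : ℝ) ∂P) (𝓝[>] 0)
        (𝓝 (p₀ : ℝ))) ∧
    (∀ j, (∀ᵐ ω ∂P, Tendsto
        (fun d : ℝ => (DistSeq.pHat T (x j) (Y ω j) (DistSeq.stopN T x (Y ω) d j) : ℝ))
        (𝓝[>] 0) (𝓝 (p₀ : ℝ))) ∧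
      Tendsto
        (fun d : ℝ => ∫ ω, (DistSeq.pHat T (x j) (Y ω j) (DistSeq.stopN T x (Y ω) d j) : ℝ) ∂P)
        (𝓝[>] 0) (𝓝 (p₀ : ℝ))) := by

  intro Y N p₀ a2 μ
  have hYe : ∀ ω j i, Y ω j i = x j i ⬝ᵥ β₀ + e j i ω := fun ω j i => hy j i ω
  have hYm : ∀ j i, Measurable fun ω => Y ω j i := by
    intro j i
    simp only [hYe]
    exact (he_meas j i).const_add _
  have hrow := fun j => DistSeq.iIndepFun_row he_indep j
  have hNm : ∀ d j, Measurable fun ω => DistSeq.stopN T x (Y ω) d j := fun d j =>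
    DistSeq.measurable_stopTime T (x j) M d (hYm j)
  have hμ : μ = DistSeq.selEig (DistSeq.suppInd β₀) 1 Sig := by
    simp only [μ, DistSeq.selEig, DistSeq.trueInd_eq, one_smul]
  have hM' : (0 : ℝ) < M := by exact_mod_cast hM
  obtain ⟨l₀, hl₀⟩ := Function.ne_iff.1 hβ₀
  have hμ0 : 0 < μ := by
    rw [hμ]
    refine DistSeq.selEig_pos one_pos hSig (l := l₀) ?_
    have : β₀ l₀ ≠ 0 := hl₀
    simp [DistSeq.suppInd, this]
  have ha2 : 0 < a2 := DistSeq.chiSqQuantile_pos (DistSeq.trueP_pos hβ₀) hα₀ hα₁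
  -- The limit of `d² Nⱼ`, the same for every procedure: dividing the quantile by `M` shares the
  -- total sample size equally.
  set c := σ ^ 2 * (a2 / M * μ) with hc
  have hc0 : 0 < c := by positivity
  have hscore : ∀ᵐ ω ∂P, ∀ j l, Tendsto (fun n : ℕ =>
      DistSeq.score (x j) (fun i => e j i ω) n l / (n : ℝ) ^ (1 - δ)) atTop (𝓝 0) :=
    ae_all_iff.2 fun j => DistSeq.ae_tendsto_score_div_rpow (he_meas j) (hrow j) (he_L2 j)
      (he_mean j) (he_var j) (hA1 j) hδ₁
  have hsq : ∀ᵐ ω ∂P, ∀ j, Tendsto (fun n : ℕ =>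
      (∑ i ∈ Finset.range n, e j i ω ^ 2) / n) atTop (𝓝 (σ ^ 2)) :=
    ae_all_iff.2 fun j => DistSeq.ae_tendsto_average_sq_error (hrow j) (he_ident j) (he_L2 j)
      (he_mean j) (he_var j)
  have hstopped : ∀ᵐ ω ∂P, ∀ j,
      (∀ d : ℝ, 0 < d → (DistSeq.stopSet T (x j) (Y ω j) M d).Nonempty) ∧
      Tendsto (fun d => DistSeq.stopN T x (Y ω) d j) (𝓝[>] 0) atTop ∧
      Tendsto (fun d => d ^ 2 * (DistSeq.stopN T x (Y ω) d j : ℝ)) (𝓝[>] 0) (𝓝 c) := by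
    filter_upwards [hscore, hsq] with ω h1 h2 j
    have h := DistSeq.tendsto_stopTime (M := M) hM hβ₀ hα₀ hα₁ hn₀ hε hγ hδ₀ hlam₀ hlam₁ hSig
      (hA1 j) (hYe ω j) (h1 j) (h2 j)
    rw [← hμ] at h
    exact h
  have hind : ∀ᵐ ω ∂P, ∀ j,
      ∀ᶠ n in atTop, DistSeq.ind T (x j) (Y ω j) n = DistSeq.suppInd β₀ := by
    filter_upwards [hscore] with ω h1 j
    exact DistSeq.eventually_ind_eq hε hγ hδ₀ hlam₀ hlam₁ hSig (hA1 j) (hYe ω j) (h1 j)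
  have hindN : ∀ᵐ ω ∂P, ∀ᶠ d in 𝓝[>] 0, ∀ j,
      DistSeq.ind T (x j) (Y ω j) (DistSeq.stopN T x (Y ω) d j) = DistSeq.suppInd β₀ := by
    filter_upwards [hind, hstopped] with ω h1 h2
    exact eventually_all.2 fun j => (h2 j).2.1.eventually (h1 j)
  have hindm : ∀ d j, Measurable fun ω =>
      DistSeq.ind T (x j) (Y ω j) (DistSeq.stopN T x (Y ω) d j) := fun d j =>
    DistSeq.measurable_ind_comp T (x j) (hYm j) (hNm d j)
  have hL : a2 * σ ^ 2 * μ = ∑ _j : Fin M, c := by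
    rw [Finset.sum_const, Finset.card_univ, Fintype.card_fin, nsmul_eq_mul, hc]
    field_simp
  have hL0 : a2 * σ ^ 2 * μ ≠ 0 := by positivity
  have hNsum : ∀ d ω, N d ω = ∑ j, (DistSeq.stopN T x (Y ω) d j : ℝ) := by
    intro d ω
    simp only [N, DistSeq.totalN, Nat.cast_sum]
  choose B hB using fun j => DistSeq.exists_integral_stopTime_sq_le (P := P) (M := M)
    (Y := fun ω => Y ω j) hM hβ₀ hα₀ hα₁ hn₀ hε hγ hlam₀ hlam₁ hSig (hA1 j)
    (fun ω i => hYe ω j i) (he_meas j) (hrow j) (he_L2 j) (he_mean j) (he_var j)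
    (hstopped.mono fun ω h => (h j).1)
  have hsmall : ∀ᶠ d : ℝ in 𝓝[>] 0, 0 < d ∧ d ≤ 1 := by
    filter_upwards [Ioc_mem_nhdsGT (zero_lt_one' ℝ)] with d hd using hd
  have hint : ∀ᶠ d : ℝ in 𝓝[>] 0, ∀ j,
      Integrable (fun ω => (DistSeq.stopN T x (Y ω) d j : ℝ)) P := by
    filter_upwards [hsmall] with d hd j
    have h1 := ((hB j d hd.1 hd.2).1.integrable one_le_two).const_mul (d ^ 2)⁻¹
    refine h1.congr (Eventually.of_forall fun ω => ?_)
    have hd2 : d ^ 2 ≠ 0 := (pow_pos hd.1 2).ne'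
    exact inv_mul_cancel_left₀ hd2 _
  have hmeanN : ∀ j, Tendsto
      (fun d : ℝ => ∫ ω, d ^ 2 * (DistSeq.stopN T x (Y ω) d j : ℝ) ∂P) (𝓝[>] 0) (𝓝 c) := by
    intro j
    refine DistSeq.tendsto_integral_of_sq_bounded (B := B j)
      (fun d ω => mul_nonneg (sq_nonneg d) (Nat.cast_nonneg _)) ?_ ?_
      (hstopped.mono fun ω h => (h j).2.2)
    · exact hsmall.mono fun d hd => (hB j d hd.1 hd.2).1
    · exact hsmall.mono fun d hd => (hB j d hd.1 hd.2).2
  refine ⟨?_, ?_, ?_, ⟨?_, ?_⟩, ?_, ?_⟩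
  · filter_upwards [hstopped] with ω h d hd j
    exact (h j).1 d hd
  · have h := DistSeq.tendsto_measureReal_mem_confSet hM hσ hβ₀ he_meas he_indep he_ident he_L2
      he_mean he_var hSig hA1 hYe hind (hstopped.mono fun ω h j => (h j).2.1) hc0
      (hstopped.mono fun ω h j => (h j).2.2)
    -- The divisor `M` in the stopping rule cancels the `M` of the pooled form, leaving exactly the
    -- quantile.
    have h1 : (M : ℝ) / σ ^ 2 * (c / DistSeq.selEig (DistSeq.suppInd β₀) 1 Sig) = a2 := by
      rw [← hμ, hc]
      field_simp
    rw [h1, DistSeq.chiSq_Iic_quantile (DistSeq.trueP_pos hβ₀) hα₀ hα₁] at h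
    exact h
  · filter_upwards [hstopped] with ω h
    have h1 := (tendsto_finsetSum Finset.univ fun j _ => (h j).2.2).div_const (a2 * σ ^ 2 * μ)
    rw [← hL, div_self hL0] at h1
    refine h1.congr fun d => ?_
    rw [hNsum, Finset.mul_sum]
  · filter_upwards [hint] with d hd
    have h1 : N d = fun ω => ∑ j, (DistSeq.stopN T x (Y ω) d j : ℝ) := funext (hNsum d)
    rw [h1]
    exact integrable_finsetSum _ fun j _ => hd j
  · have h1 := (tendsto_finsetSum Finset.univ fun j _ => hmeanN j).div_const (a2 * σ ^ 2 * μ)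
    rw [← hL, div_self hL0] at h1
    refine h1.congr' ?_
    filter_upwards [hint] with d hd
    simp only [hNsum]
    rw [integral_finsetSum _ fun j _ => hd j, Finset.mul_sum]
    simp only [integral_const_mul]
  · refine DistSeq.tendsto_count_and_integral (b := p) ?_ ?_ ?_
    · intro d
      simp only [DistSeq.combPHat, DistSeq.combInd]
      exact Finset.measurable_fun_sum _ fun l _ => Finset.measurable_fun_prod _ fun j _ =>
        (measurable_pi_apply l).comp (hindm d j)
    · intro d ω
      calc DistSeq.combPHat T x (Y ω) d ≤ ∑ _l : Fin p, 1 :=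
            Finset.sum_le_sum fun l _ => Finset.prod_le_one' fun j _ =>
              DistSeq.ind_le_one T (x j) (Y ω j) _ l
        _ = p := by simp
    · filter_upwards [hindN] with ω h
      filter_upwards [h] with d hd
      rw [DistSeq.combPHat, DistSeq.combInd_eq_suppInd hM hd]
      rfl
  · intro j
    refine DistSeq.tendsto_count_and_integral (b := p) ?_ ?_ ?_
    · intro d
      simp only [DistSeq.pHat]
      exact Finset.measurable_fun_sum _ fun l _ => (measurable_pi_apply l).comp (hindm d j)
    · exact fun d ω => DistSeq.pHat_le T (x j) (Y ω j) _
    · filter_upwards [hindN] with ω h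
      filter_upwards [h] with d hd
      rw [DistSeq.pHat, hd j]
      rfl
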